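/- Let $M$ and $F$ be complex manifolds, $G$ a compact Lie group with complexification $G_{\mathbb C}$, and suppose that $G_{\mathbb C}$ acts holomorphically on $F$. Let $\pi_P:P\to M$ be a smooth principal $G$-bundle and $E=P\times_G F$. For a connection $A$ on $P$ and a smooth section $\phi$ of $E$, write $\bar\partial^A\phi=\tfrac12(d^A\phi+J_F\circ d^A\phi\circ J_M)$, and let $F_A^{0,2}$ be the $(0,2)$-part of the curvature. Let $\hat{\mathcal S}(P,E)$ be the set of pairs $(A,\phi)$ with $\bar\partial^A\phi=0$ and $F_A^{0,2}=0$ (the first and third vortex equations). The group $\mathcal G_{\mathbb C}$ of smooth sections of $P\times_{\mathrm{Ad}}G_{\mathbb C}$ (complex gauge transformations) acts on pairs by $g(A,\phi)=(g(A),g(\phi))$: if $g(\pi_P(p))=[p,g_p]$ and $\phi(\pi_P(p))=[p,q]$, then $g(\phi)(\pi_P(p))=[p,g_p\cdot q]$, and $g(A)$ is the unique connection on $P$ such that the $\mathfrak g_{\mathbb C}$-valued horizontal form $g(A)-(\mathrm{Ad}_g\circ A-(dg)\,g^{-1})$ has vanishing $(0,1)$-part. Let $H$ be a closed normal subgroup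 of $G$, with complexification $H_{\mathbb C}\subset G_{\mathbb C}$, and suppose that $H_{\mathbb C}$ acts freely on $F$ and that $F'=F/H_{\mathbb C}$ is a quotient complex manifold, that is, $\pi_F:F\to F'$ is a surjective holomorphic submersion whose fibres are the $H_{\mathbb C}$-orbits. Put $G'=G/H$ (with quotient map $\pi_G$, whose holomorphic extension is $(\pi_G)_{\mathbb C}:G_{\mathbb C}\to G'_{\mathbb C}$), $P'=P/H$ (with quotient map $\zeta:P\to P'$), and $E'=P'\times_{G'}F'$, for the induced actions of $G'_{\mathbb C}$ on $F'$ and of $G'$ on $P'$. A connection $A$ on $P$ induces the connection $A'$ on $P'$ with $\zeta^*A'=d\pi_G\circ A$; a section $\phi$ of $E$ induces the section $\phi'$ of $E'$ obtained by composition with $[p,q]\mapsto[\zeta(p),\pi_F(q)]$; and $g\in\mathcal G_{\mathbb C}$ induces $\pi(g)\in\mathcal G'_{\mathbb C}$ by composition with $[p,x]\mapsto[\zeta(p),(\pi_G)_{\mathbb C}(x)]$. Let $\pi(\mathcal G_{\mathbb C})\subset\mathcal G'_{\mathbb C}$ be the set of all $\pi(g)$. Then $(A,\phi)\mapsto(A',\phi')$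 maps $\hat{\mathcal S}(P,E)$ to $\hat{\mathcal S}(P',E')$ and descends to a well-defined map $$\Upsilon:\hat{\mathcal S}(P,E)/\mathcal G_{\mathbb C}\longrightarrow\hat{\mathcal S}(P',E')/\pi(\mathcal G_{\mathbb C}),$$ and $\Upsilon$ is injective. -/

import Mathlib

open scoped Manifold ContDiff

noncomputable section

namespace Vortex

/-! ## Differentials -/

section Differential

variable {EX : Type*} [NormedAddCommGroup EX] [NormedSpace ℝ EX]
  {EY : Type*} [NormedAddCommGroup EY] [NormedSpace ℝ EY]
  {X : Type*} [TopologicalSpace X] [ChartedSpace EX X]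
  {Y : Type*} [TopologicalSpace Y] [ChartedSpace EY Y]

variable (EX EY) in
/-- The differential at `x` of a map `f : X → Y` between real manifolds. As always in Mathlib, the
tangent space of a manifold at a point is its model space (through the preferred chart at
the point). For a complex manifold, whose charts are holomorphic, its complex structure `J` is
therefore the multiplication by `i` on the model space. -/
def dmap (f : X → Y) (x : X) : EX →L[ℝ] EY := mfderiv 𝓘(ℝ, EX) 𝓘(ℝ, EY) f x

end Differential

/-! ## Quotient manifolds -/

section Quotients

variable {𝕜 : Type*} [NontriviallyNormedField 𝕜]
  {EX : Type*} [NormedAddCommGroup EX] [NormedSpace 𝕜 EX]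
  {EY : Type*} [NormedAddCommGroup EY] [NormedSpace 𝕜 EY]
  {X : Type*} [TopologicalSpace X] [ChartedSpace EX X]
  {Y : Type*} [TopologicalSpace Y] [ChartedSpace EY Y]

variable (𝕜 EX EY) in
/-- `f : X → Y` exhibits the manifold `Y` as the quotient manifold of `X` by the equivalence
relation `r`: the map `f` is a surjective submersion (of class `C^n` over `𝕜`), and its fibres are
the equivalence classes of `r`. This determines the set, the topology and the manifold structure
of `Y` up to a unique isomorphism. -/
structure IsManifoldQuotient (n : WithTop ℕ∞) (r : X → X → Prop) (f : X → Y) : Prop where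
  surjective : Function.Surjective f
  submersion : Manifold.IsSubmersion 𝓘(𝕜, EX) 𝓘(𝕜, EY) n f
  fiber : ∀ x y : X, f x = f y ↔ r x y

end Quotients

/-! ## Lie groups and complexifications -/

section LieGroups

variable {EG : Type*} [NormedAddCommGroup EG] [NormedSpace ℝ EG]
  {G : Type*} [TopologicalSpace G] [ChartedSpace EG G] [Group G]
  {EGC : Type*} [NormedAddCommGroup EGC] [NormedSpace ℂ EGC]
  {GC : Type*} [TopologicalSpace GC] [ChartedSpace EGC GC] [Group GC]

variable (EG) in
/-- The adjoint representation `Ad_g`, the differential at `1` of `x ↦ g x g⁻¹`. -/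
def Ad (g : G) : EG →L[ℝ] EG :=
  dmap EG EG (fun x : G => g * x * g⁻¹) 1

/-- `γ` is the one-parameter subgroup `t ↦ exp (t u)`. -/
structure IsOneParam (γ : ℝ → G) (u : EG) : Prop where
  map_add : ∀ s t : ℝ, γ (s + t) = γ s * γ t
  velocity : HasMFDerivAt 𝓘(ℝ, ℝ) 𝓘(ℝ, EG) γ 0 (ContinuousLinearMap.toSpanSingleton ℝ (u : EG))

/-- `dι : 𝔤 → 𝔤_ℂ`, the differential at `1` of a homomorphism `ι : G → G_ℂ`. -/
def lieMap (ι : G →* GC) : EG →L[ℝ] EGC :=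
  dmap EG EGC ι 1

/-- The complex Lie group `GC`, together with `ι : G → GC`, is the complexification of the compact
Lie group `G`: on Lie algebras `𝔤_ℂ = 𝔤 ⊕ i 𝔤`, and the polar decomposition holds, i.e. every
element of `GC` is uniquely of the form `ι k * exp (i v)` with `k ∈ G` and `v ∈ 𝔤`.
(Taking `x = 1` one sees that `ι` is injective.) -/
structure IsComplexification (ι : G →* GC) : Prop where
  smooth : ContMDiff 𝓘(ℝ, EG) 𝓘(ℝ, EGC) ∞ ι
  lie : ∀ z : EGC, ∃! uv : EG × EG, z = lieMap ι uv.1 + Complex.I • lieMap ι uv.2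
  polar : ∀ x : GC, ∃! kv : G × EG, ∃ γ : ℝ → GC,
    IsOneParam γ (Complex.I • lieMap (EGC := EGC) ι kv.2 : EGC) ∧ x = ι kv.1 * γ 1

/-- The Lie algebra of a closed subgroup `H` of `G`, as a subset of `𝔤`. -/
def subgroupLie (H : Subgroup G) : Set (EG) :=
  {u | ∃ γ : ℝ → G, IsOneParam γ u ∧ ∀ t, γ t ∈ H}

variable (EG EGC) in
/-- The complexification `H_ℂ ⊆ G_ℂ` of a closed subgroup `H ⊆ G`: the subgroup generated by
`ι H` and `exp (i 𝔥)`. -/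
def complexifiedSubgroup (ι : G →* GC) (H : Subgroup G) : Subgroup GC :=
  Subgroup.closure
    (ι '' (H : Set G) ∪
      {x | ∃ u ∈ subgroupLie (EG := EG) H, ∃ γ : ℝ → GC,
        IsOneParam γ (Complex.I • lieMap (EGC := EGC) ι u : EGC) ∧ x = γ 1})

end LieGroups

/-! ## Exterior derivative of a 1-form -/

section ExteriorDerivative

variable {V : Type*} [NormedAddCommGroup V] [NormedSpace ℝ V]
  {EP : Type*} [NormedAddCommGroup EP] [NormedSpace ℝ EP]
  {P : Type*} [TopologicalSpace P] [ChartedSpace EP P]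

/-- The `1`-form `A` read in the preferred chart at `p`. -/
def localForm (A : P → EP →L[ℝ] V) (p : P) (y : EP) : EP →L[ℝ] V :=
  (A ((extChartAt 𝓘(ℝ, EP) p).symm y)).comp
    (dmap EP EP (extChartAt 𝓘(ℝ, EP) p).symm y)

/-- The exterior derivative `dA` of a vector-valued `1`-form at `p`, computed in the preferred chart
at `p` (which is also the chart that identifies the tangent space at `p` with the model space):
`dA(v, w) = ∂_v (A w) - ∂_w (A v)`. -/
def extDer (A : P → EP →L[ℝ] V) (p : P)
    (v w : EP) : V :=
  fderiv ℝ (localForm A p) (extChartAt 𝓘(ℝ, EP) p p) v w -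
    fderiv ℝ (localForm A p) (extChartAt 𝓘(ℝ, EP) p p) w v

end ExteriorDerivative

/-! ## Principal bundles and connections -/

section Principal

variable {EG : Type*} [NormedAddCommGroup EG] [NormedSpace ℝ EG]
  {G : Type*} [TopologicalSpace G] [ChartedSpace EG G] [Group G]
  {EM : Type*} [NormedAddCommGroup EM] [NormedSpace ℂ EM]
  {M : Type*} [TopologicalSpace M] [ChartedSpace EM M]
  {EP : Type*} [NormedAddCommGroup EP] [NormedSpace ℝ EP]
  {P : Type*} [TopologicalSpace P] [ChartedSpace EP P] [MulAction Gᵐᵒᵖ P]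

variable (EG G EM EP) in
/-- `π : P → M` is a smooth principal `G`-bundle for the right action `p · g = op g • p`:
the action is smooth and preserves the fibres, and over a neighbourhood `U` of every point of `M`
there is a smooth section `s`, such that `(y, g) ↦ s y · g` is a diffeomorphism from `U × G` to
`π ⁻¹ U`, with inverse `p ↦ (π p, κ p)`. -/
structure IsPrincipalBundle (π : P → M) : Prop where
  smooth_act : ContMDiff (𝓘(ℝ, EP).prod 𝓘(ℝ, EG)) 𝓘(ℝ, EP) ∞
    (fun x : P × G => MulOpposite.op x.2 • x.1)
  smooth_proj : ContMDiff 𝓘(ℝ, EP) 𝓘(ℝ, EM) ∞ π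
  proj_act : ∀ (p : P) (g : G), π (MulOpposite.op g • p) = π p
  locally_trivial : ∀ x : M, ∃ U : Set M, IsOpen U ∧ x ∈ U ∧ ∃ (s : M → P) (κ : P → G),
    ContMDiffOn 𝓘(ℝ, EM) 𝓘(ℝ, EP) ∞ s U ∧ ContMDiffOn 𝓘(ℝ, EP) 𝓘(ℝ, EG) ∞ κ (π ⁻¹' U) ∧
    (∀ y ∈ U, π (s y) = y) ∧
    ∀ p : P, π p ∈ U → ∀ g : G, MulOpposite.op g • s (π p) = p ↔ g = κ p

variable (EG G EP) in
/-- The fundamental vector field at `p`, `ξ ↦ ξ^♯_p`: the differential at `1` of `g ↦ p · g`. -/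
def fundamental (p : P) : EG →L[ℝ] EP :=
  dmap EG EP (fun g : G => MulOpposite.op g • p) 1

variable [IsManifold 𝓘(ℝ, EP) ∞ P]

variable (EG G EP P) in
/-- A connection on `P`: a smooth `𝔤`-valued `1`-form `A` on `P`, with `A (ξ^♯) = ξ` and
`R_g^* A = Ad_{g⁻¹} ∘ A`. -/
structure Connection where
  form : P → EP →L[ℝ] EG
  smooth : ContMDiff 𝓘(ℝ, EP).tangent 𝓘(ℝ, EG) ∞
    (fun v : TangentBundle 𝓘(ℝ, EP) P => form v.proj v.snd)
  vertical : ∀ (p : P) (ξ : EG), form p (fundamental EG G EP p ξ) = ξ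
  equivariant : ∀ (p : P) (g : G) (v : EP),
    form (MulOpposite.op g • p)
      (dmap EP EP (fun p' : P => MulOpposite.op g • p') p v) =
      Ad EG g⁻¹ (form p v)
/-- The horizontal part `v - A(v)^♯` of a tangent vector `v`. -/
def Connection.hor (A : Connection EG G EP P) (p : P) (v : EP) : EP :=
  v - fundamental EG G EP p (A.form p v)

/-- The curvature `F_A` of `A`, as a `𝔤`-valued `2`-form on `P`:
`F_A (v, w) = dA (hor v, hor w)`. -/
def Connection.curvature (A : Connection EG G EP P) (p : P)
    (v w : EP) : EG :=
  extDer A.form p (A.hor p v) (A.hor p w)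

/-- `F_A^{0,2} = 0`. Regarded as a form on `M`, the `(0,2)`-part of `F` is
`F^{0,2}(a, b) = (F(a, b) - F(J a, J b) + i (F(J a, b) + F(a, J b))) / 4`, where `J` is the complex
structure of `M`. A tangent vector of `M` is represented by any of its lifts to `P` (the form `F_A`
being horizontal); below `v'` and `w'` are lifts of the images by `J` of the projections of
`v` and `w`. -/
def Connection.CurvatureZeroTwo (π : P → M) (A : Connection EG G EP P) : Prop :=
  ∀ (p : P) (v w v' w' : EP),
    dmap EP EM π p v' =
      Complex.I • dmap EP EM π p v →
    dmap EP EM π p w' =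
      Complex.I • dmap EP EM π p w →
    A.curvature p v w - A.curvature p v' w' = 0 ∧
      A.curvature p v' w + A.curvature p v w' = 0

end Principal

/-! ## Associated bundles and their sections -/

section Associated

variable {G : Type*} [Group G] {M : Type*} {P : Type*} [MulAction Gᵐᵒᵖ P] {F : Type*}

variable (P) in
/-- The equivalence relation `(p, q) ∼ (p · g, ρ_{g⁻¹} q)` on `P × F`. -/
def assocSetoid (ρ : G →* Equiv.Perm F) : Setoid (P × F) where
  r x y := ∃ g : G, y = (MulOpposite.op g • x.1, ρ g⁻¹ x.2)
  iseqv :=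
    { refl := fun x => ⟨1, by simp⟩
      symm := by
        rintro x y ⟨g, rfl⟩
        refine ⟨g⁻¹, ?_⟩
        simp [smul_smul]
      trans := by
        rintro x y z ⟨g, rfl⟩ ⟨h, rfl⟩
        refine ⟨g * h, ?_⟩
        simp [smul_smul] }

variable (P) in
/-- The associated bundle `P ×_ρ F`. -/
def AssocBundle (ρ : G →* Equiv.Perm F) : Type _ := Quotient (assocSetoid P ρ)

/-- The class `[p, q]` in `P ×_ρ F`. -/
def AssocBundle.mk (ρ : G →* Equiv.Perm F) (p : P) (q : F) : AssocBundle P ρ :=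
  Quotient.mk (assocSetoid P ρ) (p, q)

variable {EP : Type*} [NormedAddCommGroup EP] [NormedSpace ℝ EP]
  [TopologicalSpace P] [ChartedSpace EP P]
  {EF : Type*} [NormedAddCommGroup EF] [NormedSpace ℝ EF]
  [TopologicalSpace F] [ChartedSpace EF F]

variable (EP EF) in
/-- A smooth section of `P ×_ρ F → M`: a map of the form `π p ↦ [p, f p]` for a smooth `f : P → F`.
(When `G` acts freely on `P`, the map `f` is unique, and equivariant.) -/
structure AssocSection (π : P → M) (ρ : G →* Equiv.Perm F) where
  toFun : M → AssocBundle P ρ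
  exists_lift : ∃ f : P → F, ContMDiff 𝓘(ℝ, EP) 𝓘(ℝ, EF) ∞ f ∧
    ∀ p : P, toFun (π p) = AssocBundle.mk ρ p (f p)

/-- The map `f : P → F` with `φ (π p) = [p, f p]`. -/
def AssocSection.lift {π : P → M} {ρ : G →* Equiv.Perm F} (φ : AssocSection EP EF π ρ) : P → F :=
  φ.exists_lift.choose

end Associated

/-! ## The vortex equations and complex gauge transformations -/

section Vortex

variable {EG : Type*} [NormedAddCommGroup EG] [NormedSpace ℝ EG]
  {G : Type*} [TopologicalSpace G] [ChartedSpace EG G] [Group G]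
  {EGC : Type*} [NormedAddCommGroup EGC] [NormedSpace ℂ EGC]
  {GC : Type*} [TopologicalSpace GC] [ChartedSpace EGC GC] [Group GC]
  {EM : Type*} [NormedAddCommGroup EM] [NormedSpace ℂ EM]
  {M : Type*} [TopologicalSpace M] [ChartedSpace EM M]
  {EP : Type*} [NormedAddCommGroup EP] [NormedSpace ℝ EP]
  {P : Type*} [TopologicalSpace P] [ChartedSpace EP P] [MulAction Gᵐᵒᵖ P]
  [IsManifold 𝓘(ℝ, EP) ∞ P]
  {EF : Type*} [NormedAddCommGroup EF] [NormedSpace ℂ EF]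
  {F : Type*} [TopologicalSpace F] [ChartedSpace EF F] [MulAction GC F]

variable (F) in
/-- The action of `G` on `F`, obtained by restricting the action of `G_ℂ`. -/
def actRep (ι : G →* GC) : G →* Equiv.Perm F := (MulAction.toPermHom GC F).comp ι

/-- The action of `G` on `G_ℂ` by conjugation. -/
def conjRep (ι : G →* GC) : G →* Equiv.Perm GC :=
  (MulAut.toPerm GC).comp (MulAut.conj.comp ι)

/-- `ξ ↦ ξ^♭_q`, the infinitesimal action of `𝔤` on `F` at the point `q`. -/
def infAct (ι : G →* GC) (q : F) : EG →L[ℝ] EF :=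
  dmap EG EF (fun g : G => ι g • q) 1

/-- The covariant derivative `d^A φ` of a section, pulled back to `P`:
`v ↦ df (v) + A(v)^♭` at `f p`, where `φ (π p) = [p, f p]`. -/
def covDeriv (ι : G →* GC) {π : P → M} (A : Connection EG G EP P)
    (φ : AssocSection EP EF π (actRep F ι)) (p : P) (v : EP) : EF :=
  dmap EP EF φ.lift p v +
    infAct (EG := EG) (EF := EF) ι (φ.lift p) (A.form p v)

/-- The first vortex equation `∂̄^A φ = 0`, i.e. `d^A φ + J_F ∘ d^A φ ∘ J_M = 0`. Here `w` is any
lift of the image by `J_M` of the projection of `v` to `M`. -/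
def DbarEq (ι : G →* GC) {π : P → M} (A : Connection EG G EP P)
    (φ : AssocSection EP EF π (actRep F ι)) : Prop :=
  ∀ (p : P) (v w : EP),
    dmap EP EM π p w =
      Complex.I • dmap EP EM π p v →
    covDeriv ι A φ p v + Complex.I • covDeriv ι A φ p w = 0

variable (EG EM EP EF F) in
/-- The space `Ŝ(P, E)` of solutions `(A, φ)` of the first and third vortex equations
`∂̄^A φ = 0` and `F_A^{0,2} = 0`, where `E = P ×_G F`. -/
def SolSpace (ι : G →* GC) (π : P → M) : Type _ :=
  {x : Connection EG G EP P × AssocSection EP EF π (actRep F ι) //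
    DbarEq (EM := EM) ι x.1 x.2 ∧ x.1.CurvatureZeroTwo (EM := EM) π}

variable (EGC EP) in
/-- The group `𝒢_ℂ` of complex gauge transformations: sections of `P ×_{Ad} G_ℂ`. -/
abbrev ComplexGauge (ι : G →* GC) (π : P → M) : Type _ := AssocSection EP EGC π (conjRep ι)

/-- The `𝔤_ℂ`-valued `1`-form `Ad_g ∘ A - (dg) g⁻¹` on `P`, where `g : P → G_ℂ`. -/
def gaugeForm (ι : G →* GC) (g : P → GC) (A : Connection EG G EP P) (p : P)
    (v : EP) : EGC :=
  Ad EGC (g p) (lieMap ι (A.form p v)) -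
    dmap EP EGC (fun p' : P => g p' * (g p)⁻¹) p v

/-- `B = g(A)` for a complex gauge transformation `g`: the connection `g(A)` on `P` is the one whose
`(0,1)`-part is that of `Ad_g ∘ A - (dg) g⁻¹`, i.e. `g(A) = (Ad_g ∘ A)^{0,1} - (∂̄g) g⁻¹` up to the
conjugate `(1,0)`-term. The difference `B - (Ad_g ∘ A - (dg) g⁻¹)` is horizontal, hence a form on
`M`, and it is required to have no `(0,1)`-part. -/
def IsGaugeTransform (ι : G →* GC) (π : P → M) (g : P → GC) (A B : Connection EG G EP P) : Prop :=
  ∀ (p : P) (v w : EP),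
    dmap EP EM π p w =
      Complex.I • dmap EP EM π p v →
    (lieMap (EGC := EGC) ι (B.form p v) - gaugeForm ι g A p v) +
      Complex.I • (lieMap (EGC := EGC) ι (B.form p w) - gaugeForm ι g A p w) = 0

variable (EM) in
/-- `y = g(x)` for pairs `x = (A, φ)` and `y = (g(A), g(φ))`; here `g(φ) (π p) = [p, g_p • q]`
if `φ (π p) = [p, q]`. -/
def GaugeRel (ι : G →* GC) (π : P → M) (g : ComplexGauge EGC EP ι π)
    (x y : Connection EG G EP P × AssocSection EP EF π (actRep F ι)) : Prop :=
  IsGaugeTransform (EM := EM) (EGC := EGC) ι π g.lift x.1 y.1 ∧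
    ∀ p : P, y.2.toFun (π p) = AssocBundle.mk (actRep F ι) p (g.lift p • x.2.lift p)

variable (EG EM EP EF F) in
/-- The quotient `Ŝ(P, E) / K` for a subgroup `K` of the group of complex gauge transformations. -/
def SolQuotient (ι : G →* GC) (π : P → M) (K : Set (ComplexGauge EGC EP ι π)) : Type _ :=
  Quot fun x y : SolSpace EG EM EP EF F ι π => ∃ g ∈ K, GaugeRel EM ι π g x.1 y.1

end Vortex

/-! ## Maps induced by the passage to a quotient -/

section Induced

variable {M : Type*}
  {G : Type*} [Group G] {P : Type*} [MulAction Gᵐᵒᵖ P] {X : Type*}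
  {G' : Type*} [Group G'] {P' : Type*} [MulAction G'ᵐᵒᵖ P'] {X' : Type*}
  {EP : Type*} [NormedAddCommGroup EP] [NormedSpace ℝ EP]
  [TopologicalSpace P] [ChartedSpace EP P]
  {EP' : Type*} [NormedAddCommGroup EP'] [NormedSpace ℝ EP']
  [TopologicalSpace P'] [ChartedSpace EP' P']
  {EX : Type*} [NormedAddCommGroup EX] [NormedSpace ℝ EX]
  [TopologicalSpace X] [ChartedSpace EX X]
  {EX' : Type*} [NormedAddCommGroup EX'] [NormedSpace ℝ EX']
  [TopologicalSpace X'] [ChartedSpace EX' X']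

/-- The section `ψ` of `P' ×_{G'} X'` is the composition of the section `φ` of `P ×_G X` with the
bundle map `[p, q] ↦ [ζ p, f q]`. -/
def InducedSection {π : P → M} {ρ : G →* Equiv.Perm X} {π' : P' → M} {ρ' : G' →* Equiv.Perm X'}
    (ζ : P → P') (f : X → X') (φ : AssocSection EP EX π ρ) (ψ : AssocSection EP' EX' π' ρ') :
    Prop :=
  ∀ (x : M) (p : P) (q : X), φ.toFun x = AssocBundle.mk ρ p q →
    ψ.toFun x = AssocBundle.mk ρ' (ζ p) (f q)

variable {EG : Type*} [NormedAddCommGroup EG] [NormedSpace ℝ EG]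
  [TopologicalSpace G] [ChartedSpace EG G]
  {EG' : Type*} [NormedAddCommGroup EG'] [NormedSpace ℝ EG']
  [TopologicalSpace G'] [ChartedSpace EG' G']
  [IsManifold 𝓘(ℝ, EP) ∞ P] [IsManifold 𝓘(ℝ, EP') ∞ P']

/-- `B` is the connection on `P'` induced by the connection `A` on `P`: `ζ^* B = dπ_G ∘ A`. -/
def InducedConnection (πG : G → G') (ζ : P → P') (A : Connection EG G EP P)
    (B : Connection EG' G' EP' P') : Prop :=
  ∀ (p : P) (v : EP),
    B.form (ζ p) (dmap EP EP' ζ p v) = dmap EG EG' πG 1 (A.form p v)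

end Induced

end Vortex

end

/-!
Everything is read on the total spaces. A section of an associated bundle is the same thing as an
equivariant map on `P` (`AssocSection.exists_of_lift`, `AssocSection.lift_smul`), and a pair on the
quotient bundle is induced by a pair on `P` when the two correspond under the quotient maps `ζ`,
`πG`, `πF`. These maps are surjective submersions, so they have smooth local sections
(`HasLocalSections`); therefore smooth maps and `1`-forms descend along them, and both vortex
equations, being natural, descend as well (`exists_inducedConnection`, `exists_inducedSection`,
`curvatureZeroTwo_induced`, `dbarEq_induced`). Holomorphy enters only through the complex linearity
of the differentials (`dmap_I_smul`); all other arguments take place in the real `C^∞` category.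

The polar decompositions of `GC` and `GC'` identify `H_ℂ` with the kernel of `πGC`
(`complexifiedSubgroup_eq_ker`). So `F'` is the quotient of `F` by the free action of this kernel
(`IsFreeKernelQuotient`), which has two consequences.

* The action is infinitesimally free: a vector `ξ` of the Lie algebra of `GC` with `dπGC ξ = 0`
  which acts by zero at some point of `F` vanishes, since its one-parameter subgroup lies in the
  kernel and fixes this point (`IsFreeKernelQuotient.eq_zero_of_orbit`).
* Two smooth maps `a, b : P → F` with the same projection to `F'` satisfy `b = k • a` for a unique
  map `k` to the kernel, and `k` is smooth (`IsFreeKernelQuotient.contMDiff_of_smul_eq`). For a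
  local section `σ` of `πF`, the map `(x, y) ↦ (πGC x, x • σ y)` is an immersion by the first point,
  and its image contains an open set; as a smooth map from a second countable manifold cannot
  raise the dimension, it is a local diffeomorphism, and `k` is read off from its inverse.

For injectivity, let the pairs induced by `(A, f)` and `(B, f₁)` be related by a gauge
transformation that comes from `g` on `P`. Then `g • f` and `f₁` have the same projection to `F'`,
so `f₁ = k • g • f` with `k` smooth, and `k g` is a complex gauge transformation of `P`. It carries
`A` to `B`: the `(0,1)`-part of `B - (Ad_{kg} ∘ A - d(kg) (kg)⁻¹)` is killed by `dπGC`, because the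
induced connections are related, and acts by zero at `f₁`, because both pairs satisfy the first
vortex equation (`covDeriv_gauge`). By infinitesimal freeness it vanishes
(`exists_gaugeRel_of_induced`). Finally, gauge equivalence is an equivalence relation
(`equivalence_gaugeRel`), so the equality of two classes in the quotient is the existence of one
gauge transformation.
-/

namespace Vortex

open Set Filter Topology

/-! ### Restriction of scalars on complex manifolds -/

section RestrictScalars

variable {EX : Type*} [NormedAddCommGroup EX] [NormedSpace ℂ EX]
  {HX : Type*} [TopologicalSpace HX]
  {EY : Type*} [NormedAddCommGroup EY] [NormedSpace ℂ EY]
  {HY : Type*} [TopologicalSpace HY]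
  {X : Type*} [TopologicalSpace X] [ChartedSpace HX X]
  {Y : Type*} [TopologicalSpace Y] [ChartedSpace HY Y]

/-- A holomorphic map is smooth. The models with corners over `ℂ` and `ℝ` are only assumed to have
the same underlying partial equivalence, so that the lemma also covers products. -/
theorem contMDiffOn_complexToReal {I : ModelWithCorners ℂ EX HX} {I' : ModelWithCorners ℝ EX HX}
    {J : ModelWithCorners ℂ EY HY} {J' : ModelWithCorners ℝ EY HY}
    (hI : I'.toPartialEquiv = I.toPartialEquiv) (hJ : J'.toPartialEquiv = J.toPartialEquiv)
    {f : X → Y} {s : Set X} (hf : ContMDiffOn I J ω f s) : ContMDiffOn I' J' ∞ f s := by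
  intro x hx
  have h := contMDiffWithinAt_iff.1 (hf x hx)
  refine contMDiffWithinAt_iff.2 ⟨h.1, ?_⟩
  have h2 := (h.2.restrict_scalars ℝ).of_le (m := ∞) le_top
  have eI : ∀ x : X, extChartAt I' x = extChartAt I x := fun x => by
    simp only [extChartAt, OpenPartialHomeomorph.extend, hI]
  have eJ : ∀ x : Y, extChartAt J' x = extChartAt J x := fun x => by
    simp only [extChartAt, OpenPartialHomeomorph.extend, hJ]
  have eR : range I' = range I := by
    have : (I' : HX → EX) = I := by
      rw [← ModelWithCorners.toPartialEquiv_coe, hI, ModelWithCorners.toPartialEquiv_coe]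
    rw [this]
  rw [eI, eJ, eR]
  exact h2

end RestrictScalars

section RestrictScalarsSelf

variable {EX : Type*} [NormedAddCommGroup EX] [NormedSpace ℂ EX]
  {EY : Type*} [NormedAddCommGroup EY] [NormedSpace ℂ EY]
  {EZ : Type*} [NormedAddCommGroup EZ] [NormedSpace ℂ EZ]
  {X : Type*} [TopologicalSpace X] [ChartedSpace EX X]
  {Y : Type*} [TopologicalSpace Y] [ChartedSpace EY Y]
  {Z : Type*} [TopologicalSpace Z] [ChartedSpace EZ Z]

theorem contMDiff_complexToReal {f : X → Y} (hf : ContMDiff 𝓘(ℂ, EX) 𝓘(ℂ, EY) ω f) :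
    ContMDiff 𝓘(ℝ, EX) 𝓘(ℝ, EY) ∞ f :=
  contMDiffOn_univ.1 (contMDiffOn_complexToReal rfl rfl (contMDiffOn_univ.2 hf))

theorem contMDiff_prod_complexToReal {f : X × Y → Z}
    (hf : ContMDiff (𝓘(ℂ, EX).prod 𝓘(ℂ, EY)) 𝓘(ℂ, EZ) ω f) :
    ContMDiff (𝓘(ℝ, EX).prod 𝓘(ℝ, EY)) 𝓘(ℝ, EZ) ∞ f :=
  contMDiffOn_univ.1 (contMDiffOn_complexToReal rfl rfl (contMDiffOn_univ.2 hf))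

instance isManifold_real_of_complex [IsManifold 𝓘(ℂ, EX) ω X] : IsManifold 𝓘(ℝ, EX) ∞ X := by
  refine isManifold_of_contDiffOn _ _ _ fun e e' he he' => ?_
  have h := (contDiffGroupoid ω 𝓘(ℂ, EX)).compatible he he'
  rw [contDiffGroupoid, mem_groupoid_of_pregroupoid] at h
  exact (ContDiffOn.restrict_scalars ℝ h.1).of_le le_top

instance lieGroup_real_of_complex [Group X] [LieGroup 𝓘(ℂ, EX) ω X] :
    LieGroup 𝓘(ℝ, EX) ∞ X where
  contMDiff_mul := contMDiff_prod_complexToReal (contMDiff_mul 𝓘(ℂ, EX) ω)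
  contMDiff_inv := contMDiff_complexToReal (contMDiff_inv 𝓘(ℂ, EX) ω)

/-- The differential of a holomorphic map is complex linear. -/
theorem dmap_I_smul {f : X → Y} {x : X} (hf : MDifferentiableAt 𝓘(ℂ, EX) 𝓘(ℂ, EY) f x) (v : EX) :
    dmap EX EY f x (Complex.I • v) = Complex.I • dmap EX EY f x v := by
  have h := hf.hasMFDerivAt
  set L : EX →L[ℂ] EY := mfderiv 𝓘(ℂ, EX) 𝓘(ℂ, EY) f x with hL
  have h' : HasMFDerivAt 𝓘(ℝ, EX) 𝓘(ℝ, EY) f x (L.restrictScalars ℝ) :=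
    ⟨h.1, h.2.restrictScalars ℝ⟩
  have e : dmap EX EY f x = L.restrictScalars ℝ := h'.mfderiv
  rw [e]
  simp

end RestrictScalarsSelf

/-! ### Calculus of differentials -/

section Calculus

variable {EX : Type*} [NormedAddCommGroup EX] [NormedSpace ℝ EX]
  {EY : Type*} [NormedAddCommGroup EY] [NormedSpace ℝ EY]
  {EZ : Type*} [NormedAddCommGroup EZ] [NormedSpace ℝ EZ]
  {X : Type*} [TopologicalSpace X] [ChartedSpace EX X]
  {Y : Type*} [TopologicalSpace Y] [ChartedSpace EY Y]
  {Z : Type*} [TopologicalSpace Z] [ChartedSpace EZ Z]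

theorem hasMFDerivAt_dmap {f : X → Y} {x : X} (hf : MDifferentiableAt 𝓘(ℝ, EX) 𝓘(ℝ, EY) f x) :
    HasMFDerivAt 𝓘(ℝ, EX) 𝓘(ℝ, EY) f x (dmap EX EY f x) := hf.hasMFDerivAt

theorem dmap_comp {g : Y → Z} {f : X → Y} {x : X}
    (hg : MDifferentiableAt 𝓘(ℝ, EY) 𝓘(ℝ, EZ) g (f x))
    (hf : MDifferentiableAt 𝓘(ℝ, EX) 𝓘(ℝ, EY) f x) (v : EX) :
    dmap EX EZ (fun y => g (f y)) x v = dmap EY EZ g (f x) (dmap EX EY f x v) := by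
  have h : HasMFDerivAt 𝓘(ℝ, EX) 𝓘(ℝ, EZ) (g ∘ f) x _ := hg.hasMFDerivAt.comp x hf.hasMFDerivAt
  exact congrArg (fun L : EX →L[ℝ] EZ => L v) h.mfderiv

theorem dmap_id (x : X) (v : EX) : dmap EX EX (fun y : X => y) x v = v :=
  congrArg (fun L : EX →L[ℝ] EX => L v) (mfderiv_id (I := 𝓘(ℝ, EX)) (x := x))

theorem dmap_const (y : Y) (x : X) (v : EX) : dmap EX EY (fun _ : X => y) x v = 0 :=
  congrArg (fun L : EX →L[ℝ] EY => L v)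
    (mfderiv_const (I := 𝓘(ℝ, EX)) (I' := 𝓘(ℝ, EY)) (x := x) (c := y))

theorem dmap_congr {f g : X → Y} {x : X} (h : f =ᶠ[𝓝 x] g) : dmap EX EY f x = dmap EX EY g x :=
  h.mfderiv_eq

/-- The Leibniz rule: the differential of `p ↦ m (u p, w p)` is the sum of the two partial
differentials. -/
theorem dmap_two {EW : Type*} [NormedAddCommGroup EW] [NormedSpace ℝ EW]
    {W : Type*} [TopologicalSpace W] [ChartedSpace EW W]
    {m : X × Y → Z} {u : W → X} {w : W → Y} {p : W}
    (hm : MDifferentiableAt (𝓘(ℝ, EX).prod 𝓘(ℝ, EY)) 𝓘(ℝ, EZ) m (u p, w p))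
    (hu : MDifferentiableAt 𝓘(ℝ, EW) 𝓘(ℝ, EX) u p)
    (hw : MDifferentiableAt 𝓘(ℝ, EW) 𝓘(ℝ, EY) w p) (v : EW) :
    dmap EW EZ (fun q => m (u q, w q)) p v =
      dmap EX EZ (fun x => m (x, w p)) (u p) (dmap EW EX u p v) +
        dmap EY EZ (fun y => m (u p, y)) (w p) (dmap EW EY w p v) := by
  have h : HasMFDerivAt 𝓘(ℝ, EW) 𝓘(ℝ, EZ) (m ∘ fun q => (u q, w q)) p _ :=
    HasMFDerivAt.comp p hm.hasMFDerivAt (hu.hasMFDerivAt.prodMk hw.hasMFDerivAt)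
  have h1 := congrArg (fun L : EW →L[ℝ] EZ => L v) h.mfderiv
  exact h1.trans (mfderiv_prod_eq_add_apply hm)

theorem ContMDiff.mdiffAt {f : X → Y} (hf : ContMDiff 𝓘(ℝ, EX) 𝓘(ℝ, EY) ∞ f) (x : X) :
    MDifferentiableAt 𝓘(ℝ, EX) 𝓘(ℝ, EY) f x :=
  (hf x).mdifferentiableAt (by simp)

end Calculus

/-! ### Submersions and local sections -/

section LocalSections

variable {EX : Type*} [NormedAddCommGroup EX] [NormedSpace ℝ EX]
  {HX : Type*} [TopologicalSpace HX]
  {EY : Type*} [NormedAddCommGroup EY] [NormedSpace ℝ EY]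
  {HY : Type*} [TopologicalSpace HY]
  {EZ : Type*} [NormedAddCommGroup EZ] [NormedSpace ℝ EZ]
  {HZ : Type*} [TopologicalSpace HZ]
  {X : Type*} [TopologicalSpace X] [ChartedSpace HX X]
  {Y : Type*} [TopologicalSpace Y] [ChartedSpace HY Y]
  {Z : Type*} [TopologicalSpace Z] [ChartedSpace HZ Z]

/-- A surjective smooth map with a smooth local section through every point of its domain. This is
the only property of (real or holomorphic) quotient maps that the argument uses. -/
structure HasLocalSections (I : ModelWithCorners ℝ EX HX) (J : ModelWithCorners ℝ EY HY)
    (f : X → Y) : Prop where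
  surjective : Function.Surjective f
  smooth : ContMDiff I J ∞ f
  exists_section : ∀ x : X, ∃ U : Set Y, IsOpen U ∧ f x ∈ U ∧ ∃ s : Y → X,
    ContMDiffOn J I ∞ s U ∧ s (f x) = x ∧ ∀ y ∈ U, f (s y) = y

variable {I : ModelWithCorners ℝ EX HX} {J : ModelWithCorners ℝ EY HY}
  {K : ModelWithCorners ℝ EZ HZ}

theorem HasLocalSections.contMDiffAt_of_comp {f : X → Y} (hf : HasLocalSections I J f)
    {h : Y → Z} {x : X} (hh : ContMDiffAt I K ∞ (fun x => h (f x)) x) :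
    ContMDiffAt J K ∞ h (f x) := by
  obtain ⟨U, hU, hxU, s, hs, hsx, hfs⟩ := hf.exists_section x
  have hsU : ContMDiffAt J I ∞ s (f x) := hs.contMDiffAt (hU.mem_nhds hxU)
  have h1 : ContMDiffAt J K ∞ ((fun x => h (f x)) ∘ s) (f x) :=
    ContMDiffAt.comp (f x) (by rw [hsx]; exact hh) hsU
  refine h1.congr_of_eventuallyEq ?_
  filter_upwards [hU.mem_nhds hxU] with y hy
  simp [hfs y hy]

/-- Smooth maps descend along a quotient map. -/
theorem HasLocalSections.contMDiff_of_comp {f : X → Y} (hf : HasLocalSections I J f)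
    {h : Y → Z} (hh : ContMDiff I K ∞ (fun x => h (f x))) : ContMDiff J K ∞ h := by
  intro y
  obtain ⟨x, rfl⟩ := hf.surjective y
  exact hf.contMDiffAt_of_comp (hh x)

theorem HasLocalSections.prodMap {EX' : Type*} [NormedAddCommGroup EX'] [NormedSpace ℝ EX']
    {HX' : Type*} [TopologicalSpace HX']
    {EY' : Type*} [NormedAddCommGroup EY'] [NormedSpace ℝ EY']
    {HY' : Type*} [TopologicalSpace HY']
    {X' : Type*} [TopologicalSpace X'] [ChartedSpace HX' X']
    {Y' : Type*} [TopologicalSpace Y'] [ChartedSpace HY' Y']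
    {I' : ModelWithCorners ℝ EX' HX'} {J' : ModelWithCorners ℝ EY' HY'}
    {f : X → Y} (hf : HasLocalSections I J f) {f' : X' → Y'} (hf' : HasLocalSections I' J' f') :
    HasLocalSections (I.prod I') (J.prod J') (Prod.map f f') where
  surjective := hf.surjective.prodMap hf'.surjective
  smooth := hf.smooth.prodMap hf'.smooth
  exists_section := by
    rintro ⟨x, x'⟩
    obtain ⟨U, hU, hxU, s, hs, hsx, hfs⟩ := hf.exists_section x
    obtain ⟨U', hU', hxU', s', hs', hsx', hfs'⟩ := hf'.exists_section x'
    refine ⟨U ×ˢ U', hU.prod hU', ⟨hxU, hxU'⟩, Prod.map s s', hs.prodMap hs', ?_, ?_⟩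
    · simp [hsx, hsx']
    · rintro ⟨y, y'⟩ ⟨hy, hy'⟩
      simp [hfs y hy, hfs' y' hy']

end LocalSections

section LocalSectionsOfSubmersions

theorem exists_section_of_isSubmersion {𝕜 : Type*} [NontriviallyNormedField 𝕜]
    {EX : Type*} [NormedAddCommGroup EX] [NormedSpace 𝕜 EX]
    {EY : Type*} [NormedAddCommGroup EY] [NormedSpace 𝕜 EY]
    {X : Type*} [TopologicalSpace X] [ChartedSpace EX X]
    {Y : Type*} [TopologicalSpace Y] [ChartedSpace EY Y] {n : WithTop ℕ∞}
    {f : X → Y} (hf : Manifold.IsSubmersion 𝓘(𝕜, EX) 𝓘(𝕜, EY) n f) (x : X) :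
    ∃ U : Set Y, IsOpen U ∧ f x ∈ U ∧ ∃ s : Y → X,
      ContMDiffOn 𝓘(𝕜, EY) 𝓘(𝕜, EX) n s U ∧ s (f x) = x ∧ ∀ y ∈ U, f (s y) = y := by
  obtain ⟨F, _, _, h⟩ := hf.isSubmersionAt x
  set φ := h.domChart
  set ψ := h.codChart
  set e := h.equiv
  have hx : x ∈ φ.source := h.mem_domChart_source
  have hfx : f x ∈ ψ.source := h.mem_codChart_source
  have hform : ∀ z ∈ φ.target, ψ (f (φ.symm z)) = (e z).1 := by
    intro z hz
    have hz' : z ∈ (h.domChart.extend 𝓘(𝕜, EX)).target := by simpa using hz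
    simpa using h.writtenInCharts hz'
  -- in the charts of the submersion, the section keeps the second coordinate of `x`
  set j : Y → EX := fun y => e.symm (ψ y, (e (φ x)).2) with hj
  have hjx : j (f x) = φ x := by
    have := hform (φ x) (φ.map_source hx)
    rw [φ.left_inv hx] at this
    simp [hj, this]
  have hjs : ContMDiffOn 𝓘(𝕜, EY) 𝓘(𝕜, EX) n j ψ.source := by
    have h1 : ContMDiffOn 𝓘(𝕜, EY) 𝓘(𝕜, EY) n ψ ψ.source :=
      contMDiffOn_of_mem_maximalAtlas h.codChart_mem_maximalAtlas
    have h2 : ContDiff 𝕜 n (fun v : EY => e.symm (v, (e (φ x)).2)) := by fun_prop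
    exact h2.contMDiff.comp_contMDiffOn h1
  refine ⟨ψ.source ∩ j ⁻¹' φ.target, hjs.continuousOn.isOpen_inter_preimage ψ.open_source
    φ.open_target, ⟨hfx, ?_⟩, fun y => φ.symm (j y), ?_, ?_, ?_⟩
  · simp only [mem_preimage, hjx]
    exact φ.map_source hx
  · have h1 : ContMDiffOn 𝓘(𝕜, EX) 𝓘(𝕜, EX) n φ.symm φ.target :=
      contMDiffOn_symm_of_mem_maximalAtlas h.domChart_mem_maximalAtlas
    exact h1.comp (hjs.mono inter_subset_left) (fun y hy => hy.2)
  · simp only [hjx, φ.left_inv hx]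
  · rintro y ⟨hy, hy'⟩
    have h1 := hform (j y) hy'
    have h2 : f (φ.symm (j y)) ∈ ψ.source :=
      h.mapsto_domChart_source_codChart_source (φ.map_target hy')
    apply ψ.injOn h2 hy
    rw [h1]
    simp [hj]

variable {EX : Type*} [NormedAddCommGroup EX] {EY : Type*} [NormedAddCommGroup EY]
  {X : Type*} [TopologicalSpace X] [ChartedSpace EX X]
  {Y : Type*} [TopologicalSpace Y] [ChartedSpace EY Y]

theorem IsManifoldQuotient.hasLocalSections_real [NormedSpace ℝ EX] [NormedSpace ℝ EY]
    [IsManifold 𝓘(ℝ, EX) ∞ X] [IsManifold 𝓘(ℝ, EY) ∞ Y]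
    {r : X → X → Prop} {f : X → Y} (hf : IsManifoldQuotient ℝ EX EY ∞ r f) :
    HasLocalSections 𝓘(ℝ, EX) 𝓘(ℝ, EY) f where
  surjective := hf.surjective
  smooth := hf.submersion.contMDiff
  exists_section := exists_section_of_isSubmersion hf.submersion

theorem IsManifoldQuotient.hasLocalSections_complex [NormedSpace ℂ EX] [NormedSpace ℂ EY]
    [IsManifold 𝓘(ℂ, EX) ω X] [IsManifold 𝓘(ℂ, EY) ω Y]
    {r : X → X → Prop} {f : X → Y} (hf : IsManifoldQuotient ℂ EX EY ω r f) :
    HasLocalSections 𝓘(ℝ, EX) 𝓘(ℝ, EY) f where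
  surjective := hf.surjective
  smooth := contMDiff_complexToReal hf.submersion.contMDiff
  exists_section x := by
    obtain ⟨U, hU, hxU, s, hs, h⟩ := exists_section_of_isSubmersion hf.submersion x
    exact ⟨U, hU, hxU, s, contMDiffOn_complexToReal rfl rfl hs, h⟩

variable [NormedSpace ℝ EX] [NormedSpace ℝ EY]

theorem HasLocalSections.dmap_surjective {f : X → Y}
    (hf : HasLocalSections 𝓘(ℝ, EX) 𝓘(ℝ, EY) f) (x : X) :
    Function.Surjective (dmap EX EY f x) := by
  intro v
  obtain ⟨U, hU, hxU, s, hs, hsx, hfs⟩ := hf.exists_section x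
  have hsU := (hs.contMDiffAt (hU.mem_nhds hxU)).mdifferentiableAt (by simp)
  refine ⟨dmap EY EX s (f x) v, ?_⟩
  have h1 := dmap_comp (g := f) (f := s) (x := f x) (ContMDiff.mdiffAt hf.smooth _) hsU v
  rw [hsx] at h1
  rw [← h1]
  have h2 : (fun y => f (s y)) =ᶠ[𝓝 (f x)] fun y => y := by
    filter_upwards [hU.mem_nhds hxU] with y hy using hfs y hy
  rw [dmap_congr h2, dmap_id]

end LocalSectionsOfSubmersions

/-! ### One-parameter subgroups -/

section OneParam

variable {EG : Type*} [NormedAddCommGroup EG] [NormedSpace ℝ EG]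
  {G : Type*} [TopologicalSpace G] [ChartedSpace EG G] [Group G]

section Typed

variable {EX : Type*} [NormedAddCommGroup EX] [NormedSpace ℝ EX]
  {EY : Type*} [NormedAddCommGroup EY] [NormedSpace ℝ EY]
  {EZ : Type*} [NormedAddCommGroup EZ] [NormedSpace ℝ EZ]
  {X : Type*} [TopologicalSpace X] [ChartedSpace EX X]
  {Y : Type*} [TopologicalSpace Y] [ChartedSpace EY Y]
  {Z : Type*} [TopologicalSpace Z] [ChartedSpace EZ Z]

variable (EX EY) in
/-- `HasMFDerivAt` for real manifolds, with the derivative typed as a map between the model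
spaces, as for `dmap`. -/
def HasDmapAt (f : X → Y) (x : X) (L : EX →L[ℝ] EY) : Prop :=
  HasMFDerivAt 𝓘(ℝ, EX) 𝓘(ℝ, EY) f x L

theorem HasDmapAt.comp {g : Y → Z} {f : X → Y} {x : X} {y : Y} {L : EY →L[ℝ] EZ}
    {L' : EX →L[ℝ] EY} (hg : HasDmapAt EY EZ g y L) (hf : HasDmapAt EX EY f x L') (hy : f x = y) :
    HasDmapAt EX EZ (fun z => g (f z)) x (L.comp L') := by
  subst hy
  exact HasMFDerivAt.comp x hg hf

theorem hasDmapAt_const (y : Y) (x : X) : HasDmapAt EX EY (fun _ : X => y) x 0 :=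
  hasMFDerivAt_const _ _

theorem hasDmapAt_sub_const (s : ℝ) :
    HasDmapAt ℝ ℝ (fun t : ℝ => t - s) s (ContinuousLinearMap.id ℝ ℝ) :=
  ((hasFDerivAt_id s).sub_const s).hasMFDerivAt

theorem hasDmapAt_dmap {f : X → Y} {x : X} (hf : MDifferentiableAt 𝓘(ℝ, EX) 𝓘(ℝ, EY) f x) :
    HasDmapAt EX EY f x (dmap EX EY f x) := hf.hasMFDerivAt

theorem HasDmapAt.dmap_eq {f : X → Y} {x : X} {L : EX →L[ℝ] EY} (h : HasDmapAt EX EY f x L) :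
    dmap EX EY f x = L := HasMFDerivAt.mfderiv h

end Typed

theorem smulRight_one_eq (u : EG) :
    (1 : ℝ →L[ℝ] ℝ).smulRight u = ContinuousLinearMap.toSpanSingleton ℝ u := by
  ext; simp

/-- A curve in a manifold whose velocity vanishes identically is constant. -/
theorem eq_of_velocity_eq_zero {EX : Type*} [NormedAddCommGroup EX] [NormedSpace ℝ EX]
    {X : Type*} [TopologicalSpace X] [ChartedSpace EX X] [IsManifold 𝓘(ℝ, EX) ∞ X] [T2Space X]
    {γ : ℝ → X} (h : ∀ t, HasDmapAt ℝ EX γ t 0) (t : ℝ) : γ t = γ 0 := by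
  have : IsManifold 𝓘(ℝ, EX) 1 X := IsManifold.of_le (n := ∞) (by simp)
  have hv : ContMDiff 𝓘(ℝ, EX) 𝓘(ℝ, EX).tangent 1
      (fun x : X => (⟨x, 0⟩ : TangentBundle 𝓘(ℝ, EX) X)) :=
    Bundle.contMDiff_zeroSection ℝ (TangentSpace 𝓘(ℝ, EX) : X → Type _)
  have e : (0 : ℝ →L[ℝ] EX) = (1 : ℝ →L[ℝ] ℝ).smulRight (0 : EX) := by ext; simp
  rw [e] at h
  have h2 : ∀ t, HasDmapAt ℝ EX (fun _ : ℝ => γ 0) t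
      ((1 : ℝ →L[ℝ] ℝ).smulRight (0 : EX)) := fun t => e ▸ hasDmapAt_const (γ 0) t
  exact congrFun (isMIntegralCurve_Ioo_eq_of_contMDiff_boundaryless (I := 𝓘(ℝ, EX))
    (v := fun _ => (0 : EX)) (t₀ := 0) hv h h2 rfl) t

/-- The left-invariant vector field with value `u` at `1`. -/
noncomputable def leftField (u : EG) (g : G) : EG :=
  dmap EG EG (fun x : G => g * x) 1 u

theorem IsOneParam.map_zero {γ : ℝ → G} {u : EG} (h : IsOneParam γ u) : γ 0 = 1 := by
  have := h.map_add 0 0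
  simpa using this

theorem IsOneParam.hasDmapAt {γ : ℝ → G} {u : EG} (h : IsOneParam γ u) :
    HasDmapAt ℝ EG γ 0 (ContinuousLinearMap.toSpanSingleton ℝ u) := h.velocity

theorem IsOneParam.of_hasDmapAt {γ : ℝ → G} {u : EG} (hadd : ∀ s t : ℝ, γ (s + t) = γ s * γ t)
    (h : HasDmapAt ℝ EG γ 0 (ContinuousLinearMap.toSpanSingleton ℝ u)) : IsOneParam γ u :=
  ⟨hadd, h⟩

theorem isOneParam_const : IsOneParam (fun _ : ℝ => (1 : G)) (0 : EG) := by
  refine .of_hasDmapAt (by simp) ?_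
  have e : (0 : ℝ →L[ℝ] EG) = ContinuousLinearMap.toSpanSingleton ℝ (0 : EG) := by ext; simp
  rw [← e]
  exact hasDmapAt_const _ _

theorem IsOneParam.map {EG' : Type*} [NormedAddCommGroup EG'] [NormedSpace ℝ EG']
    {G' : Type*} [TopologicalSpace G'] [ChartedSpace EG' G'] [Group G'] {γ : ℝ → G} {u : EG}
    (h : IsOneParam γ u) (f : G →* G') (hf : ContMDiff 𝓘(ℝ, EG) 𝓘(ℝ, EG') ∞ f) :
    IsOneParam (fun t => f (γ t)) (dmap EG EG' f 1 u) := by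
  refine .of_hasDmapAt (fun s t => by simp [h.map_add]) ?_
  have h2 := (hasDmapAt_dmap (ContMDiff.mdiffAt hf 1)).comp h.hasDmapAt h.map_zero
  have e : (dmap EG EG' f 1).comp (ContinuousLinearMap.toSpanSingleton ℝ u) =
      ContinuousLinearMap.toSpanSingleton ℝ (dmap EG EG' f 1 u) := by ext; simp
  rwa [e] at h2

/-- An orbit map composed with a one-parameter subgroup is constant if its velocity at time `0`
vanishes. -/
theorem IsOneParam.orbit_eq {EX : Type*} [NormedAddCommGroup EX] [NormedSpace ℝ EX]
    {X : Type*} [TopologicalSpace X] [ChartedSpace EX X] [IsManifold 𝓘(ℝ, EX) ∞ X] [T2Space X]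
    [MulAction G X] (hact : ∀ g : G, ContMDiff 𝓘(ℝ, EX) 𝓘(ℝ, EX) ∞ (fun x : X => g • x))
    {q : X} (horb : MDifferentiableAt 𝓘(ℝ, EG) 𝓘(ℝ, EX) (fun g : G => g • q) 1)
    {γ : ℝ → G} {u : EG} (h : IsOneParam γ u) (hu : dmap EG EX (fun g : G => g • q) 1 u = 0)
    (t : ℝ) : γ t • q = q := by
  have h0 : HasDmapAt ℝ EX (fun t => γ t • q) 0 0 := by
    have h1 := (hasDmapAt_dmap horb).comp h.hasDmapAt h.map_zero
    have e : (dmap EG EX (fun g : G => g • q) 1).comp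
        (ContinuousLinearMap.toSpanSingleton ℝ u) = 0 := by ext; simp [hu]
    rwa [e] at h1
  have h1 : ∀ s, HasDmapAt ℝ EX (fun t => γ t • q) s 0 := by
    intro s
    have h2 := h0.comp (hasDmapAt_sub_const s) (sub_self s)
    have h3 := (hasDmapAt_dmap (ContMDiff.mdiffAt (hact (γ s)) (γ (s - s) • q))).comp h2 rfl
    rw [ContinuousLinearMap.zero_comp, ContinuousLinearMap.comp_zero] at h3
    have e : (fun t => γ s • γ (t - s) • q) = fun t => γ t • q := by
      funext t
      rw [smul_smul, ← h.map_add, add_sub_cancel]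
    rwa [e] at h3
  rw [eq_of_velocity_eq_zero h1 t, h.map_zero, one_smul]

variable [LieGroup 𝓘(ℝ, EG) ∞ G]

theorem contMDiff_mul_left_real (g : G) : ContMDiff 𝓘(ℝ, EG) 𝓘(ℝ, EG) ∞ (fun x : G => g * x) :=
  contMDiff_mul_left

theorem contMDiff_leftField (u : EG) : ContMDiff 𝓘(ℝ, EG) 𝓘(ℝ, EG).tangent 1
    (fun g : G => (⟨g, leftField (EG := EG) u g⟩ : TangentBundle 𝓘(ℝ, EG) G)) := by
  have e : minSmoothness ℝ 3 = 3 := minSmoothness_of_isRCLikeNormedField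
  have : LieGroup 𝓘(ℝ, EG) (minSmoothness ℝ 3) G := by
    rw [e]; infer_instance
  have h := contMDiff_mulInvariantVectorField (I := 𝓘(ℝ, EG)) (G := G) u
  exact h.of_le (le_trans one_le_two le_minSmoothness)

theorem leftField_translate {u : EG} (g h : G) :
    dmap EG EG (fun x : G => g * x) h (leftField u h) = leftField u (g * h) := by
  have h1 := dmap_comp (g := fun x : G => g * x) (f := fun x : G => h * x) (x := 1)
    (ContMDiff.mdiffAt (contMDiff_mul_left_real (EG := EG) g) _)
    (ContMDiff.mdiffAt (contMDiff_mul_left_real (EG := EG) h) _) u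
  rw [mul_one] at h1
  rw [leftField, ← h1, leftField]
  simp only [mul_assoc]

/-- Left translates of integral curves of a left-invariant field are integral curves. -/
theorem isMIntegralCurveOn_mul_left {u : EG} {γ : ℝ → G} {s : Set ℝ}
    (hγ : IsMIntegralCurveOn (I := 𝓘(ℝ, EG)) γ (leftField (EG := EG) u) s) (g : G) :
    IsMIntegralCurveOn (I := 𝓘(ℝ, EG)) (fun t => g * γ t) (leftField (EG := EG) u) s := by
  intro t ht
  have h1 := (hasMFDerivAt_dmap (ContMDiff.mdiffAt (contMDiff_mul_left_real (EG := EG) g)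
    (γ t))).comp_hasMFDerivWithinAt t (hγ t ht)
  have e : (dmap EG EG (fun x : G => g * x) (γ t)).comp
      ((1 : ℝ →L[ℝ] ℝ).smulRight (leftField u (γ t))) =
      (1 : ℝ →L[ℝ] ℝ).smulRight (leftField (EG := EG) u (g * γ t)) := by
    rw [smulRight_one_eq, smulRight_one_eq]
    ext
    simpa using leftField_translate g (γ t)
  exact e ▸ h1

omit [LieGroup 𝓘(ℝ, EG) ∞ G] in
theorem leftField_one (u : EG) : leftField u (1 : G) = u := by
  simp only [leftField, one_mul]
  exact dmap_id _ _

theorem IsOneParam.hasDmapAt_leftField {γ : ℝ → G} {u : EG} (h : IsOneParam γ u) (s : ℝ) :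
    HasDmapAt ℝ EG γ s ((1 : ℝ →L[ℝ] ℝ).smulRight (leftField u (γ s))) := by
  have h1 := h.hasDmapAt.comp (hasDmapAt_sub_const s) (sub_self s)
  have h2 := (hasDmapAt_dmap
    (ContMDiff.mdiffAt (contMDiff_mul_left_real (EG := EG) (γ s)) 1)).comp h1
      (by rw [sub_self, h.map_zero])
  have e : (fun t => γ s * γ (t - s)) = γ := by
    funext t
    rw [← h.map_add, add_sub_cancel]
  have e2 : (dmap EG EG (fun x : G => γ s * x) 1).comp
      ((ContinuousLinearMap.toSpanSingleton ℝ u).comp (ContinuousLinearMap.id ℝ ℝ)) =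
      (1 : ℝ →L[ℝ] ℝ).smulRight (leftField u (γ s)) := by
    rw [smulRight_one_eq]
    ext
    simp [leftField]
  rwa [e, e2] at h2

theorem IsOneParam.isMIntegralCurve {γ : ℝ → G} {u : EG} (h : IsOneParam γ u) :
    IsMIntegralCurve (I := 𝓘(ℝ, EG)) γ (leftField (EG := EG) u) :=
  h.hasDmapAt_leftField

variable [T2Space G]

theorem IsOneParam.unique {γ γ' : ℝ → G} {u : EG} (h : IsOneParam γ u) (h' : IsOneParam γ' u) :
    γ = γ' := by
  have : IsManifold 𝓘(ℝ, EG) 1 G := IsManifold.of_le (n := ∞) (by simp)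
  exact isMIntegralCurve_Ioo_eq_of_contMDiff_boundaryless (t₀ := 0) (contMDiff_leftField u)
    h.isMIntegralCurve h'.isMIntegralCurve (by rw [h.map_zero, h'.map_zero])

/-- Every element of the Lie algebra generates a one-parameter subgroup. -/
theorem exists_isOneParam [CompleteSpace EG] (u : EG) : ∃ γ : ℝ → G, IsOneParam γ u := by
  have : IsManifold 𝓘(ℝ, EG) 1 G := IsManifold.of_le (n := ∞) (by simp)
  have hv := contMDiff_leftField (G := G) u
  obtain ⟨γ₀, h0, hγ₀⟩ := exists_isMIntegralCurveAt_of_contMDiffAt_boundaryless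
    (I := 𝓘(ℝ, EG)) (t₀ := 0) (x₀ := (1 : G)) (v := leftField (EG := EG) u) (hv 1)
  obtain ⟨ε, hε, hγ₀⟩ := isMIntegralCurveAt_iff'.1 hγ₀
  rw [Real.ball_eq_Ioo, zero_sub, zero_add] at hγ₀
  obtain ⟨γ, h1, hγ⟩ := exists_isMIntegralCurve_of_isMIntegralCurveOn (I := 𝓘(ℝ, EG))
    (v := leftField (EG := EG) u) hv hε
    (fun x => ⟨fun t => x * γ₀ t, by simp [h0], isMIntegralCurveOn_mul_left hγ₀ x⟩) (1 : G)
  refine ⟨γ, .of_hasDmapAt ?_ ?_⟩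
  · intro s t
    have ha : IsMIntegralCurve (I := 𝓘(ℝ, EG)) (γ ∘ (· + s)) (leftField (EG := EG) u) :=
      hγ.comp_add s
    have hb : IsMIntegralCurve (I := 𝓘(ℝ, EG)) (fun t => γ s * γ t) (leftField (EG := EG) u) := by
      exact isMIntegralCurve_iff_isMIntegralCurveOn.2
        (isMIntegralCurveOn_mul_left (isMIntegralCurve_iff_isMIntegralCurveOn.1 hγ) _)
    have := congrFun (isMIntegralCurve_Ioo_eq_of_contMDiff_boundaryless (t₀ := 0) hv ha hb
      (by simp [h1])) t
    simpa [add_comm] using this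
  · have h2 : HasDmapAt ℝ EG γ 0 ((1 : ℝ →L[ℝ] ℝ).smulRight (leftField u (γ 0))) := hγ 0
    rwa [h1, leftField_one, smulRight_one_eq] at h2

end OneParam

/-! ### Complexifications -/

section Complexification

variable {EG : Type*} [NormedAddCommGroup EG] [NormedSpace ℝ EG] [FiniteDimensional ℝ EG]
  {G : Type*} [TopologicalSpace G] [ChartedSpace EG G] [Group G] [LieGroup 𝓘(ℝ, EG) ∞ G]
  [T2Space G]
  {EGC : Type*} [NormedAddCommGroup EGC] [NormedSpace ℂ EGC]
  {GC : Type*} [TopologicalSpace GC] [ChartedSpace EGC GC] [Group GC]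
  {EG' : Type*} [NormedAddCommGroup EG'] [NormedSpace ℝ EG']
  {G' : Type*} [TopologicalSpace G'] [ChartedSpace EG' G'] [Group G'] [LieGroup 𝓘(ℝ, EG') ∞ G']
  [T2Space G']
  {EGC' : Type*} [NormedAddCommGroup EGC'] [NormedSpace ℂ EGC']
  {GC' : Type*} [TopologicalSpace GC'] [ChartedSpace EGC' GC'] [Group GC']
  {ι : G →* GC} {ι' : G' →* GC'} {πG : G →* G'} {πGC : GC →* GC'}

omit [FiniteDimensional ℝ EG] [LieGroup 𝓘(ℝ, EG) ∞ G] [T2Space G] [LieGroup 𝓘(ℝ, EG') ∞ G']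
  [T2Space G'] in
/-- The differential of the holomorphic extension of `πG` extends that of `πG`. -/
theorem dmap_lieMap (hι : ContMDiff 𝓘(ℝ, EG) 𝓘(ℝ, EGC) ∞ ι)
    (hι' : ContMDiff 𝓘(ℝ, EG') 𝓘(ℝ, EGC') ∞ ι') (hπG : ContMDiff 𝓘(ℝ, EG) 𝓘(ℝ, EG') ∞ πG)
    (hπGC : ContMDiff 𝓘(ℝ, EGC) 𝓘(ℝ, EGC') ∞ πGC) (hext : ∀ g, πGC (ι g) = ι' (πG g)) (u : EG) :
    dmap EGC EGC' πGC 1 (lieMap ι u) = lieMap ι' (dmap EG EG' πG 1 u) := by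
  have h1 := dmap_comp (g := πGC) (f := ι) (x := 1) (ContMDiff.mdiffAt hπGC _)
    (ContMDiff.mdiffAt hι _) u
  have h2 := dmap_comp (g := ι') (f := πG) (x := 1) (ContMDiff.mdiffAt hι' _)
    (ContMDiff.mdiffAt hπG _) u
  rw [map_one] at h1 h2
  rw [lieMap, lieMap, ← h1, ← h2]
  simp only [hext]

omit [FiniteDimensional ℝ EG] [LieGroup 𝓘(ℝ, EG) ∞ G] [T2Space G] [LieGroup 𝓘(ℝ, EG') ∞ G']
  [T2Space G'] in
theorem dmap_holomorphic_extension_surjective (hι : ContMDiff 𝓘(ℝ, EG) 𝓘(ℝ, EGC) ∞ ι)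
    (hι' : IsComplexification (EG := EG') (EGC := EGC') ι')
    (hπG : ContMDiff 𝓘(ℝ, EG) 𝓘(ℝ, EG') ∞ πG)
    (hsurj : Function.Surjective (dmap EG EG' πG 1))
    (hπGC : ContMDiff 𝓘(ℂ, EGC) 𝓘(ℂ, EGC') ω πGC) (hext : ∀ g, πGC (ι g) = ι' (πG g)) :
    Function.Surjective (dmap EGC EGC' πGC 1) := by
  intro z
  obtain ⟨⟨u, v⟩, hz, -⟩ := hι'.lie z
  obtain ⟨u, rfl⟩ := hsurj u
  obtain ⟨v, rfl⟩ := hsurj v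
  have h := dmap_lieMap hι hι'.smooth hπG (contMDiff_complexToReal hπGC) hext
  refine ⟨lieMap ι u + Complex.I • lieMap ι v, ?_⟩
  rw [map_add, dmap_I_smul ((hπGC 1).mdifferentiableAt (by simp)), h, h]
  exact hz.symm

/-- By the polar decompositions, the kernel of the holomorphic extension of `πG : G → G'` is the
complexification of the kernel `H` of `πG`. -/
theorem complexifiedSubgroup_eq_ker (H : Subgroup G) (hH : ∀ g, πG g = 1 ↔ g ∈ H)
    [T2Space GC'] [LieGroup 𝓘(ℂ, EGC') ω GC']
    (hι : IsComplexification (EG := EG) (EGC := EGC) ι)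
    (hι' : IsComplexification (EG := EG') (EGC := EGC') ι')
    (hπG : ContMDiff 𝓘(ℝ, EG) 𝓘(ℝ, EG') ∞ πG)
    (hπGC : ContMDiff 𝓘(ℂ, EGC) 𝓘(ℂ, EGC') ω πGC) (hext : ∀ g, πGC (ι g) = ι' (πG g)) :
    complexifiedSubgroup EG EGC ι H = πGC.ker := by
  have hC := contMDiff_complexToReal hπGC
  have hlie := dmap_lieMap hι.smooth hι'.smooth hπG hC hext
  have hmap : ∀ {γ : ℝ → GC} {v : EG}, IsOneParam γ (Complex.I • lieMap (EGC := EGC) ι v) →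
      IsOneParam (fun t => πGC (γ t))
        (Complex.I • lieMap (EGC := EGC') ι' (dmap EG EG' πG 1 v)) := by
    intro γ v h
    have := h.map πGC hC
    rwa [dmap_I_smul ((hπGC 1).mdifferentiableAt (by simp)), hlie] at this
  apply le_antisymm
  · rw [complexifiedSubgroup, Subgroup.closure_le]
    rintro x (⟨h, hh, rfl⟩ | ⟨u, ⟨δ, hδ, hδH⟩, γ, hγ, rfl⟩)
    · simp [hext, (hH h).2 hh]
    · have h1 : dmap EG EG' πG 1 u = 0 := by
        have h2 := (hδ.map πG hπG).hasDmapAt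
        have h3 : (fun t => πG (δ t)) = fun _ => 1 := funext fun t => (hH _).2 (hδH t)
        rw [h3] at h2
        have h4 := h2.dmap_eq
        rw [(hasDmapAt_const (EX := ℝ) (EY := EG') (1 : G') (0 : ℝ)).dmap_eq] at h4
        simpa using (congrArg (fun L : ℝ →L[ℝ] EG' => L 1) h4).symm
      have h2 := hmap hγ
      rw [h1, map_zero, smul_zero] at h2
      exact congrFun (h2.unique isOneParam_const) 1
  · intro x hx
    rw [MonoidHom.mem_ker] at hx
    obtain ⟨⟨k, v⟩, ⟨γ, hγ, rfl⟩, -⟩ := hι.polar x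
    obtain ⟨kv, -, huniq⟩ := hι'.polar 1
    have e1 := huniq (πG k, dmap EG EG' πG 1 v) ⟨_, hmap hγ, by rw [← hext, ← map_mul, hx]⟩
    have e2 := huniq (1, 0) ⟨fun _ => 1, by
      simpa using isOneParam_const (EG := EGC') (G := GC'), by simp⟩
    have e3 := e1.trans e2.symm
    simp only [Prod.mk.injEq] at e3
    have : CompleteSpace EG := FiniteDimensional.complete ℝ EG
    obtain ⟨δ, hδ⟩ := exists_isOneParam (G := G) v
    refine Subgroup.mul_mem _ (Subgroup.subset_closure (Or.inl ⟨k, (hH k).1 e3.1, rfl⟩))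
      (Subgroup.subset_closure (Or.inr ⟨v, ⟨δ, hδ, fun t => (hH _).1 ?_⟩, γ, hγ, rfl⟩))
    have h1 := hδ.map πG hπG
    rw [e3.2] at h1
    exact congrFun (h1.unique isOneParam_const) t

end Complexification

/-! ### Principal bundles -/

section PrincipalBundles

variable {EG : Type*} [NormedAddCommGroup EG] [NormedSpace ℝ EG]
  {G : Type*} [TopologicalSpace G] [ChartedSpace EG G] [Group G]
  {EM : Type*} [NormedAddCommGroup EM] [NormedSpace ℂ EM]
  {M : Type*} [TopologicalSpace M] [ChartedSpace EM M]
  {EP : Type*} [NormedAddCommGroup EP] [NormedSpace ℝ EP]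
  {P : Type*} [TopologicalSpace P] [ChartedSpace EP P] [MulAction Gᵐᵒᵖ P]
  {π : P → M}

omit [TopologicalSpace G] [TopologicalSpace P] in
theorem op_smul_op_smul (g h : G) (p : P) :
    MulOpposite.op g • MulOpposite.op h • p = MulOpposite.op (h * g) • p := by
  rw [smul_smul, ← MulOpposite.op_mul]

namespace IsPrincipalBundle

theorem surjective (hπ : IsPrincipalBundle EG G EM EP π) : Function.Surjective π := by
  intro x
  obtain ⟨U, -, hx, s, κ, -, -, hs, -⟩ := hπ.locally_trivial x
  exact ⟨s x, hs x hx⟩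

theorem eq_one_of_smul_eq (hπ : IsPrincipalBundle EG G EM EP π) {p : P} {g : G}
    (h : MulOpposite.op g • p = p) : g = 1 := by
  obtain ⟨U, -, hx, s, κ, -, -, -, hκ⟩ := hπ.locally_trivial (π p)
  have h1 := (hκ p hx (κ p)).2 rfl
  have h2 : MulOpposite.op (κ p * g) • s (π p) = p := by
    rw [← op_smul_op_smul, h1, h]
  simpa using (hκ p hx _).1 h2

theorem exists_smul_eq (hπ : IsPrincipalBundle EG G EM EP π) {p q : P} (h : π p = π q) :
    ∃ g : G, MulOpposite.op g • p = q := by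
  obtain ⟨U, -, hx, s, κ, -, -, -, hκ⟩ := hπ.locally_trivial (π p)
  have h1 := (hκ p hx (κ p)).2 rfl
  have h2 := (hκ q (h ▸ hx) (κ q)).2 rfl
  refine ⟨(κ p)⁻¹ * κ q, ?_⟩
  calc MulOpposite.op ((κ p)⁻¹ * κ q) • p
      = MulOpposite.op ((κ p)⁻¹ * κ q) • MulOpposite.op (κ p) • s (π p) := by rw [h1]
    _ = q := by rw [op_smul_op_smul, mul_inv_cancel_left, h, h2]

theorem contMDiff_smul (hπ : IsPrincipalBundle EG G EM EP π) (g : G) :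
    ContMDiff 𝓘(ℝ, EP) 𝓘(ℝ, EP) ∞ (fun p : P => MulOpposite.op g • p) :=
  hπ.smooth_act.comp (contMDiff_id.prodMk contMDiff_const)

theorem contMDiff_orbit (hπ : IsPrincipalBundle EG G EM EP π) (p : P) :
    ContMDiff 𝓘(ℝ, EG) 𝓘(ℝ, EP) ∞ (fun g : G => MulOpposite.op g • p) :=
  hπ.smooth_act.comp (contMDiff_const.prodMk contMDiff_id)

variable [LieGroup 𝓘(ℝ, EG) ∞ G]

/-- A tangent vector of `P` that projects to `0` is vertical. -/
theorem exists_fundamental_eq (hπ : IsPrincipalBundle EG G EM EP π) {p : P} {v : EP}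
    (hv : dmap EP EM π p v = 0) : ∃ ξ : EG, fundamental EG G EP p ξ = v := by
  obtain ⟨U, hU, hx, s, κ, hs, hκs, -, hκ⟩ := hπ.locally_trivial (π p)
  have hUo : IsOpen (π ⁻¹' U) := hU.preimage hπ.smooth_proj.continuous
  have hsd : MDifferentiableAt 𝓘(ℝ, EM) 𝓘(ℝ, EP) s (π p) :=
    (hs.contMDiffAt (hU.mem_nhds hx)).mdifferentiableAt (by simp)
  have hκd : MDifferentiableAt 𝓘(ℝ, EP) 𝓘(ℝ, EG) κ p :=
    (hκs.contMDiffAt (hUo.mem_nhds hx)).mdifferentiableAt (by simp)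
  have hπd := ContMDiff.mdiffAt hπ.smooth_proj p
  have hp : MulOpposite.op (κ p) • s (π p) = p := (hκ p hx _).2 rfl
  have e1 : (fun q => MulOpposite.op (κ q) • s (π q)) =ᶠ[𝓝 p] fun q => q := by
    filter_upwards [hUo.mem_nhds hx] with q hq using (hκ q hq _).2 rfl
  have hd := dmap_two (m := fun x : P × G => MulOpposite.op x.2 • x.1) (u := fun q => s (π q))
    (w := κ) (p := p) ((hπ.smooth_act _).mdifferentiableAt (by simp))
    (hsd.comp p hπd) hκd v
  rw [dmap_congr e1, dmap_id, dmap_comp hsd hπd, hv, map_zero, map_zero, zero_add] at hd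
  refine ⟨dmap EG EG (fun g : G => (κ p)⁻¹ * g) (κ p) (dmap EP EG κ p v), ?_⟩
  have h2 := dmap_comp (g := fun g : G => MulOpposite.op g • p) (f := fun g : G => (κ p)⁻¹ * g)
    (x := κ p) (ContMDiff.mdiffAt (hπ.contMDiff_orbit p) _)
    (ContMDiff.mdiffAt (contMDiff_mul_left_real (EG := EG) _) _) (dmap EP EG κ p v)
  rw [inv_mul_cancel] at h2
  have e3 : (fun g : G => MulOpposite.op ((κ p)⁻¹ * g) • p) =
      fun g : G => MulOpposite.op g • s (π p) := by
    funext g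
    calc MulOpposite.op ((κ p)⁻¹ * g) • p
        = MulOpposite.op ((κ p)⁻¹ * g) • MulOpposite.op (κ p) • s (π p) := by rw [hp]
      _ = MulOpposite.op g • s (π p) := by rw [op_smul_op_smul, mul_inv_cancel_left]
  rw [fundamental, ← h2, e3]
  exact hd.symm

/-- In a local trivialization, `d(κ_p⁻¹ κ)` is a left inverse of `ξ ↦ ξ^♯_p`. -/
theorem fundamental_injective (hπ : IsPrincipalBundle EG G EM EP π) (p : P) :
    Function.Injective (fundamental EG G EP p) := by
  obtain ⟨U, hU, hx, s, κ, hs, hκs, -, hκ⟩ := hπ.locally_trivial (π p)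
  have hUo : IsOpen (π ⁻¹' U) := hU.preimage hπ.smooth_proj.continuous
  have hκd : MDifferentiableAt 𝓘(ℝ, EP) 𝓘(ℝ, EG) κ p :=
    (hκs.contMDiffAt (hUo.mem_nhds hx)).mdifferentiableAt (by simp)
  have hp : MulOpposite.op (κ p) • s (π p) = p := (hκ p hx _).2 rfl
  have e1 : (fun g : G => (κ p)⁻¹ * κ (MulOpposite.op g • p)) = fun g => g := by
    funext g
    have : κ p * g = κ (MulOpposite.op g • p) := by
      refine (hκ _ (by rw [hπ.proj_act]; exact hx) _).1 ?_
      rw [hπ.proj_act, ← op_smul_op_smul, hp]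
    rw [← this, inv_mul_cancel_left]
  have hod := ContMDiff.mdiffAt (hπ.contMDiff_orbit p) 1
  have hκd' : MDifferentiableAt 𝓘(ℝ, EP) 𝓘(ℝ, EG) κ (MulOpposite.op (1 : G) • p) := by
    simpa using hκd
  intro ξ η h
  have key : ∀ ξ : EG, ξ = dmap EG EG (fun g : G => (κ p)⁻¹ * g) (κ p)
      (dmap EP EG κ p (fundamental EG G EP p ξ)) := by
    intro ξ
    have h2 := dmap_comp (g := fun g : G => (κ p)⁻¹ * g)
      (f := fun g : G => κ (MulOpposite.op g • p)) (x := 1)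
      (ContMDiff.mdiffAt (contMDiff_mul_left_real (EG := EG) _) _) (hκd'.comp 1 hod) ξ
    rw [e1, dmap_id, dmap_comp (g := κ) (f := fun g : G => MulOpposite.op g • p) hκd' hod,
      MulOpposite.op_one, one_smul] at h2
    exact h2
  rw [key ξ, key η, h]

end IsPrincipalBundle

end PrincipalBundles

/-! ### Sections of associated bundles -/

section Sections

variable {EG : Type*} [NormedAddCommGroup EG] [NormedSpace ℝ EG]
  {G : Type*} [TopologicalSpace G] [ChartedSpace EG G] [Group G]
  {EM : Type*} [NormedAddCommGroup EM] [NormedSpace ℂ EM]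
  {M : Type*} [TopologicalSpace M] [ChartedSpace EM M]
  {EP : Type*} [NormedAddCommGroup EP] [NormedSpace ℝ EP]
  {P : Type*} [TopologicalSpace P] [ChartedSpace EP P] [MulAction Gᵐᵒᵖ P]
  {π : P → M}
  {EX : Type*} [NormedAddCommGroup EX] [NormedSpace ℝ EX]
  {X : Type*} [TopologicalSpace X] [ChartedSpace EX X] {ρ : G →* Equiv.Perm X}

omit [TopologicalSpace G] [TopologicalSpace P] [TopologicalSpace X] in
theorem AssocBundle.mk_eq_mk {p p' : P} {q q' : X} :
    AssocBundle.mk ρ p q = AssocBundle.mk ρ p' q' ↔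
      ∃ g : G, p' = MulOpposite.op g • p ∧ q' = ρ g⁻¹ q := by
  have h : AssocBundle.mk ρ p q = AssocBundle.mk ρ p' q' ↔ (assocSetoid P ρ).r (p, q) (p', q') :=
    Quotient.eq (r := assocSetoid P ρ)
  rw [h]
  change (∃ g : G, (p', q') = (MulOpposite.op g • p, ρ g⁻¹ q)) ↔ _
  simp only [Prod.mk.injEq]

omit [TopologicalSpace G] [TopologicalSpace M] in
theorem AssocSection.lift_smooth (φ : AssocSection EP EX π ρ) :
    ContMDiff 𝓘(ℝ, EP) 𝓘(ℝ, EX) ∞ φ.lift := φ.exists_lift.choose_spec.1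

omit [TopologicalSpace G] [TopologicalSpace M] in
theorem AssocSection.toFun_proj (φ : AssocSection EP EX π ρ) (p : P) :
    φ.toFun (π p) = AssocBundle.mk ρ p (φ.lift p) := φ.exists_lift.choose_spec.2 p

omit [TopologicalSpace X] in
theorem AssocBundle.mk_injective (hπ : IsPrincipalBundle EG G EM EP π) {p : P} {q q' : X}
    (h : AssocBundle.mk ρ p q = AssocBundle.mk ρ p q') : q = q' := by
  obtain ⟨g, hg, rfl⟩ := AssocBundle.mk_eq_mk.1 h
  rw [hπ.eq_one_of_smul_eq hg.symm]
  simp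

theorem AssocSection.lift_eq (hπ : IsPrincipalBundle EG G EM EP π) (φ : AssocSection EP EX π ρ)
    {p : P} {q : X} (h : φ.toFun (π p) = AssocBundle.mk ρ p q) : φ.lift p = q :=
  AssocBundle.mk_injective hπ ((φ.toFun_proj p).symm.trans h)

theorem AssocSection.lift_smul (hπ : IsPrincipalBundle EG G EM EP π) (φ : AssocSection EP EX π ρ)
    (g : G) (p : P) : φ.lift (MulOpposite.op g • p) = ρ g⁻¹ (φ.lift p) := by
  apply φ.lift_eq hπ
  rw [hπ.proj_act, φ.toFun_proj, AssocBundle.mk_eq_mk]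
  exact ⟨g, rfl, rfl⟩

/-- An equivariant smooth map `P → X` is the lift of a section of `P ×_ρ X`. -/
theorem AssocSection.exists_of_lift (hπ : IsPrincipalBundle EG G EM EP π) {f : P → X}
    (hf : ContMDiff 𝓘(ℝ, EP) 𝓘(ℝ, EX) ∞ f)
    (hequiv : ∀ (g : G) (p : P), f (MulOpposite.op g • p) = ρ g⁻¹ (f p)) :
    ∃ φ : AssocSection EP EX π ρ, ∀ p, φ.lift p = f p := by
  have h : ∀ p : P, AssocBundle.mk ρ (Function.surjInv hπ.surjective (π p))
      (f (Function.surjInv hπ.surjective (π p))) = AssocBundle.mk ρ p (f p) := by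
    intro p
    obtain ⟨g, hg⟩ := hπ.exists_smul_eq (Function.surjInv_eq hπ.surjective (π p))
    rw [AssocBundle.mk_eq_mk]
    refine ⟨g, hg.symm, ?_⟩
    rw [← hequiv, hg]
  let φ : AssocSection EP EX π ρ :=
    { toFun := fun x => AssocBundle.mk ρ (Function.surjInv hπ.surjective x)
        (f (Function.surjInv hπ.surjective x))
      exists_lift := ⟨f, hf, h⟩ }
  exact ⟨φ, fun p => φ.lift_eq hπ (h p)⟩

end Sections

/-! ### Quotients of principal bundles -/

section BundleQuotients

variable {EG : Type*} [NormedAddCommGroup EG] [NormedSpace ℝ EG]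
  {G : Type*} [TopologicalSpace G] [ChartedSpace EG G] [Group G]
  {EM : Type*} [NormedAddCommGroup EM] [NormedSpace ℂ EM]
  {M : Type*} [TopologicalSpace M] [ChartedSpace EM M]
  {EP : Type*} [NormedAddCommGroup EP] [NormedSpace ℝ EP]
  {P : Type*} [TopologicalSpace P] [ChartedSpace EP P] [MulAction Gᵐᵒᵖ P]
  {EG' : Type*} [NormedAddCommGroup EG'] [NormedSpace ℝ EG']
  {G' : Type*} [TopologicalSpace G'] [ChartedSpace EG' G'] [Group G']
  {EP' : Type*} [NormedAddCommGroup EP'] [NormedSpace ℝ EP']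
  {P' : Type*} [TopologicalSpace P'] [ChartedSpace EP' P'] [MulAction G'ᵐᵒᵖ P']

variable (EG EM EP EG' EP') in
/-- The principal `G'`-bundle `π' : P' → M` is the quotient of the principal `G`-bundle
`π : P → M` by the kernel of `πG : G → G'`, with quotient map `ζ`. That `π'` is a principal bundle
is not part of the data, but proved in `IsBundleQuotient.isPrincipalBundle`. -/
structure IsBundleQuotient (πG : G →* G') (ζ : P → P') (π : P → M) (π' : P' → M) : Prop where
  bundle : IsPrincipalBundle EG G EM EP π
  sections_group : HasLocalSections 𝓘(ℝ, EG) 𝓘(ℝ, EG') πG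
  sections_space : HasLocalSections 𝓘(ℝ, EP) 𝓘(ℝ, EP') ζ
  fiber : ∀ p q : P, ζ p = ζ q ↔ ∃ h : G, πG h = 1 ∧ q = MulOpposite.op h • p
  map_smul : ∀ (g : G) (p : P), ζ (MulOpposite.op g • p) = MulOpposite.op (πG g) • ζ p
  proj : ∀ p : P, π' (ζ p) = π p

variable {πG : G →* G'} {ζ : P → P'} {π : P → M} {π' : P' → M}

namespace IsBundleQuotient

theorem isPrincipalBundle (hq : IsBundleQuotient EG EM EP EG' EP' πG ζ π π') :
    IsPrincipalBundle EG' G' EM EP' π' := by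
  have hsmooth : ContMDiff 𝓘(ℝ, EP') 𝓘(ℝ, EM) ∞ π' := by
    apply hq.sections_space.contMDiff_of_comp
    simp only [hq.proj]
    exact hq.bundle.smooth_proj
  refine ⟨?_, hsmooth, ?_, ?_⟩
  · apply (hq.sections_space.prodMap hq.sections_group).contMDiff_of_comp
    have h := hq.sections_space.smooth.comp hq.bundle.smooth_act
    refine h.congr fun x => ?_
    exact (hq.map_smul x.2 x.1).symm
  · intro p g
    obtain ⟨p, rfl⟩ := hq.sections_space.surjective p
    obtain ⟨g, rfl⟩ := hq.sections_group.surjective g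
    rw [← hq.map_smul, hq.proj, hq.proj, hq.bundle.proj_act]
  · intro x
    obtain ⟨U, hU, hx, s, κ, hs, hκs, hπs, hκ⟩ := hq.bundle.locally_trivial x
    have hκmul : ∀ p, π p ∈ U → ∀ g, κ (MulOpposite.op g • p) = κ p * g := by
      intro p hp g
      refine ((hκ _ (by rw [hq.bundle.proj_act]; exact hp) _).1 ?_).symm
      rw [hq.bundle.proj_act, ← op_smul_op_smul, (hκ p hp _).2 rfl]
    set r := Function.surjInv hq.sections_space.surjective with hr
    have hκ' : ∀ p, π p ∈ U → πG (κ (r (ζ p))) = πG (κ p) := by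
      intro p hp
      have h1 : ζ p = ζ (r (ζ p)) := (Function.surjInv_eq hq.sections_space.surjective _).symm
      obtain ⟨h, hh, he⟩ := (hq.fiber _ _).1 h1
      rw [he, hκmul p hp, map_mul, hh, mul_one]
    refine ⟨U, hU, hx, fun y => ζ (s y), fun p' => πG (κ (r p')),
      hq.sections_space.smooth.comp_contMDiffOn hs, ?_, ?_, ?_⟩
    · intro p' hp'
      obtain ⟨p, rfl⟩ := hq.sections_space.surjective p'
      have hp : π p ∈ U := by simpa [hq.proj] using hp'
      have hUo : π ⁻¹' U ∈ 𝓝 p := (hU.preimage hq.bundle.smooth_proj.continuous).mem_nhds hp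
      apply ContMDiffAt.contMDiffWithinAt
      apply hq.sections_space.contMDiffAt_of_comp
      have h1 : ContMDiffAt 𝓘(ℝ, EP) 𝓘(ℝ, EG') ∞ (fun p => πG (κ p)) p :=
        ContMDiffAt.comp p (hq.sections_group.smooth _) (hκs.contMDiffAt hUo)
      refine h1.congr_of_eventuallyEq ?_
      filter_upwards [hUo] with q hqU using hκ' q hqU
    · intro y hy
      rw [hq.proj, hπs y hy]
    · intro p' hp' g'
      obtain ⟨p, rfl⟩ := hq.sections_space.surjective p'
      obtain ⟨g, rfl⟩ := hq.sections_group.surjective g'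
      rw [hq.proj] at hp' ⊢
      dsimp only
      rw [hκ' p hp', ← hq.map_smul, hq.fiber]
      constructor
      · rintro ⟨h, hh, he⟩
        rw [op_smul_op_smul] at he
        rw [← (hκ p hp' _).1 he.symm, map_mul, hh, mul_one]
      · intro h
        refine ⟨g⁻¹ * κ p, by rw [map_mul, map_inv, h, inv_mul_cancel], ?_⟩
        rw [op_smul_op_smul, mul_inv_cancel_left, (hκ p hp' _).2 rfl]

variable (hq : IsBundleQuotient EG EM EP EG' EP' πG ζ π π')
include hq

theorem dmap_proj (p : P) (v : EP) :
    dmap EP' EM π' (ζ p) (dmap EP EP' ζ p v) = dmap EP EM π p v := by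
  rw [← dmap_comp (g := π') (f := ζ) (ContMDiff.mdiffAt hq.isPrincipalBundle.smooth_proj _)
    (ContMDiff.mdiffAt hq.sections_space.smooth _)]
  simp only [hq.proj]

theorem dmap_fundamental (p : P) (ξ : EG) :
    dmap EP EP' ζ p (fundamental EG G EP p ξ) =
      fundamental EG' G' EP' (ζ p) (dmap EG EG' πG 1 ξ) := by
  have h1 := dmap_comp (g := ζ) (f := fun g : G => MulOpposite.op g • p) (x := 1)
    (ContMDiff.mdiffAt hq.sections_space.smooth _)
    (ContMDiff.mdiffAt (hq.bundle.contMDiff_orbit p) _) ξ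
  have h2 := dmap_comp (g := fun g : G' => MulOpposite.op g • ζ p) (f := πG) (x := 1)
    (ContMDiff.mdiffAt (hq.isPrincipalBundle.contMDiff_orbit (ζ p)) _)
    (ContMDiff.mdiffAt hq.sections_group.smooth _) ξ
  rw [MulOpposite.op_one, one_smul] at h1
  rw [map_one] at h2
  rw [fundamental, fundamental, ← h1, ← h2]
  simp only [hq.map_smul]

theorem dmap_smul (p : P) (g : G) (v : EP) :
    dmap EP EP' ζ (MulOpposite.op g • p) (dmap EP EP (fun q : P => MulOpposite.op g • q) p v) =
      dmap EP' EP' (fun q : P' => MulOpposite.op (πG g) • q) (ζ p) (dmap EP EP' ζ p v) := by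
  rw [← dmap_comp (g := ζ) (f := fun q : P => MulOpposite.op g • q)
      (ContMDiff.mdiffAt hq.sections_space.smooth _)
      (ContMDiff.mdiffAt (hq.bundle.contMDiff_smul g) _),
    ← dmap_comp (g := fun q : P' => MulOpposite.op (πG g) • q) (f := ζ)
      (ContMDiff.mdiffAt (hq.isPrincipalBundle.contMDiff_smul _) _)
      (ContMDiff.mdiffAt hq.sections_space.smooth _)]
  simp only [hq.map_smul]

end IsBundleQuotient

end BundleQuotients

/-! ### Naturality of the adjoint representation -/

section Adjoint

variable {EG : Type*} [NormedAddCommGroup EG] [NormedSpace ℝ EG]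
  {G : Type*} [TopologicalSpace G] [ChartedSpace EG G] [Group G] [LieGroup 𝓘(ℝ, EG) ∞ G]
  {EG' : Type*} [NormedAddCommGroup EG'] [NormedSpace ℝ EG']
  {G' : Type*} [TopologicalSpace G'] [ChartedSpace EG' G'] [Group G'] [LieGroup 𝓘(ℝ, EG') ∞ G']

theorem contMDiff_conj (g : G) : ContMDiff 𝓘(ℝ, EG) 𝓘(ℝ, EG) ∞ (fun x : G => g * x * g⁻¹) :=
  contMDiff_mul_right.comp contMDiff_mul_left

omit [LieGroup 𝓘(ℝ, EG) ∞ G] in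
theorem Ad_one (ξ : EG) : Ad EG (1 : G) ξ = ξ := by
  simp only [Ad, one_mul, inv_one, mul_one]
  exact dmap_id _ _

theorem Ad_mul (g h : G) (ξ : EG) : Ad EG (g * h) ξ = Ad EG g (Ad EG h ξ) := by
  have h1 := dmap_comp (g := fun x : G => g * x * g⁻¹) (f := fun x : G => h * x * h⁻¹) (x := 1)
    (ContMDiff.mdiffAt (contMDiff_conj g) _) (ContMDiff.mdiffAt (contMDiff_conj (EG := EG) h) _) ξ
  rw [mul_one, mul_inv_cancel] at h1
  rw [Ad, Ad, Ad, ← h1]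
  simp only [mul_inv_rev, mul_assoc]

theorem dmap_Ad {f : G →* G'} (hf : ContMDiff 𝓘(ℝ, EG) 𝓘(ℝ, EG') ∞ f) (g : G) (ξ : EG) :
    dmap EG EG' f 1 (Ad EG g ξ) = Ad EG' (f g) (dmap EG EG' f 1 ξ) := by
  have h1 := dmap_comp (g := f) (f := fun x : G => g * x * g⁻¹) (x := 1)
    (ContMDiff.mdiffAt hf _) (ContMDiff.mdiffAt (contMDiff_conj (EG := EG) g) _) ξ
  have h2 := dmap_comp (g := fun x : G' => f g * x * (f g)⁻¹) (f := f) (x := 1)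
    (ContMDiff.mdiffAt (contMDiff_conj (EG := EG') (f g)) _) (ContMDiff.mdiffAt hf _) ξ
  rw [mul_one, mul_inv_cancel] at h1
  rw [map_one] at h2
  rw [Ad, Ad, ← h1, ← h2]
  simp only [map_mul, map_inv]

end Adjoint

/-! ### Naturality of the exterior derivative -/

section ExteriorDerivative

variable {V : Type*} [NormedAddCommGroup V] [NormedSpace ℝ V]
  {V' : Type*} [NormedAddCommGroup V'] [NormedSpace ℝ V']
  {EP : Type*} [NormedAddCommGroup EP] [NormedSpace ℝ EP]
  {P : Type*} [TopologicalSpace P] [ChartedSpace EP P] [IsManifold 𝓘(ℝ, EP) ∞ P]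
  {EP' : Type*} [NormedAddCommGroup EP'] [NormedSpace ℝ EP']
  {P' : Type*} [TopologicalSpace P'] [ChartedSpace EP' P'] [IsManifold 𝓘(ℝ, EP') ∞ P']

theorem mdifferentiableAt_extChartAt_symm (p : P) {y : EP}
    (hy : y ∈ (extChartAt 𝓘(ℝ, EP) p).target) :
    MDifferentiableAt 𝓘(ℝ, EP) 𝓘(ℝ, EP) (extChartAt 𝓘(ℝ, EP) p).symm y :=
  ((contMDiffOn_extChartAt_symm (n := ∞) p).contMDiffAt
    ((isOpen_extChartAt_target p).mem_nhds hy)).mdifferentiableAt (by simp)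

/-- A smooth `1`-form is smooth in a chart. -/
theorem differentiableAt_localForm [FiniteDimensional ℝ EP] {A : P → EP →L[ℝ] V}
    (hA : ContMDiff 𝓘(ℝ, EP).tangent 𝓘(ℝ, V) ∞
      (fun v : TangentBundle 𝓘(ℝ, EP) P => A v.proj v.snd)) (p : P) :
    DifferentiableAt ℝ (localForm A p) (extChartAt 𝓘(ℝ, EP) p p) := by
  set T := (extChartAt 𝓘(ℝ, EP) p).target with hT
  have hTo : IsOpen T := isOpen_extChartAt_target p
  have hpT : extChartAt 𝓘(ℝ, EP) p p ∈ T := mem_extChartAt_target p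
  have hs : ContMDiffOn 𝓘(ℝ, EP) 𝓘(ℝ, EP) ∞ (extChartAt 𝓘(ℝ, EP) p).symm T :=
    contMDiffOn_extChartAt_symm p
  have h1 := hs.contMDiffOn_tangentMapWithin (m := ∞) (by simp) hTo.uniqueMDiffOn
  suffices h : ContDiffOn ℝ ∞ (localForm A p) T from
    (h.contDiffAt (hTo.mem_nhds hpT)).differentiableAt (by simp)
  rw [contDiffOn_clm_apply]
  intro w
  have h2 : ContMDiff 𝓘(ℝ, EP) 𝓘(ℝ, EP).tangent ∞
      (fun y : EP => (⟨y, w⟩ : TangentBundle 𝓘(ℝ, EP) EP)) :=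
    contMDiff_vectorSpace_iff_contDiff.2 contDiff_const
  have h3 : ContMDiffOn 𝓘(ℝ, EP) 𝓘(ℝ, EP).tangent ∞ (fun y : EP =>
      tangentMapWithin 𝓘(ℝ, EP) 𝓘(ℝ, EP) (extChartAt 𝓘(ℝ, EP) p).symm T
        (⟨y, w⟩ : TangentBundle 𝓘(ℝ, EP) EP)) T :=
    h1.comp h2.contMDiffOn (fun y hy => hy)
  have h4 := hA.comp_contMDiffOn h3
  refine (contMDiffOn_iff_contDiffOn.1 h4).congr fun y hy => ?_
  have e : mfderivWithin 𝓘(ℝ, EP) 𝓘(ℝ, EP) (extChartAt 𝓘(ℝ, EP) p).symm T y =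
      mfderiv 𝓘(ℝ, EP) 𝓘(ℝ, EP) (extChartAt 𝓘(ℝ, EP) p).symm y := mfderivWithin_of_isOpen hTo hy
  exact (congrArg (fun L : EP →L[ℝ] EP => A ((extChartAt 𝓘(ℝ, EP) p).symm y) (L w)) e).symm

/-- The exterior derivative is natural: `f^* B = L ∘ A` implies `f^* dB = L ∘ dA`. Read in
charts, the derivative of the first identity has an additional term with the second derivative of
`f`, which is symmetric and cancels in `dB`. -/
theorem extDer_pullback {A : P → EP →L[ℝ] V} {B : P' → EP' →L[ℝ] V'} {f : P → P'} {L : V →L[ℝ] V'}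
    (hf : ContMDiff 𝓘(ℝ, EP) 𝓘(ℝ, EP') ∞ f)
    (h : ∀ p v, B (f p) (dmap EP EP' f p v) = L (A p v)) {p : P}
    (hA : DifferentiableAt ℝ (localForm A p) (extChartAt 𝓘(ℝ, EP) p p))
    (hB : DifferentiableAt ℝ (localForm B (f p)) (extChartAt 𝓘(ℝ, EP') (f p) (f p)))
    (v w : EP) :
    extDer B (f p) (dmap EP EP' f p v) (dmap EP EP' f p w) = L (extDer A p v w) := by
  set φ := extChartAt 𝓘(ℝ, EP) p with hφ
  set ψ := extChartAt 𝓘(ℝ, EP') (f p) with hψ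
  set x := φ p with hx
  set z : EP → EP' := fun y => ψ (f (φ.symm y)) with hz
  have hxT : x ∈ φ.target := mem_extChartAt_target p
  have hTo : IsOpen φ.target := isOpen_extChartAt_target p
  have hφx : φ.symm x = p := extChartAt_to_inv p
  have hzx : z x = ψ (f p) := by simp only [hz, hφx]
  have hzs : ContDiffAt ℝ ∞ z x := by
    have := (contMDiffAt_iff.1 (hf p)).2
    rw [modelWithCornersSelf_coe, range_id, contDiffWithinAt_univ] at this
    exact this
  have hdz : fderiv ℝ z x = dmap EP EP' f p := by
    have hm : MDifferentiableAt 𝓘(ℝ, EP) 𝓘(ℝ, EP') f p := ContMDiff.mdiffAt hf p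
    have := hm.mfderiv
    rw [dmap, this]
    simp only [modelWithCornersSelf_coe, range_id, fderivWithin_univ]
    rfl
  have hV : ∀ᶠ y in 𝓝 x, y ∈ φ.target ∧ f (φ.symm y) ∈ ψ.source ∧ ContDiffAt ℝ 1 z y := by
    have h1 : ContinuousAt (fun y => f (φ.symm y)) x :=
      ContinuousAt.comp (by rw [hφx]; exact hf.continuous.continuousAt)
        (continuousAt_extChartAt_symm p)
    have h2 : ψ.source ∈ 𝓝 (f (φ.symm x)) := by
      rw [hφx]; exact extChartAt_source_mem_nhds (f p)
    filter_upwards [hTo.mem_nhds hxT, h1 h2, (hzs.of_le (m := 1) (by simp)).eventually (by simp)]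
      with y h1 h2 h3 using ⟨h1, h2, h3⟩
  -- the hypothesis `h` read in the charts
  have key : ∀ᶠ y in 𝓝 x, ∀ w, localForm B (f p) (z y) (fderiv ℝ z y w) =
      L (localForm A p y w) := by
    filter_upwards [hV.eventually_nhds] with y hy w
    obtain ⟨hyT, hyS, hyz⟩ := hy.self_of_nhds
    have hzT : z y ∈ ψ.target := ψ.map_source hyS
    have e1 : ψ.symm (z y) = f (φ.symm y) := ψ.left_inv hyS
    have e2 : dmap EP' EP' ψ.symm (z y) (fderiv ℝ z y w) =
        dmap EP EP' f (φ.symm y) (dmap EP EP φ.symm y w) := by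
      rw [← dmap_comp (g := f) (f := φ.symm) (ContMDiff.mdiffAt hf _)
        (mdifferentiableAt_extChartAt_symm p hyT)]
      have hzd : MDifferentiableAt 𝓘(ℝ, EP) 𝓘(ℝ, EP') z y :=
        (hyz.differentiableAt (by simp)).mdifferentiableAt
      have e3 : dmap EP EP' z y = fderiv ℝ z y := mfderiv_eq_fderiv
      rw [← e3, ← dmap_comp (g := ψ.symm) (f := z)
        (mdifferentiableAt_extChartAt_symm (f p) hzT) hzd]
      refine congrArg (fun M : EP →L[ℝ] EP' => M w) (dmap_congr ?_)
      filter_upwards [hy] with y' hy' using ψ.left_inv hy'.2.1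
    simp only [localForm, ContinuousLinearMap.comp_apply]
    rw [← h, ← hψ, e1, e2]
  -- differentiate `key` along `u`
  have hB' : DifferentiableAt ℝ (localForm B (f p)) (z x) := by rw [hzx]; exact hB
  have hzd : DifferentiableAt ℝ z x := hzs.differentiableAt (by simp)
  have hz2 : DifferentiableAt ℝ (fderiv ℝ z) x :=
    (hzs.fderiv_right (m := 1)
      (by rw [one_add_one_eq_two]; exact ENat.LEInfty.out)).differentiableAt (by simp)
  have hd : ∀ u w, fderiv ℝ (localForm B (f p)) (z x) (fderiv ℝ z x u) (fderiv ℝ z x w) +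
      localForm B (f p) (z x) (fderiv ℝ (fderiv ℝ z) x u w) =
        L (fderiv ℝ (localForm A p) x u w) := by
    intro u w
    have h1 : HasFDerivAt (fun y => localForm B (f p) (z y) (fderiv ℝ z y w)) _ x :=
      (hB'.hasFDerivAt.comp x hzd.hasFDerivAt).clm_apply
        (hz2.hasFDerivAt.clm_apply (hasFDerivAt_const w x))
    have h2 : HasFDerivAt (fun y => L (localForm A p y w)) _ x :=
      L.hasFDerivAt.comp x (hA.hasFDerivAt.clm_apply (hasFDerivAt_const w x))
    have h3 := h1.congr_of_eventuallyEq (f₁ := fun y => L (localForm A p y w))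
      (by filter_upwards [key] with y hy using (hy w).symm)
    have h4 := congrArg (fun M : EP →L[ℝ] V' => M u) (h3.unique h2)
    simpa [add_comm] using h4
  have hsymm : fderiv ℝ (fderiv ℝ z) x v w = fderiv ℝ (fderiv ℝ z) x w v :=
    (hzs.isSymmSndFDerivAt
      (minSmoothness_of_isRCLikeNormedField.le.trans ENat.LEInfty.out)).eq v w
  rw [extDer, extDer, map_sub, ← hd v w, ← hd w v, hsymm, hdz, hzx]
  abel

end ExteriorDerivative

/-! ### Induced connections and induced sections -/

section Induced

variable {EG : Type*} [NormedAddCommGroup EG] [NormedSpace ℝ EG]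
  {G : Type*} [TopologicalSpace G] [ChartedSpace EG G] [Group G]
  {EM : Type*} [NormedAddCommGroup EM] [NormedSpace ℂ EM]
  {M : Type*} [TopologicalSpace M] [ChartedSpace EM M]
  {EP : Type*} [NormedAddCommGroup EP] [NormedSpace ℝ EP]
  {P : Type*} [TopologicalSpace P] [ChartedSpace EP P] [MulAction Gᵐᵒᵖ P]
  {EG' : Type*} [NormedAddCommGroup EG'] [NormedSpace ℝ EG']
  {G' : Type*} [TopologicalSpace G'] [ChartedSpace EG' G'] [Group G']
  {EP' : Type*} [NormedAddCommGroup EP'] [NormedSpace ℝ EP']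
  {P' : Type*} [TopologicalSpace P'] [ChartedSpace EP' P'] [MulAction G'ᵐᵒᵖ P']
  {πG : G →* G'} {ζ : P → P'} {π : P → M} {π' : P' → M}
  (hq : IsBundleQuotient EG EM EP EG' EP' πG ζ π π')
include hq

section Sections

variable {EX : Type*} [NormedAddCommGroup EX] [NormedSpace ℝ EX]
  {X : Type*} [TopologicalSpace X] [ChartedSpace EX X] {ρ : G →* Equiv.Perm X}
  {EX' : Type*} [NormedAddCommGroup EX'] [NormedSpace ℝ EX']
  {X' : Type*} [TopologicalSpace X'] [ChartedSpace EX' X'] {ρ' : G' →* Equiv.Perm X'}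
  {f : X → X'}

/-- In terms of the equivariant maps that represent sections, `ψ` is induced by `φ` if and only if
`ψ ∘ ζ = f ∘ φ`. -/
theorem inducedSection_iff (hequiv : ∀ (g : G) (x : X), f (ρ g x) = ρ' (πG g) (f x))
    {φ : AssocSection EP EX π ρ} {ψ : AssocSection EP' EX' π' ρ'} :
    InducedSection ζ f φ ψ ↔ ∀ p, ψ.lift (ζ p) = f (φ.lift p) := by
  constructor
  · intro h p
    apply ψ.lift_eq hq.isPrincipalBundle
    rw [hq.proj]
    exact h _ _ _ (φ.toFun_proj p)
  · intro h x p q hx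
    obtain ⟨p₀, rfl⟩ := hq.bundle.surjective x
    rw [φ.toFun_proj] at hx
    obtain ⟨g, rfl, rfl⟩ := AssocBundle.mk_eq_mk.1 hx
    have h1 := ψ.toFun_proj (ζ p₀)
    rw [hq.proj, h] at h1
    rw [h1, AssocBundle.mk_eq_mk]
    exact ⟨πG g, hq.map_smul g p₀, by rw [hequiv, map_inv]⟩

theorem exists_inducedSection (hf : ContMDiff 𝓘(ℝ, EX) 𝓘(ℝ, EX') ∞ f)
    (hequiv : ∀ (g : G) (x : X), f (ρ g x) = ρ' (πG g) (f x)) (φ : AssocSection EP EX π ρ) :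
    ∃ ψ : AssocSection EP' EX' π' ρ', InducedSection ζ f φ ψ := by
  set r := Function.surjInv hq.sections_space.surjective with hr
  have h1 : ∀ p, f (φ.lift (r (ζ p))) = f (φ.lift p) := by
    intro p
    have h1 : ζ p = ζ (r (ζ p)) := (Function.surjInv_eq hq.sections_space.surjective _).symm
    obtain ⟨h, hh, he⟩ := (hq.fiber _ _).1 h1
    rw [he, φ.lift_smul hq.bundle, hequiv, map_inv, hh]
    simp
  obtain ⟨ψ, hψ⟩ := AssocSection.exists_of_lift (EX := EX') (ρ := ρ') hq.isPrincipalBundle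
    (f := fun p' => f (φ.lift (r p')))
    (by
      apply hq.sections_space.contMDiff_of_comp
      simp only [h1]
      exact hf.comp φ.lift_smooth)
    (by
      intro g' p'
      obtain ⟨p, rfl⟩ := hq.sections_space.surjective p'
      obtain ⟨g, rfl⟩ := hq.sections_group.surjective g'
      rw [← hq.map_smul, h1, h1, φ.lift_smul hq.bundle, hequiv, map_inv])
  refine ⟨ψ, (inducedSection_iff hq hequiv).2 fun p => ?_⟩
  rw [hψ, h1]

end Sections

variable [LieGroup 𝓘(ℝ, EG) ∞ G] [LieGroup 𝓘(ℝ, EG') ∞ G']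
  [IsManifold 𝓘(ℝ, EP) ∞ P] [IsManifold 𝓘(ℝ, EP') ∞ P']

omit [IsManifold 𝓘(ℝ, EP') ∞ P'] in
/-- `dπ_G ∘ A` descends to the quotient bundle: the kernel of `dζ` consists of the vertical vectors
`ξ^♯` with `dπ_G ξ = 0`. -/
theorem dmap_form_eq (A : Connection EG G EP P) {p q : P} {v w : EP} (hpq : ζ p = ζ q)
    (hvw : dmap EP EP' ζ p v = dmap EP EP' ζ q w) :
    dmap EG EG' πG 1 (A.form p v) = dmap EG EG' πG 1 (A.form q w) := by
  obtain ⟨h, hh, rfl⟩ := (hq.fiber _ _).1 hpq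
  set v' := dmap EP EP (fun q : P => MulOpposite.op h • q) p v with hv'
  have h1 : dmap EP EP' ζ (MulOpposite.op h • p) v' = dmap EP EP' ζ p v := by
    rw [hv', hq.dmap_smul, hh]
    simp only [MulOpposite.op_one, one_smul]
    exact dmap_id _ _
  have h2 : dmap EG EG' πG 1 (A.form (MulOpposite.op h • p) v') =
      dmap EG EG' πG 1 (A.form p v) := by
    rw [hv', A.equivariant, dmap_Ad hq.sections_group.smooth, map_inv, hh, inv_one, Ad_one]
  rw [← h2, ← sub_eq_zero, ← map_sub, ← map_sub]
  have h3 : dmap EP EP' ζ (MulOpposite.op h • p) (v' - w) = 0 := by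
    rw [map_sub, h1, hvw, sub_self]
  have h4 : dmap EP EM π (MulOpposite.op h • p) (v' - w) = 0 := by
    rw [← hq.dmap_proj, h3, map_zero]
  obtain ⟨ξ, hξ⟩ := hq.bundle.exists_fundamental_eq h4
  rw [← hξ, A.vertical]
  rw [← hξ, hq.dmap_fundamental] at h3
  exact hq.isPrincipalBundle.fundamental_injective _ (h3.trans (map_zero _).symm)

/-- The value of the induced connection is computed with arbitrary lifts, on which it does not
depend by `dmap_form_eq`; it is smooth because the lifts can be taken along a local section. -/
theorem exists_inducedConnection (A : Connection EG G EP P) :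
    ∃ B : Connection EG' G' EP' P', InducedConnection πG ζ A B := by
  -- a right inverse of `dζ` at a point over `p'`, as the differential of a local section
  have hR : ∀ p' : P', ∃ (p : P) (R : EP' →L[ℝ] EP), ζ p = p' ∧
      ∀ v, dmap EP EP' ζ p (R v) = v := by
    intro p'
    obtain ⟨p, rfl⟩ := hq.sections_space.surjective p'
    obtain ⟨U, hU, hxU, s, hs, hsx, hfs⟩ := hq.sections_space.exists_section p
    refine ⟨p, dmap EP' EP s (ζ p), rfl, fun v => ?_⟩
    have h1 := dmap_comp (g := ζ) (f := s) (x := ζ p)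
      (ContMDiff.mdiffAt hq.sections_space.smooth _)
      ((hs.contMDiffAt (hU.mem_nhds hxU)).mdifferentiableAt (by simp)) v
    have h2 : (fun y => ζ (s y)) =ᶠ[𝓝 (ζ p)] fun y => y := by
      filter_upwards [hU.mem_nhds hxU] with y hy using hfs y hy
    rw [dmap_congr h2, dmap_id, hsx] at h1
    exact h1.symm
  choose r R hr hR using hR
  set form : P' → EP' →L[ℝ] EG' := fun p' => (dmap EG EG' πG 1).comp ((A.form (r p')).comp (R p'))
    with hform
  have key : ∀ p v, form (ζ p) (dmap EP EP' ζ p v) = dmap EG EG' πG 1 (A.form p v) := by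
    intro p v
    simp only [hform, ContinuousLinearMap.comp_apply]
    exact dmap_form_eq hq A (hr _) (hR _ _)
  refine ⟨⟨form, ?_, ?_, ?_⟩, key⟩
  · intro v₀
    obtain ⟨p, hp⟩ := hq.sections_space.surjective v₀.proj
    obtain ⟨U, hU, hxU, s, hs, hsx, hfs⟩ := hq.sections_space.exists_section p
    rw [hp] at hxU
    have h1 := hs.contMDiffOn_tangentMapWithin (m := ∞) (by simp) hU.uniqueMDiffOn
    have h2 := A.smooth.comp_contMDiffOn h1
    have hL : ContMDiff 𝓘(ℝ, EG) 𝓘(ℝ, EG') ∞ (dmap EG EG' πG 1) :=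
      (dmap EG EG' πG 1).contDiff.contMDiff
    have h3 := hL.comp_contMDiffOn h2
    have hUo : IsOpen ((fun v : TangentBundle 𝓘(ℝ, EP') P' => v.proj) ⁻¹' U) :=
      hU.preimage (FiberBundle.continuous_proj EP' (TangentSpace 𝓘(ℝ, EP') : P' → Type _))
    have hsec : ∀ y ∈ U, ∀ u, dmap EP EP' ζ (s y) (dmap EP' EP s y u) = u := by
      intro y hy u
      have e1 := dmap_comp (g := ζ) (f := s) (x := y)
        (ContMDiff.mdiffAt hq.sections_space.smooth _)
        ((hs.contMDiffAt (hU.mem_nhds hy)).mdifferentiableAt (by simp)) u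
      have e2 : (fun y => ζ (s y)) =ᶠ[𝓝 y] fun y => y := by
        filter_upwards [hU.mem_nhds hy] with y hy using hfs y hy
      rw [dmap_congr e2, dmap_id] at e1
      exact e1.symm
    have hform_sec : ∀ y ∈ U, ∀ u,
        form y u = dmap EG EG' πG 1 (A.form (s y) (dmap EP' EP s y u)) := by
      intro y hy u
      have h := key (s y) (dmap EP' EP s y u)
      rwa [hsec y hy, hfs y hy] at h
    refine (h3.contMDiffAt (hUo.mem_nhds hxU)).congr_of_eventuallyEq ?_
    filter_upwards [hUo.mem_nhds hxU] with v hv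
    have hv' : v.proj ∈ U := hv
    have e : mfderivWithin 𝓘(ℝ, EP') 𝓘(ℝ, EP) s U v.proj = mfderiv 𝓘(ℝ, EP') 𝓘(ℝ, EP) s v.proj :=
      mfderivWithin_of_isOpen hU hv'
    refine (hform_sec _ hv' v.snd).trans ?_
    exact (congrArg (fun L : EP' →L[ℝ] EP => dmap EG EG' πG 1 (A.form (s v.proj) (L v.snd))) e).symm
  · intro p' ξ'
    obtain ⟨p, rfl⟩ := hq.sections_space.surjective p'
    obtain ⟨ξ, rfl⟩ := hq.sections_group.dmap_surjective 1 ξ'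
    rw [← hq.dmap_fundamental, key, A.vertical]
  · intro p' g' v'
    obtain ⟨p, rfl⟩ := hq.sections_space.surjective p'
    obtain ⟨g, rfl⟩ := hq.sections_group.surjective g'
    obtain ⟨v, rfl⟩ := hq.sections_space.dmap_surjective p v'
    rw [← hq.dmap_smul, ← hq.map_smul, key, key, A.equivariant, dmap_Ad hq.sections_group.smooth,
      map_inv]

omit [LieGroup 𝓘(ℝ, EG) ∞ G] [LieGroup 𝓘(ℝ, EG') ∞ G'] in
theorem curvature_induced [FiniteDimensional ℝ EP] [FiniteDimensional ℝ EP']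
    {A : Connection EG G EP P} {B : Connection EG' G' EP' P'}
    (hAB : InducedConnection πG ζ A B) (p : P) (v w : EP) :
    B.curvature (ζ p) (dmap EP EP' ζ p v) (dmap EP EP' ζ p w) =
      dmap EG EG' πG 1 (A.curvature p v w) := by
  have hhor : ∀ v, B.hor (ζ p) (dmap EP EP' ζ p v) = dmap EP EP' ζ p (A.hor p v) := by
    intro v
    rw [Connection.hor, Connection.hor, hAB, map_sub, hq.dmap_fundamental]
  rw [Connection.curvature, Connection.curvature, hhor, hhor]
  exact extDer_pullback hq.sections_space.smooth hAB (differentiableAt_localForm A.smooth p)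
    (differentiableAt_localForm B.smooth (ζ p)) _ _

omit [LieGroup 𝓘(ℝ, EG) ∞ G] [LieGroup 𝓘(ℝ, EG') ∞ G'] in
theorem curvatureZeroTwo_induced [FiniteDimensional ℝ EP] [FiniteDimensional ℝ EP']
    {A : Connection EG G EP P} {B : Connection EG' G' EP' P'}
    (hAB : InducedConnection πG ζ A B) (hA : A.CurvatureZeroTwo (EM := EM) π) :
    B.CurvatureZeroTwo (EM := EM) π' := by
  intro p' v w v' w' hv hw
  obtain ⟨p, rfl⟩ := hq.sections_space.surjective p'
  obtain ⟨v, rfl⟩ := hq.sections_space.dmap_surjective p v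
  obtain ⟨w, rfl⟩ := hq.sections_space.dmap_surjective p w
  obtain ⟨v', rfl⟩ := hq.sections_space.dmap_surjective p v'
  obtain ⟨w', rfl⟩ := hq.sections_space.dmap_surjective p w'
  rw [hq.dmap_proj, hq.dmap_proj] at hv hw
  obtain ⟨h1, h2⟩ := hA p v w v' w' hv hw
  simp only [curvature_induced hq hAB]
  rw [← map_sub, ← map_add, h1, h2, map_zero]
  exact ⟨rfl, rfl⟩

end Induced

/-! ### The infinitesimal action and the first vortex equation -/

section InfinitesimalAction

variable {EG : Type*} [NormedAddCommGroup EG] [NormedSpace ℝ EG]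
  {G : Type*} [TopologicalSpace G] [ChartedSpace EG G] [Group G]
  {EGC : Type*} [NormedAddCommGroup EGC] [NormedSpace ℂ EGC]
  {GC : Type*} [TopologicalSpace GC] [ChartedSpace EGC GC] [Group GC]
  {EF : Type*} [NormedAddCommGroup EF] [NormedSpace ℂ EF]
  {F : Type*} [TopologicalSpace F] [ChartedSpace EF F] [MulAction GC F]

instance contMDiffSMul_real_of_complex [ContMDiffSMul 𝓘(ℂ, EGC) 𝓘(ℂ, EF) ω GC F] :
    ContMDiffSMul 𝓘(ℝ, EGC) 𝓘(ℝ, EF) ∞ GC F :=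
  ⟨contMDiff_prod_complexToReal ContMDiffSMul.contMDiff_smul⟩

theorem contMDiff_const_smul_complex [ContMDiffSMul 𝓘(ℂ, EGC) 𝓘(ℂ, EF) ω GC F]
    (x : GC) :
    ContMDiff 𝓘(ℂ, EF) 𝓘(ℂ, EF) ω (fun q : F => x • q) :=
  ContMDiff.comp (g := fun x : GC × F => x.1 • x.2)
    (ContMDiffSMul.contMDiff_smul (I := 𝓘(ℂ, EGC)) (I' := 𝓘(ℂ, EF)) (n := ω))
    (contMDiff_const.prodMk contMDiff_id)

variable [ContMDiffSMul 𝓘(ℂ, EGC) 𝓘(ℂ, EF) ω GC F]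

variable (EGC GC EF) in
/-- The infinitesimal action of `𝔤_ℂ` on `F` at the point `q`. -/
noncomputable def cInfAct (q : F) : EGC →L[ℝ] EF := dmap EGC EF (fun x : GC => x • q) 1

theorem contMDiff_smul_real :
    ContMDiff (𝓘(ℝ, EGC).prod 𝓘(ℝ, EF)) 𝓘(ℝ, EF) ∞ (fun x : GC × F => x.1 • x.2) :=
  ContMDiffSMul.contMDiff_smul

theorem contMDiff_orbit_complex (q : F) :
    ContMDiff 𝓘(ℂ, EGC) 𝓘(ℂ, EF) ω (fun x : GC => x • q) :=
  ContMDiff.comp (g := fun x : GC × F => x.1 • x.2)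
    (ContMDiffSMul.contMDiff_smul (I := 𝓘(ℂ, EGC)) (I' := 𝓘(ℂ, EF)) (n := ω))
    (contMDiff_id.prodMk contMDiff_const)

theorem cInfAct_I_smul (q : F) (ξ : EGC) :
    cInfAct EGC GC EF q (Complex.I • ξ) = Complex.I • cInfAct EGC GC EF q ξ :=
  dmap_I_smul ((contMDiff_orbit_complex q 1).mdifferentiableAt (by simp)) ξ

theorem infAct_eq {ι : G →* GC} (hι : ContMDiff 𝓘(ℝ, EG) 𝓘(ℝ, EGC) ∞ ι) (q : F) (ξ : EG) :
    infAct (EF := EF) ι q ξ = cInfAct EGC GC EF q (lieMap ι ξ) := by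
  have h := dmap_comp (g := fun x : GC => x • q) (f := ι) (x := 1)
    (ContMDiff.mdiffAt (contMDiff_complexToReal
      (contMDiff_orbit_complex (EGC := EGC) (EF := EF) q)) _)
    (ContMDiff.mdiffAt hι _) ξ
  rw [map_one] at h
  exact h

theorem contMDiff_orbit_compact {ι : G →* GC} (hι : ContMDiff 𝓘(ℝ, EG) 𝓘(ℝ, EGC) ∞ ι) (q : F) :
    ContMDiff 𝓘(ℝ, EG) 𝓘(ℝ, EF) ∞ (fun g : G => ι g • q) :=
  (contMDiff_complexToReal (contMDiff_orbit_complex (EGC := EGC) (EF := EF) q)).comp hι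

variable {EG' : Type*} [NormedAddCommGroup EG'] [NormedSpace ℝ EG']
  {G' : Type*} [TopologicalSpace G'] [ChartedSpace EG' G'] [Group G']
  {GC' : Type*} [Group GC']
  {EF' : Type*} [NormedAddCommGroup EF'] [NormedSpace ℂ EF']
  {F' : Type*} [TopologicalSpace F'] [ChartedSpace EF' F'] [MulAction GC' F']
  {ι : G →* GC} {ι' : G' →* GC'} {πG : G →* G'} {πF : F → F'}

theorem infAct_induced (hι : ContMDiff 𝓘(ℝ, EG) 𝓘(ℝ, EGC) ∞ ι)
    (hG : HasLocalSections 𝓘(ℝ, EG) 𝓘(ℝ, EG') πG)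
    (hF : ContMDiff 𝓘(ℝ, EF) 𝓘(ℝ, EF') ∞ πF)
    (hact : ∀ (g : G) (q : F), ι' (πG g) • πF q = πF (ι g • q)) (q : F) (ξ : EG) :
    dmap EG' EF' (fun g : G' => ι' g • πF q) 1 (dmap EG EG' πG 1 ξ) =
      dmap EF EF' πF q (infAct (EF := EF) ι q ξ) := by
  have h0 := contMDiff_orbit_compact (EF := EF) hι q
  have h1 : ContMDiff 𝓘(ℝ, EG') 𝓘(ℝ, EF') ∞ (fun g : G' => ι' g • πF q) := by
    apply hG.contMDiff_of_comp
    simp only [hact]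
    exact hF.comp h0
  have h2 := dmap_comp (g := fun g : G' => ι' g • πF q) (f := πG) (x := 1)
    (ContMDiff.mdiffAt h1 _) (ContMDiff.mdiffAt hG.smooth _) ξ
  have h3 := dmap_comp (g := πF) (f := fun g : G => ι g • q) (x := 1)
    (ContMDiff.mdiffAt hF _) (ContMDiff.mdiffAt h0 _) ξ
  rw [map_one] at h2
  rw [map_one, one_smul] at h3
  rw [infAct, ← h2, ← h3]
  simp only [hact]

variable {EM : Type*} [NormedAddCommGroup EM] [NormedSpace ℂ EM]
  {M : Type*} [TopologicalSpace M] [ChartedSpace EM M]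
  {EP : Type*} [NormedAddCommGroup EP] [NormedSpace ℝ EP]
  {P : Type*} [TopologicalSpace P] [ChartedSpace EP P] [MulAction Gᵐᵒᵖ P]
  {EP' : Type*} [NormedAddCommGroup EP'] [NormedSpace ℝ EP']
  {P' : Type*} [TopologicalSpace P'] [ChartedSpace EP' P'] [MulAction G'ᵐᵒᵖ P']
  {ζ : P → P'} {π : P → M} {π' : P' → M}
  [IsManifold 𝓘(ℝ, EP) ∞ P] [IsManifold 𝓘(ℝ, EP') ∞ P']

/-- The covariant derivative of the induced section is the image by `dπF` of the covariant
derivative, and `dπF` is complex linear. -/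
theorem dbarEq_induced (hq : IsBundleQuotient EG EM EP EG' EP' πG ζ π π')
    (hι : ContMDiff 𝓘(ℝ, EG) 𝓘(ℝ, EGC) ∞ ι)
    (hF : ContMDiff 𝓘(ℂ, EF) 𝓘(ℂ, EF') ω πF)
    (hact : ∀ (g : G) (q : F), ι' (πG g) • πF q = πF (ι g • q))
    {A : Connection EG G EP P} {B : Connection EG' G' EP' P'}
    (hAB : InducedConnection πG ζ A B)
    {φ : AssocSection EP EF π (actRep F ι)} {ψ : AssocSection EP' EF' π' (actRep F' ι')}
    (hφψ : ∀ p, ψ.lift (ζ p) = πF (φ.lift p))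
    (hA : DbarEq (EM := EM) ι A φ) : DbarEq (EM := EM) ι' B ψ := by
  have hFr := contMDiff_complexToReal hF
  have hcov : ∀ p v, covDeriv ι' B ψ (ζ p) (dmap EP EP' ζ p v) =
      dmap EF EF' πF (φ.lift p) (covDeriv ι A φ p v) := by
    intro p v
    have h1 := dmap_comp (g := ψ.lift) (f := ζ) (x := p) (ContMDiff.mdiffAt ψ.lift_smooth _)
      (ContMDiff.mdiffAt hq.sections_space.smooth _) v
    have h2 := dmap_comp (g := πF) (f := φ.lift) (x := p) (ContMDiff.mdiffAt hFr _)
      (ContMDiff.mdiffAt φ.lift_smooth _) v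
    simp only [hφψ] at h1
    rw [covDeriv, covDeriv, map_add, hAB, ← h1, h2, hφψ,
      ← infAct_induced hι hq.sections_group hFr hact]
    rfl
  intro p' v w hvw
  obtain ⟨p, rfl⟩ := hq.sections_space.surjective p'
  obtain ⟨v, rfl⟩ := hq.sections_space.dmap_surjective p v
  obtain ⟨w, rfl⟩ := hq.sections_space.dmap_surjective p w
  rw [hq.dmap_proj, hq.dmap_proj] at hvw
  rw [hcov, hcov, ← dmap_I_smul ((hF _).mdifferentiableAt (by simp)), ← map_add, hA p v w hvw,
    map_zero]

end InfinitesimalAction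

/-! ### Complex gauge transformations -/

section Gauge

variable {EGC : Type*} [NormedAddCommGroup EGC] [NormedSpace ℂ EGC]
  {GC : Type*} [TopologicalSpace GC] [ChartedSpace EGC GC] [Group GC] [LieGroup 𝓘(ℂ, EGC) ω GC]
  {EP : Type*} [NormedAddCommGroup EP] [NormedSpace ℝ EP]
  {P : Type*} [TopologicalSpace P] [ChartedSpace EP P]

variable (EGC EP) in
/-- The right logarithmic derivative `(dg) g⁻¹` of a map `g : P → GC`. -/
noncomputable def rightLogDer (g : P → GC) (p : P) : EP →L[ℝ] EGC :=
  dmap EP EGC (fun p' : P => g p' * (g p)⁻¹) p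

theorem Ad_I_smul (x : GC) (ξ : EGC) : Ad EGC x (Complex.I • ξ) = Complex.I • Ad EGC x ξ := by
  have h : ContMDiff 𝓘(ℂ, EGC) 𝓘(ℂ, EGC) ω (fun y : GC => x * y * x⁻¹) :=
    contMDiff_mul_right.comp contMDiff_mul_left
  exact dmap_I_smul ((h 1).mdifferentiableAt (by simp)) ξ

theorem contMDiff_mul_const {g : P → GC} (hg : ContMDiff 𝓘(ℝ, EP) 𝓘(ℝ, EGC) ∞ g) (x : GC) :
    ContMDiff 𝓘(ℝ, EP) 𝓘(ℝ, EGC) ∞ (fun p => g p * x) :=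
  ContMDiff.mul hg contMDiff_const

theorem rightLogDer_mul {g h : P → GC} (hg : ContMDiff 𝓘(ℝ, EP) 𝓘(ℝ, EGC) ∞ g)
    (hh : ContMDiff 𝓘(ℝ, EP) 𝓘(ℝ, EGC) ∞ h) (p : P) (v : EP) :
    rightLogDer EGC EP (fun p => h p * g p) p v =
      rightLogDer EGC EP h p v + Ad EGC (h p) (rightLogDer EGC EP g p v) := by
  have hu := contMDiff_mul_const hh (h p)⁻¹
  have hw0 := contMDiff_mul_const hg (g p)⁻¹
  have hw : ContMDiff 𝓘(ℝ, EP) 𝓘(ℝ, EGC) ∞ (fun q => h p * (g q * (g p)⁻¹) * (h p)⁻¹) :=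
    (contMDiff_conj (EG := EGC) (h p)).comp hw0
  have h1 := dmap_two (m := fun x : GC × GC => x.1 * x.2) (u := fun q => h q * (h p)⁻¹)
    (w := fun q => h p * (g q * (g p)⁻¹) * (h p)⁻¹) (p := p)
    (((contMDiff_mul 𝓘(ℝ, EGC) ∞) _).mdifferentiableAt (by simp))
    (ContMDiff.mdiffAt hu p) (ContMDiff.mdiffAt hw p) v
  have h2 := dmap_comp (g := fun x : GC => h p * x * (h p)⁻¹) (f := fun q => g q * (g p)⁻¹)
    (x := p) (ContMDiff.mdiffAt (contMDiff_conj (EG := EGC) (h p)) _) (ContMDiff.mdiffAt hw0 p) v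
  simp only [mul_inv_cancel, mul_one, one_mul] at h1 h2
  rw [dmap_id, dmap_id, h2] at h1
  rw [rightLogDer, rightLogDer, rightLogDer, Ad, ← h1]
  simp only [mul_inv_rev, mul_assoc, inv_mul_cancel_left]

omit [LieGroup 𝓘(ℂ, EGC) ω GC] in
theorem rightLogDer_one (p : P) (v : EP) :
    rightLogDer EGC EP (fun _ : P => (1 : GC)) p v = 0 := dmap_const _ _ _

theorem rightLogDer_inv {g : P → GC} (hg : ContMDiff 𝓘(ℝ, EP) 𝓘(ℝ, EGC) ∞ g) (p : P) (v : EP) :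
    rightLogDer EGC EP (fun p => (g p)⁻¹) p v =
      - Ad EGC (g p)⁻¹ (rightLogDer EGC EP g p v) := by
  have h := rightLogDer_mul hg hg.inv p v
  simp only [inv_mul_cancel] at h
  rw [rightLogDer_one] at h
  exact eq_neg_of_add_eq_zero_left h.symm

variable {EG : Type*} [NormedAddCommGroup EG] [NormedSpace ℝ EG]
  {G : Type*} [TopologicalSpace G] [ChartedSpace EG G] [Group G]
  {EM : Type*} [NormedAddCommGroup EM] [NormedSpace ℂ EM]
  {M : Type*} [TopologicalSpace M] [ChartedSpace EM M]
  [MulAction Gᵐᵒᵖ P] [IsManifold 𝓘(ℝ, EP) ∞ P] {ι : G →* GC} {π : P → M}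

omit [LieGroup 𝓘(ℂ, EGC) ω GC] in
theorem gaugeForm_eq (g : P → GC) (A : Connection EG G EP P) (p : P) (v : EP) :
    gaugeForm ι g A p v =
      Ad EGC (g p) (lieMap ι (A.form p v)) - rightLogDer EGC EP g p v := rfl

omit [LieGroup 𝓘(ℂ, EGC) ω GC] in
theorem isGaugeTransform_one (A : Connection EG G EP P) :
    IsGaugeTransform (EM := EM) (EGC := EGC) ι π (fun _ => (1 : GC)) A A := by
  intro p v w _
  simp only [gaugeForm_eq, Ad_one, rightLogDer_one]
  simp

theorem IsGaugeTransform.mul {g h : P → GC} (hg : ContMDiff 𝓘(ℝ, EP) 𝓘(ℝ, EGC) ∞ g)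
    (hh : ContMDiff 𝓘(ℝ, EP) 𝓘(ℝ, EGC) ∞ h) {A B C : Connection EG G EP P}
    (hAB : IsGaugeTransform (EM := EM) (EGC := EGC) ι π g A B)
    (hBC : IsGaugeTransform (EM := EM) (EGC := EGC) ι π h B C) :
    IsGaugeTransform (EM := EM) (EGC := EGC) ι π (fun p => h p * g p) A C := by
  intro p v w hvw
  have key : ∀ v, lieMap (EGC := EGC) ι (C.form p v) - gaugeForm ι (fun p => h p * g p) A p v =
      (lieMap ι (C.form p v) - gaugeForm ι h B p v) +
        Ad EGC (h p) (lieMap ι (B.form p v) - gaugeForm ι g A p v) := by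
    intro v
    simp only [gaugeForm_eq, rightLogDer_mul hg hh, Ad_mul, map_sub]
    abel
  have h1 := hBC p v w hvw
  have h2 := congrArg (Ad EGC (h p)) (hAB p v w hvw)
  rw [map_add, Ad_I_smul, map_zero] at h2
  rw [key, key, smul_add, add_add_add_comm, h1, h2, add_zero]

theorem IsGaugeTransform.inv {g : P → GC} (hg : ContMDiff 𝓘(ℝ, EP) 𝓘(ℝ, EGC) ∞ g)
    {A B : Connection EG G EP P} (hAB : IsGaugeTransform (EM := EM) (EGC := EGC) ι π g A B) :
    IsGaugeTransform (EM := EM) (EGC := EGC) ι π (fun p => (g p)⁻¹) B A := by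
  intro p v w hvw
  have key : ∀ v, lieMap (EGC := EGC) ι (A.form p v) - gaugeForm ι (fun p => (g p)⁻¹) B p v =
      - Ad EGC (g p)⁻¹ (lieMap ι (B.form p v) - gaugeForm ι g A p v) := by
    intro v
    simp only [gaugeForm_eq, rightLogDer_inv hg, map_sub, ← Ad_mul, inv_mul_cancel, Ad_one]
    abel
  have h2 := congrArg (Ad EGC (g p)⁻¹) (hAB p v w hvw)
  rw [map_add, Ad_I_smul, map_zero] at h2
  rw [key, key, smul_neg, ← neg_add, h2, neg_zero]

/-! ### The action of gauge transformations on pairs -/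

variable {EF : Type*} [NormedAddCommGroup EF] [NormedSpace ℂ EF]
  {F : Type*} [TopologicalSpace F] [ChartedSpace EF F] [MulAction GC F]

omit [LieGroup 𝓘(ℂ, EGC) ω GC] in
theorem gaugeRel_iff (hπ : IsPrincipalBundle EG G EM EP π) {g : ComplexGauge EGC EP ι π}
    {x y : Connection EG G EP P × AssocSection EP EF π (actRep F ι)} :
    GaugeRel EM ι π g x y ↔ IsGaugeTransform (EM := EM) (EGC := EGC) ι π g.lift x.1 y.1 ∧
      ∀ p, y.2.lift p = g.lift p • x.2.lift p := by
  refine and_congr_right fun _ => forall_congr' fun p => ⟨fun h => y.2.lift_eq hπ h, fun h => ?_⟩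
  rw [y.2.toFun_proj, h]

omit [TopologicalSpace G] [LieGroup 𝓘(ℂ, EGC) ω GC] [ChartedSpace EGC GC] [TopologicalSpace GC] in
theorem conjRep_apply (ι : G →* GC) (a : G) (x : GC) :
    conjRep ι a x = ι a * x * (ι a)⁻¹ := rfl

omit [LieGroup 𝓘(ℂ, EGC) ω GC] [IsManifold 𝓘(ℝ, EP) ∞ P] in
theorem exists_complexGauge_one (hπ : IsPrincipalBundle EG G EM EP π) :
    ∃ k : ComplexGauge EGC EP ι π, ∀ p, k.lift p = 1 :=
  AssocSection.exists_of_lift hπ contMDiff_const (fun g p => by rw [conjRep_apply]; simp)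

omit [IsManifold 𝓘(ℝ, EP) ∞ P] in
theorem exists_complexGauge_mul (hπ : IsPrincipalBundle EG G EM EP π)
    (g h : ComplexGauge EGC EP ι π) :
    ∃ k : ComplexGauge EGC EP ι π, ∀ p, k.lift p = h.lift p * g.lift p :=
  AssocSection.exists_of_lift hπ (h.lift_smooth.mul g.lift_smooth)
    (fun a p => by rw [g.lift_smul hπ, h.lift_smul hπ]; simp only [conjRep_apply]; group)

omit [IsManifold 𝓘(ℝ, EP) ∞ P] in
theorem exists_complexGauge_inv (hπ : IsPrincipalBundle EG G EM EP π)
    (g : ComplexGauge EGC EP ι π) :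
    ∃ k : ComplexGauge EGC EP ι π, ∀ p, k.lift p = (g.lift p)⁻¹ :=
  AssocSection.exists_of_lift hπ g.lift_smooth.inv
    (fun a p => by rw [g.lift_smul hπ]; simp only [conjRep_apply]; group)

omit [LieGroup 𝓘(ℂ, EGC) ω GC] in
theorem gaugeRel_one (hπ : IsPrincipalBundle EG G EM EP π) {k : ComplexGauge EGC EP ι π}
    (hk : ∀ p, k.lift p = 1)
    (x : Connection EG G EP P × AssocSection EP EF π (actRep F ι)) : GaugeRel EM ι π k x x := by
  rw [gaugeRel_iff hπ, funext hk]
  exact ⟨isGaugeTransform_one x.1, fun p => (one_smul _ _).symm⟩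

theorem GaugeRel.mul (hπ : IsPrincipalBundle EG G EM EP π) {g h k : ComplexGauge EGC EP ι π}
    (hk : ∀ p, k.lift p = h.lift p * g.lift p)
    {x y z : Connection EG G EP P × AssocSection EP EF π (actRep F ι)}
    (hxy : GaugeRel EM ι π g x y) (hyz : GaugeRel EM ι π h y z) : GaugeRel EM ι π k x z := by
  rw [gaugeRel_iff hπ] at hxy hyz ⊢
  rw [funext hk]
  refine ⟨hxy.1.mul g.lift_smooth h.lift_smooth hyz.1, fun p => ?_⟩
  rw [hyz.2, hxy.2, smul_smul]

theorem GaugeRel.inv (hπ : IsPrincipalBundle EG G EM EP π) {g k : ComplexGauge EGC EP ι π}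
    (hk : ∀ p, k.lift p = (g.lift p)⁻¹)
    {x y : Connection EG G EP P × AssocSection EP EF π (actRep F ι)}
    (hxy : GaugeRel EM ι π g x y) : GaugeRel EM ι π k y x := by
  rw [gaugeRel_iff hπ] at hxy ⊢
  rw [funext hk]
  refine ⟨hxy.1.inv g.lift_smooth, fun p => ?_⟩
  rw [hxy.2, inv_smul_smul]

end Gauge

/-! ### Differentials of moving points -/

section ActionDifferential

variable {EGC : Type*} [NormedAddCommGroup EGC] [NormedSpace ℂ EGC]
  {GC : Type*} [TopologicalSpace GC] [ChartedSpace EGC GC] [Group GC] [LieGroup 𝓘(ℂ, EGC) ω GC]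
  {EF : Type*} [NormedAddCommGroup EF] [NormedSpace ℂ EF]
  {F : Type*} [TopologicalSpace F] [ChartedSpace EF F] [MulAction GC F]

omit [LieGroup 𝓘(ℂ, EGC) ω GC] in
theorem contMDiff_const_smul_real [ContMDiffSMul 𝓘(ℂ, EGC) 𝓘(ℂ, EF) ω GC F] (x : GC) :
    ContMDiff 𝓘(ℝ, EF) 𝓘(ℝ, EF) ∞ (fun q : F => x • q) :=
  contMDiff_complexToReal (contMDiff_const_smul_complex (EGC := EGC) x)

variable [ContMDiffSMul 𝓘(ℂ, EGC) 𝓘(ℂ, EF) ω GC F]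
  {EP : Type*} [NormedAddCommGroup EP] [NormedSpace ℝ EP]
  {P : Type*} [TopologicalSpace P] [ChartedSpace EP P]

omit [LieGroup 𝓘(ℂ, EGC) ω GC] in
theorem contMDiff_orbit_real (q : F) :
    ContMDiff 𝓘(ℝ, EGC) 𝓘(ℝ, EF) ∞ (fun x : GC => x • q) :=
  contMDiff_complexToReal (contMDiff_orbit_complex q)

theorem dmap_smul_cInfAct (x : GC) (q : F) (ξ : EGC) :
    dmap EF EF (fun q : F => x • q) q (cInfAct EGC GC EF q ξ) =
      cInfAct EGC GC EF (x • q) (Ad EGC x ξ) := by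
  have h1 := dmap_comp (g := fun q : F => x • q) (f := fun y : GC => y • q) (x := 1)
    (ContMDiff.mdiffAt (contMDiff_const_smul_real (EGC := EGC) (EF := EF) x) _)
    (ContMDiff.mdiffAt (contMDiff_orbit_real (EGC := EGC) (EF := EF) q) _) ξ
  have h2 := dmap_comp (g := fun y : GC => y • x • q) (f := fun y : GC => x * y * x⁻¹) (x := 1)
    (ContMDiff.mdiffAt (contMDiff_orbit_real (EGC := EGC) (EF := EF) (x • q)) _)
    (ContMDiff.mdiffAt (contMDiff_conj (EG := EGC) x) _) ξ
  rw [one_smul] at h1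
  rw [mul_one, mul_inv_cancel] at h2
  rw [cInfAct, cInfAct, Ad, ← h1, ← h2]
  simp only [smul_smul, inv_mul_cancel_right]

/-- The Leibniz rule for `p ↦ g p • f p`: moving `g` contributes the infinitesimal action of
`(dg) g⁻¹`. -/
theorem dmap_smul_lift {g : P → GC} {f : P → F} (hg : ContMDiff 𝓘(ℝ, EP) 𝓘(ℝ, EGC) ∞ g)
    (hf : ContMDiff 𝓘(ℝ, EP) 𝓘(ℝ, EF) ∞ f) (p : P) (v : EP) :
    dmap EP EF (fun p => g p • f p) p v =
      cInfAct EGC GC EF (g p • f p) (rightLogDer EGC EP g p v) +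
        dmap EF EF (fun q : F => g p • q) (f p) (dmap EP EF f p v) := by
  have hu := contMDiff_mul_const hg (g p)⁻¹
  have hc := contMDiff_const_smul_real (EGC := EGC) (EF := EF) (F := F) (g p)
  have h1 := dmap_two (m := fun x : GC × F => x.1 • x.2) (u := fun q => g q * (g p)⁻¹)
    (w := fun q => g p • f q) (p := p)
    ((contMDiff_smul_real (EGC := EGC) (EF := EF) _).mdifferentiableAt (by simp))
    (ContMDiff.mdiffAt hu p) (ContMDiff.mdiffAt (hc.comp hf) p) v
  have h2 := dmap_comp (g := fun q : F => g p • q) (f := f) (x := p)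
    (ContMDiff.mdiffAt hc _) (ContMDiff.mdiffAt hf p) v
  simp only [mul_inv_cancel, one_smul, smul_smul, inv_mul_cancel_right] at h1
  rw [dmap_id, h2] at h1
  rw [cInfAct, rightLogDer]
  simp only [smul_smul]
  exact h1

end ActionDifferential

/-! ### Induced gauge transformations -/

section InducedGauge

variable {EG : Type*} [NormedAddCommGroup EG] [NormedSpace ℝ EG]
  {G : Type*} [TopologicalSpace G] [ChartedSpace EG G] [Group G]
  {EGC : Type*} [NormedAddCommGroup EGC] [NormedSpace ℂ EGC]
  {GC : Type*} [TopologicalSpace GC] [ChartedSpace EGC GC] [Group GC] [LieGroup 𝓘(ℂ, EGC) ω GC]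
  {EG' : Type*} [NormedAddCommGroup EG'] [NormedSpace ℝ EG']
  {G' : Type*} [TopologicalSpace G'] [ChartedSpace EG' G'] [Group G']
  {EGC' : Type*} [NormedAddCommGroup EGC'] [NormedSpace ℂ EGC']
  {GC' : Type*} [TopologicalSpace GC'] [ChartedSpace EGC' GC'] [Group GC']
  [LieGroup 𝓘(ℂ, EGC') ω GC']
  {ι : G →* GC} {ι' : G' →* GC'} {πG : G →* G'} {πGC : GC →* GC'}
  {EM : Type*} [NormedAddCommGroup EM] [NormedSpace ℂ EM]
  {M : Type*} [TopologicalSpace M] [ChartedSpace EM M]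
  {EP : Type*} [NormedAddCommGroup EP] [NormedSpace ℝ EP]
  {P : Type*} [TopologicalSpace P] [ChartedSpace EP P] [MulAction Gᵐᵒᵖ P]
  {EP' : Type*} [NormedAddCommGroup EP'] [NormedSpace ℝ EP']
  {P' : Type*} [TopologicalSpace P'] [ChartedSpace EP' P'] [MulAction G'ᵐᵒᵖ P']
  {ζ : P → P'} {π : P → M} {π' : P' → M}
  [IsManifold 𝓘(ℝ, EP) ∞ P] [IsManifold 𝓘(ℝ, EP') ∞ P']

theorem gaugeForm_induced (hq : IsBundleQuotient EG EM EP EG' EP' πG ζ π π')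
    (hι : ContMDiff 𝓘(ℝ, EG) 𝓘(ℝ, EGC) ∞ ι) (hι' : ContMDiff 𝓘(ℝ, EG') 𝓘(ℝ, EGC') ∞ ι')
    (hπGC : ContMDiff 𝓘(ℝ, EGC) 𝓘(ℝ, EGC') ∞ πGC) (hext : ∀ g, πGC (ι g) = ι' (πG g))
    {g : P → GC} {g' : P' → GC'} (hg : ContMDiff 𝓘(ℝ, EP) 𝓘(ℝ, EGC) ∞ g)
    (hg' : ContMDiff 𝓘(ℝ, EP') 𝓘(ℝ, EGC') ∞ g') (hgg' : ∀ p, g' (ζ p) = πGC (g p))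
    {A : Connection EG G EP P} {A' : Connection EG' G' EP' P'}
    (hA : InducedConnection πG ζ A A') (p : P) (v : EP) :
    gaugeForm ι' g' A' (ζ p) (dmap EP EP' ζ p v) = dmap EGC EGC' πGC 1 (gaugeForm ι g A p v) := by
  have h1 := dmap_comp (g := fun q => g' q * (g' (ζ p))⁻¹) (f := ζ) (x := p)
    (ContMDiff.mdiffAt (contMDiff_mul_const hg' _) _)
    (ContMDiff.mdiffAt hq.sections_space.smooth _) v
  have h2 := dmap_comp (g := πGC) (f := fun q => g q * (g p)⁻¹) (x := p)
    (ContMDiff.mdiffAt hπGC _) (ContMDiff.mdiffAt (contMDiff_mul_const hg _) _) v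
  rw [mul_inv_cancel] at h2
  simp only [map_mul, map_inv] at h2
  simp only [hgg'] at h1
  rw [gaugeForm_eq, gaugeForm_eq, map_sub, hA, dmap_Ad hπGC,
    dmap_lieMap hι hι' hq.sections_group.smooth hπGC hext, hgg', rightLogDer, rightLogDer, ← h2, h1,
    hgg']

theorem isGaugeTransform_induced (hq : IsBundleQuotient EG EM EP EG' EP' πG ζ π π')
    (hι : ContMDiff 𝓘(ℝ, EG) 𝓘(ℝ, EGC) ∞ ι) (hι' : ContMDiff 𝓘(ℝ, EG') 𝓘(ℝ, EGC') ∞ ι')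
    (hπGC : ContMDiff 𝓘(ℂ, EGC) 𝓘(ℂ, EGC') ω πGC) (hext : ∀ g, πGC (ι g) = ι' (πG g))
    {g : P → GC} {g' : P' → GC'} (hg : ContMDiff 𝓘(ℝ, EP) 𝓘(ℝ, EGC) ∞ g)
    (hg' : ContMDiff 𝓘(ℝ, EP') 𝓘(ℝ, EGC') ∞ g') (hgg' : ∀ p, g' (ζ p) = πGC (g p))
    {A B : Connection EG G EP P} {A' B' : Connection EG' G' EP' P'}
    (hA : InducedConnection πG ζ A A') (hB : InducedConnection πG ζ B B')
    (hAB : IsGaugeTransform (EM := EM) (EGC := EGC) ι π g A B) :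
    IsGaugeTransform (EM := EM) (EGC := EGC') ι' π' g' A' B' := by
  have hr := contMDiff_complexToReal hπGC
  intro p' v w hvw
  obtain ⟨p, rfl⟩ := hq.sections_space.surjective p'
  obtain ⟨v, rfl⟩ := hq.sections_space.dmap_surjective p v
  obtain ⟨w, rfl⟩ := hq.sections_space.dmap_surjective p w
  rw [hq.dmap_proj, hq.dmap_proj] at hvw
  simp only [gaugeForm_induced hq hι hι' hr hext hg hg' hgg' hA, hB p,
    ← dmap_lieMap hι hι' hq.sections_group.smooth hr hext]
  rw [← map_sub, ← map_sub, ← dmap_I_smul ((hπGC _).mdifferentiableAt (by simp)), ← map_add,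
    hAB p v w hvw, map_zero]

end InducedGauge

/-! ### Open mapping, inverse function and dimension theorems on manifolds -/

section InverseFunction

variable {EX : Type*} [NormedAddCommGroup EX] [NormedSpace ℝ EX] [FiniteDimensional ℝ EX]
  {HX : Type*} [TopologicalSpace HX]
  {EY : Type*} [NormedAddCommGroup EY] [NormedSpace ℝ EY] [FiniteDimensional ℝ EY]
  {HY : Type*} [TopologicalSpace HY]
  {X : Type*} [TopologicalSpace X] [ChartedSpace HX X]
  {Y : Type*} [TopologicalSpace Y] [ChartedSpace HY Y]
  {I : ModelWithCorners ℝ EX HX} {J : ModelWithCorners ℝ EY HY}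
  [I.Boundaryless] [J.Boundaryless]

omit [FiniteDimensional ℝ EX] [FiniteDimensional ℝ EY] [J.Boundaryless] in
theorem contDiffAt_inCharts {f : X → Y} {x : X} (hf : ContMDiffAt I J ∞ f x) :
    ContDiffAt ℝ ∞ (extChartAt J (f x) ∘ f ∘ (extChartAt I x).symm) (extChartAt I x x) := by
  have h := (contMDiffAt_iff.1 hf).2
  rwa [I.range_eq_univ, contDiffWithinAt_univ] at h

omit [FiniteDimensional ℝ EX] [FiniteDimensional ℝ EY] [J.Boundaryless] in
theorem hasStrictFDerivAt_inCharts {f : X → Y} {x : X} (hf : ContMDiffAt I J ∞ f x)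
    {L : EX →L[ℝ] EY} (hL : HasMFDerivAt I J f x L) :
    HasStrictFDerivAt (extChartAt J (f x) ∘ f ∘ (extChartAt I x).symm) L (extChartAt I x x) := by
  have h1 := (contDiffAt_inCharts hf).hasStrictFDerivAt (by simp)
  have h2 : HasFDerivWithinAt (extChartAt J (f x) ∘ f ∘ (extChartAt I x).symm) L (range I)
      (extChartAt I x x) := hL.2
  rw [I.range_eq_univ, hasFDerivWithinAt_univ] at h2
  have h3 : fderiv ℝ (extChartAt J (f x) ∘ f ∘ (extChartAt I x).symm) (extChartAt I x x) = L :=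
    h2.fderiv
  rwa [h3] at h1

/-- A smooth map is open near a point where its differential is surjective. -/
theorem image_mem_nhds_of_surjective {f : X → Y} {x : X} (hf : ContMDiffAt I J ∞ f x)
    {L : EX →L[ℝ] EY} (hL : HasMFDerivAt I J f x L) (hs : Function.Surjective L)
    {s : Set X} (hsx : s ∈ 𝓝 x) : f '' s ∈ 𝓝 (f x) := by
  have := FiniteDimensional.complete ℝ EX
  have := FiniteDimensional.complete ℝ EY
  have h1 := (hasStrictFDerivAt_inCharts hf hL).map_nhds_eq_of_surj (LinearMap.range_eq_top.2 hs)
  rw [← map_extChartAt_nhds_of_boundaryless (I := I) x] at h1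
  have h2 : map (extChartAt J (f x)).symm (map (extChartAt J (f x) ∘ f ∘ (extChartAt I x).symm)
      (map (extChartAt I x) (𝓝 x))) = map f (𝓝 x) := by
    rw [Filter.map_map, Filter.map_map]
    refine Filter.map_congr ?_
    filter_upwards [extChartAt_source_mem_nhds (I := I) x,
      hf.continuousAt.preimage_mem_nhds (extChartAt_source_mem_nhds (I := J) (f x))] with z hz hz'
    simp only [Function.comp_apply, (extChartAt I x).left_inv hz]
    exact (extChartAt J (f x)).left_inv hz'
  rw [h1] at h2
  have h3 := map_extChartAt_symm_nhdsWithin_range (I := J) (f x)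
  rw [J.range_eq_univ, nhdsWithin_univ] at h3
  simp only [Function.comp_apply, extChartAt_to_inv] at h2
  rw [h3] at h2
  rw [h2]
  exact image_mem_map hsx

omit [J.Boundaryless] in
/-- The inverse function theorem: a smooth map has a smooth local right inverse near a point where
its differential is bijective. -/
theorem exists_local_inverse [IsManifold I ∞ X] [IsManifold J ∞ Y]
    {f : X → Y} {x : X} (hf : ContMDiffAt I J ∞ f x)
    {L : EX →L[ℝ] EY} (hL : HasMFDerivAt I J f x L) (hb : Function.Bijective L) :
    ∃ g : Y → X, ContMDiffAt J I ∞ g (f x) ∧ g (f x) = x ∧ ∀ᶠ y in 𝓝 (f x), f (g y) = y := by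
  have := FiniteDimensional.complete ℝ EX
  have := FiniteDimensional.complete ℝ EY
  set e : EX ≃L[ℝ] EY := (LinearEquiv.ofBijective L.toLinearMap hb).toContinuousLinearEquiv
  have he : (e : EX →L[ℝ] EY) = L := by ext v; rfl
  set u := extChartAt J (f x) ∘ f ∘ (extChartAt I x).symm with hu
  have hs : HasStrictFDerivAt u (e : EX →L[ℝ] EY) (extChartAt I x x) :=
    he ▸ hasStrictFDerivAt_inCharts hf hL
  have hux : u (extChartAt I x x) = extChartAt J (f x) (f x) := by simp [hu]
  have hu' : ContDiffAt ℝ ∞ u (extChartAt I x x) := contDiffAt_inCharts hf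
  set w := hu'.localInverse hs.hasFDerivAt (by simp) with hw
  have hw1 : ContDiffAt ℝ ∞ w (extChartAt J (f x) (f x)) := by
    have := hu'.to_localInverse hs.hasFDerivAt (by simp)
    rwa [hux] at this
  have hw2 : w (extChartAt J (f x) (f x)) = extChartAt I x x := by
    have := hu'.localInverse_apply_image hs.hasFDerivAt (by simp)
    rwa [hux] at this
  have hw3 : ∀ᶠ z in 𝓝 (extChartAt J (f x) (f x)), u (w z) = z := by
    have := hs.eventually_right_inverse
    rwa [hux] at this
  have hJ : ContMDiffAt J 𝓘(ℝ, EY) ∞ (extChartAt J (f x)) (f x) := contMDiffAt_extChartAt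
  have hI : ContMDiffAt 𝓘(ℝ, EX) I ∞ (extChartAt I x).symm (extChartAt I x x) :=
    (contMDiffOn_extChartAt_symm x).contMDiffAt (extChartAt_target_mem_nhds x)
  have hg1 : ContMDiffAt J 𝓘(ℝ, EX) ∞ (fun y => w (extChartAt J (f x) y)) (f x) :=
    ContMDiffAt.comp (f x) hw1.contMDiffAt hJ
  have hg : ContMDiffAt J I ∞ (fun y => (extChartAt I x).symm (w (extChartAt J (f x) y))) (f x) :=
    ContMDiffAt.comp (f x) (by rw [hw2]; exact hI) hg1
  have hgx : (extChartAt I x).symm (w (extChartAt J (f x) (f x))) = x := by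
    rw [hw2, extChartAt_to_inv]
  refine ⟨_, hg, hgx, ?_⟩
  have hfg : ContinuousAt (fun y => f ((extChartAt I x).symm (w (extChartAt J (f x) y)))) (f x) :=
    ContinuousAt.comp (g := f) (by rw [hgx]; exact hf.continuousAt) hg.continuousAt
  filter_upwards [hJ.continuousAt.eventually hw3, extChartAt_source_mem_nhds (I := J) (f x),
    hfg.preimage_mem_nhds
      (by rw [hgx]; exact extChartAt_source_mem_nhds (I := J) (f x))] with y hy1 hy2 hy3
  exact (extChartAt J (f x)).injOn hy3 hy2 hy1

omit [FiniteDimensional ℝ EY] in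
theorem dimH_image_le_finrank [SecondCountableTopology X] {f : X → EY} {s : Set X} (hs : IsOpen s)
    (hf : ContMDiffOn I 𝓘(ℝ, EY) ∞ f s) : dimH (f '' s) ≤ Module.finrank ℝ EX := by
  have hloc : ∀ x ∈ s, ∃ u ∈ 𝓝[s] x, dimH (f '' u) ≤ Module.finrank ℝ EX := by
    intro x hx
    have h1 := contDiffAt_inCharts (hf.contMDiffAt (hs.mem_nhds hx))
    obtain ⟨v, hv, hv'⟩ := (h1.of_le (m := 1) (by simp)).contDiffOn le_rfl (by simp)
    obtain ⟨r, hr, hrv⟩ := Metric.mem_nhds_iff.1 hv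
    refine ⟨(extChartAt I x).source ∩ extChartAt I x ⁻¹' Metric.ball (extChartAt I x x) r,
      mem_nhdsWithin_of_mem_nhds (inter_mem (extChartAt_source_mem_nhds x)
        ((continuousAt_extChartAt x).preimage_mem_nhds (Metric.ball_mem_nhds _ hr))), ?_⟩
    refine le_trans (dimH_mono ?_)
      (((hv'.mono hrv).dimH_image_le (convex_ball _ r) subset_rfl).trans
        (Real.dimH_of_mem_nhds (Metric.ball_mem_nhds _ hr)).le)
    rintro _ ⟨z, ⟨hz, hz'⟩, rfl⟩
    refine ⟨extChartAt I x z, hz', ?_⟩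
    rw [Function.comp_apply, Function.comp_apply, (extChartAt I x).left_inv hz]
    rfl
  choose! u hu hdim using hloc
  obtain ⟨t, hts, htc, hst⟩ := TopologicalSpace.countable_cover_nhdsWithin hu
  calc dimH (f '' s) ≤ dimH (⋃ x ∈ t, f '' u x) := by
        refine dimH_mono ?_
        rw [← image_iUnion₂]
        exact image_mono hst
    _ = ⨆ x ∈ t, dimH (f '' u x) := dimH_bUnion htc _
    _ ≤ Module.finrank ℝ EX := iSup₂_le fun x hx => hdim x (hts hx)

/-- A smooth map from a second countable manifold whose image has an interior point does not raise
the dimension. -/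
theorem finrank_le_of_image_mem_nhds [SecondCountableTopology X] [IsManifold J ∞ Y]
    {f : X → Y} {s : Set X} (hs : IsOpen s) (hf : ContMDiffOn I J ∞ f s) {y : Y}
    (hy : f '' s ∈ 𝓝 y) : Module.finrank ℝ EY ≤ Module.finrank ℝ EX := by
  have ho : IsOpen (s ∩ f ⁻¹' (extChartAt J y).source) :=
    hf.continuousOn.isOpen_inter_preimage hs (isOpen_extChartAt_source (I := J) y)
  have h1 : ContMDiffOn I 𝓘(ℝ, EY) ∞ (fun x => extChartAt J y (f x))
      (s ∩ f ⁻¹' (extChartAt J y).source) := by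
    have h := contMDiffOn_extChartAt (I := J) (n := ∞) (x := y)
    rw [← extChartAt_source J] at h
    exact h.comp (hf.mono inter_subset_left) fun x hx => hx.2
  have h2 : (fun x => extChartAt J y (f x)) '' (s ∩ f ⁻¹' (extChartAt J y).source) ∈
      𝓝 (extChartAt J y y) := by
    rw [← map_extChartAt_nhds_of_boundaryless (I := J)]
    refine mem_of_superset (image_mem_map (inter_mem hy (extChartAt_source_mem_nhds (I := J) y))) ?_
    rintro _ ⟨_, ⟨⟨x, hx, rfl⟩, hx'⟩, rfl⟩
    exact ⟨x, ⟨hx, hx'⟩, rfl⟩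
  have h3 := dimH_image_le_finrank ho h1
  rw [Real.dimH_of_mem_nhds h2] at h3
  exact_mod_cast h3

end InverseFunction

/-! ### The division map of a free action -/

section Division

variable {EG : Type*} [NormedAddCommGroup EG] [NormedSpace ℝ EG]
  {G : Type*} [TopologicalSpace G] [ChartedSpace EG G] [Group G]
  {EG' : Type*} [NormedAddCommGroup EG'] [NormedSpace ℝ EG']
  {G' : Type*} [TopologicalSpace G'] [ChartedSpace EG' G'] [Group G']
  {EF : Type*} [NormedAddCommGroup EF] [NormedSpace ℝ EF]
  {F : Type*} [TopologicalSpace F] [ChartedSpace EF F] [MulAction G F]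
  {EF' : Type*} [NormedAddCommGroup EF'] [NormedSpace ℝ EF']
  {F' : Type*} [TopologicalSpace F'] [ChartedSpace EF' F']

variable (EG EG' EF EF') in
/-- The situation in which `F'` is the quotient of `F` by the free action of the kernel of a
homomorphism `f : G → G'` of Lie groups whose differential is onto, with quotient map `πF`. -/
structure IsFreeKernelQuotient (f : G →* G') (πF : F → F') : Prop where
  smooth_hom : ContMDiff 𝓘(ℝ, EG) 𝓘(ℝ, EG') ∞ f
  hom_surjective : Function.Surjective (dmap EG EG' f 1)
  sections : HasLocalSections 𝓘(ℝ, EF) 𝓘(ℝ, EF') πF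
  fiber : ∀ a b : F, πF a = πF b ↔ ∃ x : G, f x = 1 ∧ b = x • a
  free : ∀ (x : G) (a : F), f x = 1 → x • a = a → x = 1

variable {f : G →* G'} {πF : F → F'}

/-- The element of the kernel of `f` carrying `a` to `b` is unique. -/
theorem IsFreeKernelQuotient.eq_of_smul_eq (h : IsFreeKernelQuotient EG EG' EF EF' f πF)
    {x y : G} {a : F} (hx : f x = 1) (hy : f y = 1) (hxy : x • a = y • a) : x = y := by
  have h1 := h.free (y⁻¹ * x) a (by simp [hx, hy]) (by rw [mul_smul, hxy, inv_smul_smul])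
  exact (inv_mul_eq_one.1 h1).symm

theorem contMDiff_translation [ContMDiffSMul 𝓘(ℝ, EG) 𝓘(ℝ, EF) ∞ G F] (x : G) :
    ContMDiff 𝓘(ℝ, EF) 𝓘(ℝ, EF) ∞ (fun q : F => x • q) :=
  ContMDiff.comp (g := fun x : G × F => x.1 • x.2)
    (ContMDiffSMul.contMDiff_smul (I := 𝓘(ℝ, EG)) (I' := 𝓘(ℝ, EF)) (n := ∞))
    (contMDiff_const.prodMk contMDiff_id)

variable [ContMDiffSMul 𝓘(ℝ, EG) 𝓘(ℝ, EF) ∞ G F]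

theorem contMDiff_orbit_map (q : F) : ContMDiff 𝓘(ℝ, EG) 𝓘(ℝ, EF) ∞ (fun x : G => x • q) :=
  ContMDiff.comp (g := fun x : G × F => x.1 • x.2)
    (ContMDiffSMul.contMDiff_smul (I := 𝓘(ℝ, EG)) (I' := 𝓘(ℝ, EF)) (n := ∞))
    (contMDiff_id.prodMk contMDiff_const)

variable [LieGroup 𝓘(ℝ, EG) ∞ G]
variable [FiniteDimensional ℝ EG] [T2Space G]

namespace IsFreeKernelQuotient

section Infinitesimal

variable [LieGroup 𝓘(ℝ, EG') ∞ G'] [T2Space G']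

omit [ContMDiffSMul 𝓘(ℝ, EG) 𝓘(ℝ, EF) ∞ G F] in
/-- The one-parameter subgroups with velocity in the kernel of `df` lie in the kernel of `f`. -/
theorem exists_isOneParam_ker (h : IsFreeKernelQuotient EG EG' EF EF' f πF) {ξ : EG}
    (hξ : dmap EG EG' f 1 ξ = 0) : ∃ γ : ℝ → G, IsOneParam γ ξ ∧ ∀ t, f (γ t) = 1 := by
  have := FiniteDimensional.complete ℝ EG
  obtain ⟨γ, hγ⟩ := exists_isOneParam (G := G) ξ
  have h1 := hγ.map f h.smooth_hom
  rw [hξ] at h1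
  exact ⟨γ, hγ, congrFun (h1.unique isOneParam_const)⟩

/-- A free action of the kernel is infinitesimally free. -/
theorem eq_zero_of_orbit (h : IsFreeKernelQuotient EG EG' EF EF' f πF)
    [IsManifold 𝓘(ℝ, EF) ∞ F] [T2Space F] {ξ : EG} (hξ : dmap EG EG' f 1 ξ = 0) {q : F}
    (hq : dmap EG EF (fun x : G => x • q) 1 ξ = 0) : ξ = 0 := by
  obtain ⟨γ, hγ, hker⟩ := h.exists_isOneParam_ker hξ
  have h1 : γ = fun _ => 1 := funext fun t => h.free _ q (hker t)
    (hγ.orbit_eq (contMDiff_translation (EG := EG))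
      (ContMDiff.mdiffAt (contMDiff_orbit_map q) 1) hq t)
  have h2 := hγ.hasDmapAt
  rw [h1] at h2
  have h3 := h2.dmap_eq.symm.trans (hasDmapAt_const (1 : G) (0 : ℝ)).dmap_eq
  simpa using congrArg (fun L : ℝ →L[ℝ] EG => L 1) h3

/-- The orbits of the kernel are tangent to the fibres of `πF`. -/
theorem dmap_orbit (h : IsFreeKernelQuotient EG EG' EF EF' f πF) {ξ : EG}
    (hξ : dmap EG EG' f 1 ξ = 0) (q : F) :
    dmap EF EF' πF q (dmap EG EF (fun x : G => x • q) 1 ξ) = 0 := by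
  obtain ⟨γ, hγ, hker⟩ := h.exists_isOneParam_ker hξ
  have h1 := (hasDmapAt_dmap (ContMDiff.mdiffAt (contMDiff_orbit_map (EG := EG) (EF := EF) q)
    (1 : G))).comp hγ.hasDmapAt hγ.map_zero
  have h2 := (hasDmapAt_dmap (ContMDiff.mdiffAt h.sections.smooth q)).comp h1
    (by rw [hγ.map_zero, one_smul])
  have h3 : (fun t => πF (γ t • q)) = fun _ => πF q :=
    funext fun t => ((h.fiber _ _).2 ⟨γ t, hker t, rfl⟩).symm
  rw [h3] at h2
  have h4 := h2.dmap_eq.symm.trans (hasDmapAt_const (πF q) (0 : ℝ)).dmap_eq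
  simpa using congrArg (fun L : ℝ →L[ℝ] EF' => L 1) h4

variable [FiniteDimensional ℝ EG'] [FiniteDimensional ℝ EF] [FiniteDimensional ℝ EF']
  [IsManifold 𝓘(ℝ, EF) ∞ F] [T2Space F] [IsManifold 𝓘(ℝ, EF') ∞ F']
  [SecondCountableTopology G] [SecondCountableTopology F']

/-- Near `q`, every point of `F` is carried by the kernel of `f` to a slice, the image of a section
`σ` of `πF`, by an element depending smoothly on the point. The map `(x, y) ↦ (f x, x • σ y)` is an
immersion because the kernel acts infinitesimally freely, and it is onto a neighbourhood of
`(1, q)`; so the dimensions agree and its inverse is smooth. -/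
theorem exists_slice_coordinate (h : IsFreeKernelQuotient EG EG' EF EF' f πF) (q : F) :
    ∃ (σ : F' → F) (κ : F → G), ContMDiffAt 𝓘(ℝ, EF) 𝓘(ℝ, EG) ∞ κ q ∧
      ∀ᶠ a in 𝓝 q, f (κ a) = 1 ∧ κ a • σ (πF a) = a := by
  obtain ⟨U, hU, hqU, σ, hσ, hσq, hπσ⟩ := h.sections.exists_section q
  set m : G × F' → F := fun z => z.1 • σ z.2 with hm
  set Λ : G × F' → G' × F := fun z => (f z.1, m z) with hΛ
  have hmU : ContMDiffOn (𝓘(ℝ, EG).prod 𝓘(ℝ, EF')) 𝓘(ℝ, EF) ∞ m (univ ×ˢ U) :=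
    ContMDiff.comp_contMDiffOn (g := fun x : G × F => x.1 • x.2)
      (ContMDiffSMul.contMDiff_smul (I := 𝓘(ℝ, EG)) (I' := 𝓘(ℝ, EF)) (n := ∞))
      (contMDiff_fst.contMDiffOn.prodMk (hσ.comp contMDiff_snd.contMDiffOn fun z hz => hz.2))
  have hΛU : ContMDiffOn (𝓘(ℝ, EG).prod 𝓘(ℝ, EF')) (𝓘(ℝ, EG').prod 𝓘(ℝ, EF)) ∞ Λ (univ ×ˢ U) :=
    ((h.smooth_hom.comp contMDiff_fst).contMDiffOn).prodMk hmU
  have hopen : IsOpen ((univ : Set G) ×ˢ U) := isOpen_univ.prod hU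
  have hmem : ((1, πF q) : G × F') ∈ (univ : Set G) ×ˢ U := ⟨mem_univ _, hqU⟩
  have hmd : MDifferentiableAt (𝓘(ℝ, EG).prod 𝓘(ℝ, EF')) 𝓘(ℝ, EF) m (1, πF q) :=
    (hmU.contMDiffAt (hopen.mem_nhds hmem)).mdifferentiableAt (by simp)
  have hσd : MDifferentiableAt 𝓘(ℝ, EF') 𝓘(ℝ, EF) σ (πF q) :=
    (hσ.contMDiffAt (hU.mem_nhds hqU)).mdifferentiableAt (by simp)
  let M : EG × EF' →L[ℝ] EF := mfderiv (𝓘(ℝ, EG).prod 𝓘(ℝ, EF')) 𝓘(ℝ, EF) m (1, πF q)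
  have hM : ∀ v : EG × EF', M v =
      dmap EG EF (fun x : G => x • q) 1 v.1 + dmap EF' EF σ (πF q) v.2 := by
    intro v
    have h1 : M v = dmap EG EF (fun x : G => m (x, πF q)) 1 v.1 +
        dmap EF' EF (fun y : F' => m (1, y)) (πF q) v.2 := mfderiv_prod_eq_add_apply hmd
    simpa only [hm, hσq, one_smul] using h1
  let L : EG × EF' →L[ℝ] EG' × EF :=
    ((dmap EG EG' f 1).comp (ContinuousLinearMap.fst ℝ EG EF')).prod M
  have hL : HasMFDerivAt (𝓘(ℝ, EG).prod 𝓘(ℝ, EF')) (𝓘(ℝ, EG').prod 𝓘(ℝ, EF)) Λ (1, πF q) L := by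
    have h1 : HasMFDerivAt (𝓘(ℝ, EG).prod 𝓘(ℝ, EF')) 𝓘(ℝ, EG') (fun z : G × F' => f z.1)
        (1, πF q) ((dmap EG EG' f 1).comp (ContinuousLinearMap.fst ℝ EG EF')) :=
      HasMFDerivAt.comp (g := f) (f := Prod.fst) (1, πF q)
        (ContMDiff.mdiffAt h.smooth_hom 1).hasMFDerivAt (hasMFDerivAt_fst _)
    exact h1.prodMk hmd.hasMFDerivAt
  have hinj : Function.Injective L := by
    refine (injective_iff_map_eq_zero L).2 ?_
    rintro ⟨ξ, η⟩ hv
    have hξ : dmap EG EG' f 1 ξ = 0 := congrArg Prod.fst hv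
    have h1 : M (ξ, η) = 0 := congrArg Prod.snd hv
    rw [hM] at h1
    have hη : η = 0 := by
      have h2 := congrArg (dmap EF EF' πF q) h1
      rw [map_add, map_zero, h.dmap_orbit hξ, zero_add] at h2
      have h3 := dmap_comp (g := πF) (f := σ) (x := πF q)
        (ContMDiff.mdiffAt h.sections.smooth _) hσd η
      have h4 : (fun y => πF (σ y)) =ᶠ[𝓝 (πF q)] fun y => y := by
        filter_upwards [hU.mem_nhds hqU] with y hy using hπσ y hy
      rw [dmap_congr h4, dmap_id, hσq] at h3
      exact h3.trans h2
    subst hη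
    rw [map_zero, add_zero] at h1
    rw [h.eq_zero_of_orbit hξ h1]
    rfl
  -- `(f x₀, b)` has a preimage when `x₀⁻¹ • b` lies over the domain of `σ`
  have himage : Λ '' (univ ×ˢ U) ∈ 𝓝 ((1, q) : G' × F) := by
    have hcont : ContinuousAt (fun z : G × F => πF (z.1⁻¹ • z.2)) (1, q) := by
      have h1 : ContMDiff (𝓘(ℝ, EG).prod 𝓘(ℝ, EF)) 𝓘(ℝ, EF) ∞
          (fun z : G × F => z.1⁻¹ • z.2) :=
        ContMDiff.comp (g := fun x : G × F => x.1 • x.2)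
          (ContMDiffSMul.contMDiff_smul (I := 𝓘(ℝ, EG)) (I' := 𝓘(ℝ, EF)) (n := ∞))
          (contMDiff_fst.inv.prodMk contMDiff_snd)
      exact (h.sections.smooth.continuous.comp h1.continuous).continuousAt
    have h1 := hcont.preimage_mem_nhds (t := U) (by simpa using hU.mem_nhds hqU)
    rw [nhds_prod_eq] at h1
    obtain ⟨W₁, hW₁, W₂, hW₂, hW⟩ := mem_prod_iff.1 h1
    have h2 : f '' W₁ ∈ 𝓝 (1 : G') := by
      have := image_mem_nhds_of_surjective (h.smooth_hom 1)
        (ContMDiff.mdiffAt h.smooth_hom 1).hasMFDerivAt h.hom_surjective hW₁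
      rwa [map_one] at this
    rw [nhds_prod_eq]
    refine mem_of_superset (prod_mem_prod h2 hW₂) ?_
    rintro ⟨_, b⟩ ⟨⟨x, hx, rfl⟩, hb⟩
    have hy : πF (x⁻¹ • b) ∈ U := hW (mk_mem_prod hx hb)
    obtain ⟨k, hk, hkb⟩ := (h.fiber _ _).1 (hπσ _ hy)
    refine ⟨(x * k, πF (x⁻¹ • b)), ⟨mem_univ _, hy⟩, Prod.ext (by simp [hΛ, hk]) ?_⟩
    change (x * k) • σ (πF (x⁻¹ • b)) = b
    rw [mul_smul, ← hkb, smul_inv_smul]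
  have hrank : Module.finrank ℝ (EG × EF') = Module.finrank ℝ (EG' × EF) :=
    le_antisymm (LinearMap.finrank_le_finrank_of_injective (f := L.toLinearMap) hinj)
      (finrank_le_of_image_mem_nhds hopen hΛU himage)
  have hbij : Function.Bijective L :=
    ⟨hinj, (LinearMap.injective_iff_surjective_of_finrank_eq_finrank
      (f := L.toLinearMap) hrank).1 hinj⟩
  obtain ⟨g, hg, hgq, hΛg⟩ :=
    exists_local_inverse (hΛU.contMDiffAt (hopen.mem_nhds hmem)) hL hbij
  have hΛq : Λ (1, πF q) = (1, q) := by simp [hΛ, hm, hσq]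
  rw [hΛq] at hg hgq hΛg
  have hj : ContMDiff 𝓘(ℝ, EF) (𝓘(ℝ, EG').prod 𝓘(ℝ, EF)) ∞ (fun a : F => ((1 : G'), a)) :=
    contMDiff_const.prodMk contMDiff_id
  have hgj : ContMDiffAt 𝓘(ℝ, EF) (𝓘(ℝ, EG).prod 𝓘(ℝ, EF')) ∞ (fun a : F => g (1, a)) q :=
    ContMDiffAt.comp q hg (hj q)
  refine ⟨σ, fun a => (g (1, a)).1, contMDiffAt_fst.comp q hgj, ?_⟩
  filter_upwards [(hj q).continuousAt.eventually hΛg,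
    hgj.continuousAt.preimage_mem_nhds (hopen.mem_nhds (by rw [hgq]; exact hmem))] with a ha haU
  have h1 : f (g (1, a)).1 = 1 := congrArg Prod.fst ha
  have h2 : (g (1, a)).1 • σ (g (1, a)).2 = a := congrArg Prod.snd ha
  have h3 : πF a = (g (1, a)).2 := by
    rw [← hπσ _ haU.2]
    exact ((h.fiber _ _).2 ⟨_, h1, h2.symm⟩).symm
  exact ⟨h1, by rw [h3]; exact h2⟩

/-- Two smooth maps to `F` with the same projection to `F'` differ by a smooth map to the kernel
of `f`. -/
theorem contMDiff_of_smul_eq (h : IsFreeKernelQuotient EG EG' EF EF' f πF)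
    {EP : Type*} [NormedAddCommGroup EP] [NormedSpace ℝ EP]
    {P : Type*} [TopologicalSpace P] [ChartedSpace EP P] {a b : P → F} {k : P → G}
    (ha : ContMDiff 𝓘(ℝ, EP) 𝓘(ℝ, EF) ∞ a) (hb : ContMDiff 𝓘(ℝ, EP) 𝓘(ℝ, EF) ∞ b)
    (hk : ∀ p, f (k p) = 1) (hkab : ∀ p, k p • a p = b p) :
    ContMDiff 𝓘(ℝ, EP) 𝓘(ℝ, EG) ∞ k := by
  intro p₀
  obtain ⟨σ, κ, hκ, hκσ⟩ := h.exists_slice_coordinate (a p₀)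
  set c : P → F := fun p => (k p₀)⁻¹ • b p with hc
  have hcs : ContMDiff 𝓘(ℝ, EP) 𝓘(ℝ, EF) ∞ c := (contMDiff_translation (EG := EG) _).comp hb
  have hc₀ : c p₀ = a p₀ := by rw [hc]; simp only [← hkab, inv_smul_smul]
  have h1 : ContMDiffAt 𝓘(ℝ, EP) 𝓘(ℝ, EG) ∞ (fun p => κ (a p)) p₀ := hκ.comp p₀ (ha p₀)
  have h2 : ContMDiffAt 𝓘(ℝ, EP) 𝓘(ℝ, EG) ∞ (fun p => κ (c p)) p₀ :=
    ContMDiffAt.comp p₀ (by rw [hc₀]; exact hκ) (hcs p₀)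
  have h3 : ContMDiffAt 𝓘(ℝ, EP) 𝓘(ℝ, EG) ∞ (fun p => k p₀ * κ (c p) * (κ (a p))⁻¹) p₀ :=
    (contMDiffAt_const.mul h2).mul h1.inv
  refine h3.congr_of_eventuallyEq ?_
  have hcc : Tendsto c (𝓝 p₀) (𝓝 (a p₀)) := hc₀ ▸ (hcs p₀).continuousAt
  filter_upwards [(ha p₀).continuousAt.eventually hκσ, hcc.eventually hκσ] with p hp hp'
  have h4 : πF (c p) = πF (a p) := by
    refine ((h.fiber _ _).2 ⟨(k p₀)⁻¹ * k p, by simp [hk], ?_⟩).symm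
    rw [mul_smul, hkab]
  refine h.eq_of_smul_eq (a := a p) (hk p) (by simp [hk, hp.1, hp'.1]) ?_
  rw [mul_smul, inv_smul_eq_iff.2 hp.2.symm, hkab, mul_smul, ← h4, hp'.2, hc, smul_inv_smul]

end Infinitesimal

end IsFreeKernelQuotient

end Division

/-! ### Gauge equivalence as an equivalence relation -/

section Equivalence

variable {EG : Type*} [NormedAddCommGroup EG] [NormedSpace ℝ EG]
  {G : Type*} [TopologicalSpace G] [ChartedSpace EG G] [Group G]
  {EGC : Type*} [NormedAddCommGroup EGC] [NormedSpace ℂ EGC]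
  {GC : Type*} [TopologicalSpace GC] [ChartedSpace EGC GC] [Group GC] [LieGroup 𝓘(ℂ, EGC) ω GC]
  {EM : Type*} [NormedAddCommGroup EM] [NormedSpace ℂ EM]
  {M : Type*} [TopologicalSpace M] [ChartedSpace EM M]
  {EP : Type*} [NormedAddCommGroup EP] [NormedSpace ℝ EP]
  {P : Type*} [TopologicalSpace P] [ChartedSpace EP P] [MulAction Gᵐᵒᵖ P]
  [IsManifold 𝓘(ℝ, EP) ∞ P] {ι : G →* GC} {π : P → M}
  {EF : Type*} [NormedAddCommGroup EF] [NormedSpace ℂ EF]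
  {F : Type*} [TopologicalSpace F] [ChartedSpace EF F] [MulAction GC F]

theorem equivalence_gaugeRel (hπ : IsPrincipalBundle EG G EM EP π)
    {K : Set (ComplexGauge EGC EP ι π)} (hone : ∃ k ∈ K, ∀ p, k.lift p = 1)
    (hmul : ∀ g ∈ K, ∀ h ∈ K, ∃ k ∈ K, ∀ p, k.lift p = h.lift p * g.lift p)
    (hinv : ∀ g ∈ K, ∃ k ∈ K, ∀ p, k.lift p = (g.lift p)⁻¹) :
    Equivalence fun x y : SolSpace EG EM EP EF F ι π => ∃ g ∈ K, GaugeRel EM ι π g x.1 y.1 where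
  refl x := by
    obtain ⟨k, hk, hk1⟩ := hone
    exact ⟨k, hk, gaugeRel_one hπ hk1 x.1⟩
  symm := by
    rintro x y ⟨g, hg, hxy⟩
    obtain ⟨k, hk, hkg⟩ := hinv g hg
    exact ⟨k, hk, hxy.inv hπ hkg⟩
  trans := by
    rintro x y z ⟨g, hg, hxy⟩ ⟨h, hh, hyz⟩
    obtain ⟨k, hk, hkgh⟩ := hmul g hg h hh
    exact ⟨k, hk, hxy.mul hπ hkgh hyz⟩

end Equivalence

section Descent

variable {EG : Type*} [NormedAddCommGroup EG] [NormedSpace ℝ EG]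
  {G : Type*} [TopologicalSpace G] [ChartedSpace EG G] [Group G]
  {EGC : Type*} [NormedAddCommGroup EGC] [NormedSpace ℂ EGC]
  {GC : Type*} [TopologicalSpace GC] [ChartedSpace EGC GC] [Group GC] [LieGroup 𝓘(ℂ, EGC) ω GC]
  {EG' : Type*} [NormedAddCommGroup EG'] [NormedSpace ℝ EG']
  {G' : Type*} [TopologicalSpace G'] [ChartedSpace EG' G'] [Group G']
  {EGC' : Type*} [NormedAddCommGroup EGC'] [NormedSpace ℂ EGC']
  {GC' : Type*} [TopologicalSpace GC'] [ChartedSpace EGC' GC'] [Group GC']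
  [LieGroup 𝓘(ℂ, EGC') ω GC']
  {ι : G →* GC} {ι' : G' →* GC'} {πG : G →* G'} {πGC : GC →* GC'}
  {EM : Type*} [NormedAddCommGroup EM] [NormedSpace ℂ EM]
  {M : Type*} [TopologicalSpace M] [ChartedSpace EM M]
  {EP : Type*} [NormedAddCommGroup EP] [NormedSpace ℝ EP]
  {P : Type*} [TopologicalSpace P] [ChartedSpace EP P] [MulAction Gᵐᵒᵖ P]
  {EP' : Type*} [NormedAddCommGroup EP'] [NormedSpace ℝ EP']
  {P' : Type*} [TopologicalSpace P'] [ChartedSpace EP' P'] [MulAction G'ᵐᵒᵖ P']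
  {ζ : P → P'} {π : P → M} {π' : P' → M}
  {EF : Type*} [NormedAddCommGroup EF] [NormedSpace ℂ EF]
  {F : Type*} [TopologicalSpace F] [ChartedSpace EF F] [MulAction GC F]
  {EF' : Type*} [NormedAddCommGroup EF'] [NormedSpace ℂ EF']
  {F' : Type*} [TopologicalSpace F'] [ChartedSpace EF' F'] [MulAction GC' F'] {πF : F → F'}

omit [TopologicalSpace G] [TopologicalSpace GC] [TopologicalSpace G'] [TopologicalSpace GC'] in
theorem map_conjRep (hext : ∀ g, πGC (ι g) = ι' (πG g)) (a : G) (x : GC) :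
    πGC (conjRep ι a x) = conjRep ι' (πG a) (πGC x) := by
  simp only [conjRep_apply, map_mul, map_inv, hext]

omit [TopologicalSpace G] [TopologicalSpace GC] [TopologicalSpace G'] [TopologicalSpace GC']
  [TopologicalSpace F] [TopologicalSpace F'] in
theorem map_actRep (hext : ∀ g, πGC (ι g) = ι' (πG g))
    (hact : ∀ (x : GC) (q : F), πGC x • πF q = πF (x • q)) (a : G) (q : F) :
    πF (actRep F ι a q) = actRep F' ι' (πG a) (πF q) := by
  change πF (ι a • q) = ι' (πG a) • πF q
  rw [← hact, hext]

/-- Complex gauge transformations that come from `P` form a subgroup. -/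
theorem equivalence_gaugeRel_induced (hq : IsBundleQuotient EG EM EP EG' EP' πG ζ π π')
    (hext : ∀ g, πGC (ι g) = ι' (πG g)) [IsManifold 𝓘(ℝ, EP') ∞ P'] :
    Equivalence fun x y : SolSpace EG' EM EP' EF' F' ι' π' =>
      ∃ g' ∈ {g' : ComplexGauge EGC' EP' ι' π' |
        ∃ g : ComplexGauge EGC EP ι π, InducedSection ζ πGC g g'},
        GaugeRel EM ι' π' g' x.1 y.1 := by
  have hπ' := hq.isPrincipalBundle
  have hiff := fun (g : ComplexGauge EGC EP ι π) (g' : ComplexGauge EGC' EP' ι' π') =>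
    inducedSection_iff hq (f := πGC) (map_conjRep hext) (φ := g) (ψ := g')
  apply equivalence_gaugeRel hπ'
  · obtain ⟨k, hk⟩ := exists_complexGauge_one (EGC := EGC) (ι := ι) hq.bundle
    obtain ⟨k', hk'⟩ := exists_complexGauge_one (EGC := EGC') (ι := ι') hπ'
    exact ⟨k', ⟨k, (hiff _ _).2 fun p => by rw [hk, hk', map_one]⟩, hk'⟩
  · rintro g' ⟨g, hg⟩ h' ⟨h, hh⟩
    rw [hiff] at hg hh
    obtain ⟨k, hk⟩ := exists_complexGauge_mul hq.bundle g h
    obtain ⟨k', hk'⟩ := exists_complexGauge_mul hπ' g' h'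
    exact ⟨k', ⟨k, (hiff _ _).2 fun p => by rw [hk, hk', map_mul, hg, hh]⟩, hk'⟩
  · rintro g' ⟨g, hg⟩
    rw [hiff] at hg
    obtain ⟨k, hk⟩ := exists_complexGauge_inv hq.bundle g
    obtain ⟨k', hk'⟩ := exists_complexGauge_inv hπ' g'
    exact ⟨k', ⟨k, (hiff _ _).2 fun p => by rw [hk, hk', map_inv, hg]⟩, hk'⟩

variable [IsManifold 𝓘(ℝ, EP) ∞ P] [IsManifold 𝓘(ℝ, EP') ∞ P']

/-! ### Gauge equivalence upstairs and downstairs -/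

theorem gaugeRel_induced (hq : IsBundleQuotient EG EM EP EG' EP' πG ζ π π')
    (hι : ContMDiff 𝓘(ℝ, EG) 𝓘(ℝ, EGC) ∞ ι) (hι' : ContMDiff 𝓘(ℝ, EG') 𝓘(ℝ, EGC') ∞ ι')
    (hπGC : ContMDiff 𝓘(ℂ, EGC) 𝓘(ℂ, EGC') ω πGC) (hext : ∀ g, πGC (ι g) = ι' (πG g))
    (hact : ∀ (x : GC) (q : F), πGC x • πF q = πF (x • q))
    {x y : Connection EG G EP P × AssocSection EP EF π (actRep F ι)}
    {x' y' : Connection EG' G' EP' P' × AssocSection EP' EF' π' (actRep F' ι')}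
    (hx₁ : InducedConnection πG ζ x.1 x'.1) (hx₂ : InducedSection ζ πF x.2 x'.2)
    (hy₁ : InducedConnection πG ζ y.1 y'.1) (hy₂ : InducedSection ζ πF y.2 y'.2)
    {g : ComplexGauge EGC EP ι π} {g' : ComplexGauge EGC' EP' ι' π'}
    (hg : InducedSection ζ πGC g g') (hxy : GaugeRel EM ι π g x y) :
    GaugeRel EM ι' π' g' x' y' := by
  rw [inducedSection_iff hq (map_conjRep hext)] at hg
  rw [inducedSection_iff hq (map_actRep hext hact)] at hx₂ hy₂
  rw [gaugeRel_iff hq.bundle] at hxy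
  rw [gaugeRel_iff hq.isPrincipalBundle]
  refine ⟨isGaugeTransform_induced hq hι hι' hπGC hext g.lift_smooth g'.lift_smooth hg hx₁ hy₁
    hxy.1, fun p' => ?_⟩
  obtain ⟨p, rfl⟩ := hq.sections_space.surjective p'
  rw [hy₂, hx₂, hg, hxy.2, hact]

variable [ContMDiffSMul 𝓘(ℂ, EGC) 𝓘(ℂ, EF) ω GC F]

omit [TopologicalSpace M] in
/-- If `f_y = g • f_x`, then the covariant derivative of `f_y` with respect to `B` and the translate
by `g` of that of `f_x` with respect to `A` differ by the infinitesimal action of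
`B - (Ad_g ∘ A - (dg) g⁻¹)`. -/
theorem covDeriv_gauge (hι : ContMDiff 𝓘(ℝ, EG) 𝓘(ℝ, EGC) ∞ ι)
    {g : P → GC} (hg : ContMDiff 𝓘(ℝ, EP) 𝓘(ℝ, EGC) ∞ g)
    {x y : Connection EG G EP P × AssocSection EP EF π (actRep F ι)}
    (hxy : ∀ p, y.2.lift p = g p • x.2.lift p) (p : P) (v : EP) :
    cInfAct EGC GC EF (y.2.lift p) (lieMap ι (y.1.form p v) - gaugeForm ι g x.1 p v) =
      covDeriv ι y.1 y.2 p v -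
        dmap EF EF (fun q : F => g p • q) (x.2.lift p) (covDeriv ι x.1 x.2 p v) := by
  have h := dmap_smul_lift (EGC := EGC) (EF := EF) hg x.2.lift_smooth p v
  simp only [← hxy] at h
  rw [covDeriv, covDeriv, h, infAct_eq (EGC := EGC) (EF := EF) hι,
    infAct_eq (EGC := EGC) (EF := EF) hι, map_add,
    dmap_smul_cInfAct (EGC := EGC) (EF := EF), ← hxy, gaugeForm_eq, map_sub, map_sub]
  abel

variable [FiniteDimensional ℂ EGC] [T2Space GC] [SecondCountableTopology GC]
  [FiniteDimensional ℂ EGC'] [T2Space GC']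
  [FiniteDimensional ℂ EF] [IsManifold 𝓘(ℂ, EF) ω F] [T2Space F]
  [FiniteDimensional ℂ EF'] [IsManifold 𝓘(ℂ, EF') ω F'] [SecondCountableTopology F']

/-- A gauge equivalence between induced pairs, by a gauge transformation which is itself induced by
some `g`, lifts to a gauge equivalence between the given pairs: the element `k p` of the kernel of
`πGC` carrying `g p • f_x p` to `f_y p` depends smoothly on `p`, and `k g` is the required
transformation. -/
theorem exists_gaugeRel_of_induced (hq : IsBundleQuotient EG EM EP EG' EP' πG ζ π π')
    (hι : ContMDiff 𝓘(ℝ, EG) 𝓘(ℝ, EGC) ∞ ι) (hι' : ContMDiff 𝓘(ℝ, EG') 𝓘(ℝ, EGC') ∞ ι')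
    (hπGC : ContMDiff 𝓘(ℂ, EGC) 𝓘(ℂ, EGC') ω πGC) (hext : ∀ g, πGC (ι g) = ι' (πG g))
    (hact : ∀ (x : GC) (q : F), πGC x • πF q = πF (x • q))
    (hF : IsFreeKernelQuotient EGC EGC' EF EF' πGC πF)
    {x y : Connection EG G EP P × AssocSection EP EF π (actRep F ι)}
    {x' y' : Connection EG' G' EP' P' × AssocSection EP' EF' π' (actRep F' ι')}
    (hx : DbarEq (EM := EM) ι x.1 x.2) (hy : DbarEq (EM := EM) ι y.1 y.2)
    (hx₁ : InducedConnection πG ζ x.1 x'.1) (hx₂ : InducedSection ζ πF x.2 x'.2)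
    (hy₁ : InducedConnection πG ζ y.1 y'.1) (hy₂ : InducedSection ζ πF y.2 y'.2)
    {g : ComplexGauge EGC EP ι π} {g' : ComplexGauge EGC' EP' ι' π'}
    (hg : InducedSection ζ πGC g g') (hxy : GaugeRel EM ι' π' g' x' y') :
    ∃ k : ComplexGauge EGC EP ι π, GaugeRel EM ι π k x y := by
  have : FiniteDimensional ℝ EGC := FiniteDimensional.complexToReal EGC
  have : FiniteDimensional ℝ EGC' := FiniteDimensional.complexToReal EGC'
  have : FiniteDimensional ℝ EF := FiniteDimensional.complexToReal EF
  have : FiniteDimensional ℝ EF' := FiniteDimensional.complexToReal EF'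
  rw [inducedSection_iff hq (map_conjRep hext)] at hg
  rw [inducedSection_iff hq (map_actRep hext hact)] at hx₂ hy₂
  rw [gaugeRel_iff hq.isPrincipalBundle] at hxy
  have hex : ∀ p, ∃ k : GC, πGC k = 1 ∧ y.2.lift p = k • g.lift p • x.2.lift p := by
    intro p
    rw [← hF.fiber, ← hact, ← hg, ← hx₂, ← hy₂, hxy.2]
  choose k hk hky using hex
  have hgx : ContMDiff 𝓘(ℝ, EP) 𝓘(ℝ, EF) ∞ (fun p => g.lift p • x.2.lift p) :=
    (contMDiff_smul_real (EGC := EGC) (EF := EF)).comp (g.lift_smooth.prodMk x.2.lift_smooth)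
  have hks : ContMDiff 𝓘(ℝ, EP) 𝓘(ℝ, EGC) ∞ k :=
    hF.contMDiff_of_smul_eq hgx y.2.lift_smooth hk fun p => (hky p).symm
  have hkg : ContMDiff 𝓘(ℝ, EP) 𝓘(ℝ, EGC) ∞ (fun p => k p * g.lift p) := hks.mul g.lift_smooth
  have hkequiv : ∀ (a : G) (p : P), k (MulOpposite.op a • p) = conjRep ι a⁻¹ (k p) := by
    intro a p
    refine hF.eq_of_smul_eq (a := g.lift (MulOpposite.op a • p) • x.2.lift (MulOpposite.op a • p))
      (hk _) (by rw [conjRep_apply, map_mul, map_mul, hk, mul_one, ← map_mul, mul_inv_cancel,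
        map_one]) ?_
    rw [← hky, y.2.lift_smul hq.bundle, x.2.lift_smul hq.bundle, g.lift_smul hq.bundle]
    change ι a⁻¹ • y.2.lift p = _ • _ • ι a⁻¹ • x.2.lift p
    simp only [hky, conjRep_apply, smul_smul]
    congr 1
    group
  obtain ⟨h, hh⟩ := AssocSection.exists_of_lift (ρ := conjRep ι) hq.bundle hkg fun a p => by
    rw [hkequiv, g.lift_smul hq.bundle]
    simp only [conjRep_apply]
    group
  refine ⟨h, (gaugeRel_iff hq.bundle).2 ⟨?_, fun p => by rw [hh, hky, smul_smul]⟩⟩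
  rw [funext hh]
  have hlift : ∀ p, y.2.lift p = (k p * g.lift p) • x.2.lift p := fun p => by
    rw [hky, smul_smul]
  intro p v w hvw
  have hr := contMDiff_complexToReal hπGC
  apply hF.eq_zero_of_orbit (q := y.2.lift p)
  · have hgg : ∀ p, g'.lift (ζ p) = πGC (k p * g.lift p) := fun p => by
      rw [hg, map_mul, hk, one_mul]
    have hd : ∀ v, dmap EGC EGC' πGC 1
        (lieMap ι (y.1.form p v) - gaugeForm ι (fun p => k p * g.lift p) x.1 p v) =
        lieMap ι' (y'.1.form (ζ p) (dmap EP EP' ζ p v)) -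
          gaugeForm ι' g'.lift x'.1 (ζ p) (dmap EP EP' ζ p v) := by
      intro v
      rw [map_sub, dmap_lieMap hι hι' hq.sections_group.smooth hr hext, hy₁,
        gaugeForm_induced hq hι hι' hr hext hkg g'.lift_smooth hgg hx₁]
    rw [map_add, dmap_I_smul ((hπGC _).mdifferentiableAt (by simp)), hd, hd]
    exact hxy.1 _ _ _ (by rw [hq.dmap_proj, hq.dmap_proj, hvw])
  · have hc := covDeriv_gauge (EGC := EGC) (EF := EF) hι hkg hlift p
    have hT : MDifferentiableAt 𝓘(ℂ, EF) 𝓘(ℂ, EF) (fun q : F => (k p * g.lift p) • q)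
        (x.2.lift p) :=
      (contMDiff_const_smul_complex (EGC := EGC) (EF := EF) _ _).mdifferentiableAt (by simp)
    change cInfAct EGC GC EF _ _ = 0
    rw [map_add, cInfAct_I_smul, hc, hc, smul_sub, ← dmap_I_smul hT, sub_add_sub_comm, hy p v w hvw,
      ← map_add, hx p v w hvw, map_zero, sub_zero]

end Descent

end Vortex

theorem theorem6
    -- the complex manifold `M`
    {EM : Type*} [NormedAddCommGroup EM] [NormedSpace ℂ EM] [FiniteDimensional ℂ EM]
    {M : Type*} [TopologicalSpace M] [ChartedSpace EM M] [IsManifold 𝓘(ℂ, EM) ω M]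
    [T2Space M] [SecondCountableTopology M]
    -- the compact Lie group `G` and its complexification `ι : G → GC`
    {EG : Type*} [NormedAddCommGroup EG] [NormedSpace ℝ EG] [FiniteDimensional ℝ EG]
    {G : Type*} [TopologicalSpace G] [ChartedSpace EG G] [Group G] [LieGroup 𝓘(ℝ, EG) ∞ G]
    [T2Space G] [SecondCountableTopology G] [CompactSpace G]
    {EGC : Type*} [NormedAddCommGroup EGC] [NormedSpace ℂ EGC] [FiniteDimensional ℂ EGC]
    {GC : Type*} [TopologicalSpace GC] [ChartedSpace EGC GC] [Group GC]
    [LieGroup 𝓘(ℂ, EGC) ω GC] [T2Space GC] [SecondCountableTopology GC]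
    (ι : G →* GC) (hι : Vortex.IsComplexification (EG := EG) (EGC := EGC) ι)
    -- the complex manifold `F` with a holomorphic action of `GC`
    {EF : Type*} [NormedAddCommGroup EF] [NormedSpace ℂ EF] [FiniteDimensional ℂ EF]
    {F : Type*} [TopologicalSpace F] [ChartedSpace EF F] [IsManifold 𝓘(ℂ, EF) ω F]
    [T2Space F] [SecondCountableTopology F]
    [MulAction GC F] [ContMDiffSMul 𝓘(ℂ, EGC) 𝓘(ℂ, EF) ω GC F]
    -- the principal `G`-bundle `π : P → M`
    {EP : Type*} [NormedAddCommGroup EP] [NormedSpace ℝ EP] [FiniteDimensional ℝ EP]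
    {P : Type*} [TopologicalSpace P] [ChartedSpace EP P] [IsManifold 𝓘(ℝ, EP) ∞ P]
    [T2Space P] [SecondCountableTopology P] [MulAction Gᵐᵒᵖ P]
    (π : P → M) (hπ : Vortex.IsPrincipalBundle EG G EM EP π)
    -- the closed normal subgroup `H` of `G`, such that `H_ℂ` acts freely on `F`
    (H : Subgroup G) [H.Normal] (hH : IsClosed (H : Set G))
    (hfree : ∀ x ∈ Vortex.complexifiedSubgroup EG EGC ι H, ∀ q : F, x • q = q → x = 1)
    -- the Lie group `G' = G / H` and its complexification `ι' : G' → GC'`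
    {EG' : Type*} [NormedAddCommGroup EG'] [NormedSpace ℝ EG'] [FiniteDimensional ℝ EG']
    {G' : Type*} [TopologicalSpace G'] [ChartedSpace EG' G'] [Group G'] [LieGroup 𝓘(ℝ, EG') ∞ G']
    [T2Space G'] [SecondCountableTopology G']
    (πG : G →* G')
    (hπG : Vortex.IsManifoldQuotient ℝ EG EG' ∞ (fun g₁ g₂ : G => g₁⁻¹ * g₂ ∈ H) πG)
    {EGC' : Type*} [NormedAddCommGroup EGC'] [NormedSpace ℂ EGC'] [FiniteDimensional ℂ EGC']
    {GC' : Type*} [TopologicalSpace GC'] [ChartedSpace EGC' GC'] [Group GC']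
    [LieGroup 𝓘(ℂ, EGC') ω GC'] [T2Space GC'] [SecondCountableTopology GC']
    (ι' : G' →* GC') (hι' : Vortex.IsComplexification (EG := EG') (EGC := EGC') ι')
    -- the holomorphic extension `πGC : GC → GC'` of `πG`
    (πGC : GC →* GC') (hπGC : ContMDiff 𝓘(ℂ, EGC) 𝓘(ℂ, EGC') ω πGC)
    (hπGC_ext : ∀ g : G, πGC (ι g) = ι' (πG g))
    -- the quotient complex manifold `F' = F / H_ℂ` with the induced action of `GC'`
    {EF' : Type*} [NormedAddCommGroup EF'] [NormedSpace ℂ EF'] [FiniteDimensional ℂ EF']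
    {F' : Type*} [TopologicalSpace F'] [ChartedSpace EF' F'] [IsManifold 𝓘(ℂ, EF') ω F']
    [T2Space F'] [SecondCountableTopology F'] [MulAction GC' F']
    (πF : F → F')
    (hπF : Vortex.IsManifoldQuotient ℂ EF EF' ω
      (fun q₁ q₂ : F => ∃ x ∈ Vortex.complexifiedSubgroup EG EGC ι H, q₂ = x • q₁) πF)
    (hπF_act : ∀ (x : GC) (q : F), πGC x • πF q = πF (x • q))
    -- the quotient manifold `P' = P / H` with the induced action of `G'` and projection to `M`
    {EP' : Type*} [NormedAddCommGroup EP'] [NormedSpace ℝ EP'] [FiniteDimensional ℝ EP']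
    {P' : Type*} [TopologicalSpace P'] [ChartedSpace EP' P'] [IsManifold 𝓘(ℝ, EP') ∞ P']
    [T2Space P'] [SecondCountableTopology P'] [MulAction G'ᵐᵒᵖ P']
    (ζ : P → P')
    (hζ : Vortex.IsManifoldQuotient ℝ EP EP' ∞
      (fun p₁ p₂ : P => ∃ h ∈ H, p₂ = MulOpposite.op h • p₁) ζ)
    (hζ_act : ∀ (g : G) (p : P), MulOpposite.op (πG g) • ζ p = ζ (MulOpposite.op g • p))
    (π' : P' → M) (hπ' : ∀ p : P, π' (ζ p) = π p) :
    -- the map `(A, φ) ↦ (A', φ')` from `Ŝ(P, E)` to `Ŝ(P', E')`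
    ∃ Υ₀ : Vortex.SolSpace EG EM EP EF F ι π → Vortex.SolSpace EG' EM EP' EF' F' ι' π',
      (∀ x, Vortex.InducedConnection πG ζ x.1.1 (Υ₀ x).1.1 ∧
        Vortex.InducedSection ζ πF x.1.2 (Υ₀ x).1.2) ∧
      -- descends to an injective map from `Ŝ(P, E) / 𝒢_ℂ` to `Ŝ(P', E') / π(𝒢_ℂ)`
      ∃ Υ : Vortex.SolQuotient EG EM EP EF F ι π
            (Set.univ : Set (Vortex.ComplexGauge EGC EP ι π)) →
          Vortex.SolQuotient EG' EM EP' EF' F' ι' π'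
            {g' : Vortex.ComplexGauge EGC' EP' ι' π' |
              ∃ g : Vortex.ComplexGauge EGC EP ι π, Vortex.InducedSection ζ πGC g g'},
        (∀ x, Υ (Quot.mk _ x) = Quot.mk _ (Υ₀ x)) ∧ Function.Injective Υ := by
  have hker : ∀ g : G, πG g = 1 ↔ g ∈ H := fun g => by
    rw [← map_one πG, eq_comm, hπG.fiber, inv_one, one_mul]
  have hKer := Vortex.complexifiedSubgroup_eq_ker H hker hι hι' hπG.submersion.contMDiff hπGC
    hπGC_ext
  have hsG := hπG.hasLocalSections_real
  have hq : Vortex.IsBundleQuotient EG EM EP EG' EP' πG ζ π π' :=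
    { bundle := hπ
      sections_group := hsG
      sections_space := hζ.hasLocalSections_real
      fiber := fun p q => by simp only [hζ.fiber, hker]
      map_smul := fun g p => (hζ_act g p).symm
      proj := hπ' }
  have hF : Vortex.IsFreeKernelQuotient EGC EGC' EF EF' πGC πF :=
    { smooth_hom := Vortex.contMDiff_complexToReal hπGC
      hom_surjective := Vortex.dmap_holomorphic_extension_surjective hι.smooth hι' hsG.smooth
        (hsG.dmap_surjective 1) hπGC hπGC_ext
      sections := hπF.hasLocalSections_complex
      fiber := fun a b => by simp only [hπF.fiber, hKer, MonoidHom.mem_ker]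
      free := fun x a hx => hfree x (by rw [hKer]; exact hx) a }
  have hFr := hF.sections.smooth
  have hact : ∀ (g : G) (q : F), ι' (πG g) • πF q = πF (ι g • q) := fun g q => by
    rw [← hπGC_ext, hπF_act]
  have hex : ∀ x : Vortex.SolSpace EG EM EP EF F ι π,
      ∃ y : Vortex.SolSpace EG' EM EP' EF' F' ι' π',
        Vortex.InducedConnection πG ζ x.1.1 y.1.1 ∧ Vortex.InducedSection ζ πF x.1.2 y.1.2 := by
    intro x
    obtain ⟨A', hA'⟩ := Vortex.exists_inducedConnection hq x.1.1
    obtain ⟨φ', hφ'⟩ := Vortex.exists_inducedSection (ρ' := Vortex.actRep F' ι') hq hFr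
      (Vortex.map_actRep hπGC_ext hπF_act) x.1.2
    refine ⟨⟨(A', φ'), Vortex.dbarEq_induced (EGC := EGC) hq hι.smooth hπF.submersion.contMDiff
      hact hA' ((Vortex.inducedSection_iff hq (Vortex.map_actRep hπGC_ext hπF_act)).1 hφ') x.2.1,
      Vortex.curvatureZeroTwo_induced hq hA' x.2.2⟩, hA', hφ'⟩
  choose Υ₀ hΥ₀ using hex
  refine ⟨Υ₀, hΥ₀, Quot.lift (fun x => Quot.mk _ (Υ₀ x)) ?_, fun x => rfl, ?_⟩
  · rintro x y ⟨g, -, hxy⟩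
    obtain ⟨g', hg'⟩ := Vortex.exists_inducedSection (ρ' := Vortex.conjRep ι') hq
      (Vortex.contMDiff_complexToReal hπGC) (Vortex.map_conjRep hπGC_ext) g
    exact Quot.sound ⟨g', ⟨g, hg'⟩, Vortex.gaugeRel_induced hq hι.smooth hι'.smooth hπGC hπGC_ext
      hπF_act (hΥ₀ x).1 (hΥ₀ x).2 (hΥ₀ y).1 (hΥ₀ y).2 hg' hxy⟩
  · rintro ⟨x⟩ ⟨y⟩ hxy
    obtain ⟨g', ⟨g, hg⟩, h⟩ := (Vortex.equivalence_gaugeRel_induced hq hπGC_ext).eqvGen_iff.1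
      (Quot.eqvGen_exact hxy)
    obtain ⟨k, hk⟩ := Vortex.exists_gaugeRel_of_induced hq hι.smooth hι'.smooth hπGC hπGC_ext
      hπF_act hF x.2.1 y.2.1 (hΥ₀ x).1 (hΥ₀ x).2 (hΥ₀ y).1 (hΥ₀ y).2 hg h
    exact Quot.sound ⟨k, Set.mem_univ k, hk⟩
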